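/- **Setting.** Work in an arbitrary virtual equipment $\mathbb X$: a virtual double category (objects; tight-cells $A \to B$, which form a category; loose-cells; and 2-cells with source a finite composable chain of loose-cells, target a single loose-cell, and tight-cells as left and right boundaries) in which every object $A$ has a loose-identity $A(1,1)$ and every loose-cell $p$ has all restrictions $p(f,g)$ along tight-cells. Write $E(f,g)$ for the restriction of $E(1,1)$ along $f$ and $g$; these loose-cells have identities $\langle\rangle \Rightarrow E(f,f)$ and compositions $E(f,g), E(g,h) \Rightarrow E(f,h)$, written $;$. A 2-cell $f \Rightarrow g$ between tight-cells into $E$ is a 2-cell $\langle\rangle \Rightarrow E(f,g)$ with identity boundaries. All 2-cells below between loose-cells of the form $E(f,g)$ have identity boundaries. The composite of tight-cells $f$ and $g$, in diagrammatic order, is written $f;g$. **Definitions.** * An *adjunction* $\ell \dashv r$, with $\ell \colon E \to C$ and $r \colon C \to E$, consists of mutually inverse 2-cells $\sharp \colon C(\ell,1) \Rightarrow E(1,r)$ and $\flat \colon E(1,r) \Rightarrow C(\ell,1)$. * A *monad* $T$ on $E$ consists of a tight-cell $t \colon E \to E$ and 2-cells $\eta \colon 1 \Rightarrow t$ and $\dagger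 \colon E(1,t) \Rightarrow E(t,t)$ with $\eta ; f^\dagger = f$, $\eta^\dagger = 1$ and $(f ; g^\dagger)^\dagger = f^\dagger ; g^\dagger$ (equations between 2-cells, written on generalised elements). An adjunction $\ell \dashv r$ induces a monad with $t = (\ell ; r)$, with $\eta$ the transpose of the identity of $\ell$, and with $\dagger$ the composite $E(1,(\ell;r)) \Rightarrow C(\ell,\ell) \Rightarrow E((\ell;r),(\ell;r))$ of transposition and the action of $r$. * A *$T$-algebra* with domain $D$ is a tight-cell $e \colon D \to E$ with a 2-cell $\rtimes \colon E(1,e) \Rightarrow E(t,e)$ such that $\eta ; f^\rtimes = f$ and $(f ; g^\rtimes)^\rtimes = f^\dagger ; g^\rtimes$. For $T$-algebras $(e,\rtimes)$ and $(e',\rtimes')$ with domains $D$ and $D'$ and a chain $p_1,\dots,p_n$ of loose-cells from $D'$ to $D$, a *graded algebra morphism* is a 2-cell $\varepsilon \colon p_1,\dots,p_n \Rightarrow E(e,e')$ with $(f;\varepsilon)^{\rtimes'} = f^\rtimes ; \varepsilon$. If $\ell \dashv r$ induces $T$, then $r$ is a $T$-algebra, with $\rtimes$ the composite $E(1,r)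 \Rightarrow C(\ell,1) \Rightarrow E((\ell;r),r)$. * An *algebra object* for $T$ is a $T$-algebra $(u_T \colon \mathbf{Alg}(T) \to E, \rtimes_T)$ such that (1) for every $T$-algebra $(e \colon D \to E, \rtimes)$ there is a unique tight-cell $x_{e} \colon D \to \mathbf{Alg}(T)$ with $(x_e ; u_T) = e$ and $\rtimes_T(1, x_e) = \rtimes$; and (2) every graded algebra morphism $\varepsilon \colon p_1,\dots,p_n \Rightarrow E(e,e')$ arises, by applying $u_T$, from a unique 2-cell $p_1,\dots,p_n \Rightarrow \mathbf{Alg}(T)(x_e, x_{e'})$. * A tight-cell $r \colon C \to E$ is *strictly* (respectively *non-strictly*) *monadic* when it admits a left adjoint $\ell$, the induced monad $T$ admits an algebra object, and the comparison tight-cell $C \to \mathbf{Alg}(T)$ (the tight-cell $x_r$ of (1) for the $T$-algebra $r$) is an isomorphism (respectively an equivalence, that is, invertible up to invertible 2-cells). **Corollary (Cancellability).** Let $\ell \dashv r$ and $\ell' \dashv r'$ be adjunctions in a virtual equipment $\mathbb X$, with $r \colon C \to D$ and $r' \colon D \to E$, and suppose that the monad on $D$ induced by $\ell \dashv r$ admits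 an algebra object. 1. If $r'$ and $(r ; r') \colon C \to E$ are strictly monadic, then $r$ is strictly monadic. 2. If $r'$ and $(r ; r') \colon C \to E$ are non-strictly monadic, then $r$ is non-strictly monadic. -/

import Mathlib

open CategoryTheory

universe u v w z

namespace FormalCat

/-! ### Chains of loose-cells, rows of 2-cells

Orientation: `L A B` is the type of loose-cells from `B` to `A` (drawn right to left, so that the
values of a distributor `p` are written `p(a, b)`, contravariant in `a` and covariant in `b`). -/

/-- Finite composable chains `p₁, …, pₙ` of loose-cells, `pᵢ : L Aᵢ₋₁ Aᵢ`. -/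
inductive Chain {X : Type u} (L : X → X → Type w) : X → X → Type (max u w)
  | nil (A : X) : Chain L A A
  | cons {A B C : X} (p : L A B) (P : Chain L B C) : Chain L A C

namespace Chain

variable {X : Type u} {L : X → X → Type w}

/-- The chain with one element. -/
abbrev one {A B : X} (p : L A B) : Chain L A B := cons p (nil B)

/-- The chain with two elements. -/
abbrev two {A B C : X} (p : L A B) (q : L B C) : Chain L A C := cons p (one q)

/-- Concatenation of chains. -/
@[reducible] def append : {A B C : X} → Chain L A B → Chain L B C → Chain L A C
  | _, _, _, nil _, Q => Q
  | _, _, _, cons p P, Q => cons p (append P Q)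

theorem append_nil : {A B : X} → (P : Chain L A B) → P.append (nil B) = P
  | _, _, nil _ => rfl
  | _, _, cons p P => congrArg (cons p) (append_nil P)

theorem append_assoc : {A B C D : X} → (P : Chain L A B) → (Q : Chain L B C) →
    (R : Chain L C D) → (P.append Q).append R = P.append (Q.append R)
  | _, _, _, _, nil _, _, _ => rfl
  | _, _, _, _, cons p P, Q, R => congrArg (cons p) (append_assoc P Q R)

end Chain

/-- A row of 2-cells side by side. If the 2-cells `φᵢ` have source the chain `Pᵢ`, target the
loose-cell `qᵢ`, and left and right boundary the tight-cells `fᵢ₋₁`, `fᵢ`, then they form a row from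
the concatenated chain `P₁ ⋯ Pₙ` to the chain `q₁, …, qₙ`, with boundary `f₀`, `fₙ`.
(A row of length `0` is just a tight-cell.) -/
inductive Row {X : Type u} [Category.{v} X] {L : X → X → Type w}
    (Cell : ∀ ⦃A B A' B' : X⦄, Chain L A B → L A' B' → (A ⟶ A') → (B ⟶ B') → Type z) :
    ∀ {A B A' B' : X}, Chain L A B → Chain L A' B' → (A ⟶ A') → (B ⟶ B') → Type (max u v w z)
  | nil {A A' : X} (f : A ⟶ A') : Row Cell (.nil A) (.nil A') f f
  | cons {A B C A' B' C' : X} {P : Chain L A B} {q : L A' B'} {f : A ⟶ A'} {g : B ⟶ B'}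
      {P' : Chain L B C} {Q' : Chain L B' C'} {h : C ⟶ C'} {P'' : Chain L A C}
      (φ : Cell P q f g) (Φ : Row Cell P' Q' g h) (e : P'' = P.append P') :
      Row Cell P'' (.cons q Q') f h

/-- Concatenation of rows. (As for `Row.cons`, the source and the target of the result may be any
chains equal to the concatenated ones.) -/
def Row.append {X : Type u} [Category.{v} X] {L : X → X → Type w}
    {Cell : ∀ ⦃A B A' B' : X⦄, Chain L A B → L A' B' → (A ⟶ A') → (B ⟶ B') → Type z} :
    ∀ {A B C A' B' C' : X} {P : Chain L A B} {Q : Chain L A' B'} {f : A ⟶ A'} {g : B ⟶ B'}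
      {P' : Chain L B C} {Q' : Chain L B' C'} {h : C ⟶ C'} {P'' : Chain L A C}
      {Q'' : Chain L A' C'}, Row Cell P Q f g → Row Cell P' Q' g h →
      P'' = P.append P' → Q'' = Q.append Q' → Row Cell P'' Q'' f h
  | _, _, _, _, _, _, _, _, _, _, _, _, _, _, _, .nil _, Ψ, eP, eQ => by
      rw [eP, eQ]; exact Ψ
  | _, _, _, _, _, _, _, _, _, _, _, _, _, _, _, .cons φ Φ e, Ψ, eP, eQ => by
      rw [eQ]
      exact .cons φ (Row.append Φ Ψ rfl rfl) (by rw [eP, e, Chain.append_assoc])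

/-! ### Virtual double categories -/

/-- The data of a virtual double category: objects and tight-cells (a category), loose-cells,
2-cells, identity 2-cells, and the composite of a row of 2-cells with a 2-cell below it.

So that no transport along equalities of tight-cells is ever needed, the boundary of a
composite 2-cell is allowed to be any pair of tight-cells *equal* to the composites of the
boundaries. -/
class VirtualDoubleStruct (X : Type u) extends Category.{v} X where
  /-- Loose-cells; `Loose A B` consists of the loose-cells from `B` to `A`. -/
  Loose : X → X → Type w
  /-- 2-cells with source `P`, target `q`, left boundary `f` and right boundary `g`. -/
  Cell : ∀ ⦃A B A' B' : X⦄, Chain Loose A B → Loose A' B' → (A ⟶ A') → (B ⟶ B') → Type z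
  /-- Identity 2-cells. -/
  idCell : ∀ {A B : X} (p : Loose A B), Cell (Chain.one p) p (𝟙 A) (𝟙 B)
  /-- Composition of 2-cells. -/
  compCell : ∀ {A B A' B' A'' B'' : X} {P : Chain Loose A B} {Q : Chain Loose A' B'}
    {r : Loose A'' B''} {f : A ⟶ A'} {g : B ⟶ B'} {f' : A' ⟶ A''} {g' : B' ⟶ B''}
    {F : A ⟶ A''} {G : B ⟶ B''}, Row Cell P Q f g → Cell Q r f' g' →
    f ≫ f' = F → g ≫ g' = G → Cell P r F G

open VirtualDoubleStruct

section Rows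

variable {X : Type u} [VirtualDoubleStruct.{u, v, w, z} X]

/-- The row consisting of a single 2-cell. -/
def Row.one {A B A' B' : X} {P : Chain Loose A B} {q : Loose A' B'} {f : A ⟶ A'} {g : B ⟶ B'}
    (φ : Cell P q f g) : Row Cell P (Chain.one q) f g :=
  .cons φ (.nil g) (Chain.append_nil P).symm

/-- The row consisting of two 2-cells. -/
def Row.two {A B C A' B' C' : X} {P : Chain Loose A B} {Q : Chain Loose B C}
    {p : Loose A' B'} {q : Loose B' C'} {f : A ⟶ A'} {g : B ⟶ B'} {h : C ⟶ C'}
    (φ : Cell P p f g) (ψ : Cell Q q g h) : Row Cell (P.append Q) (Chain.two p q) f h :=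
  .cons φ (.one ψ) rfl

/-- The row of identity 2-cells on a chain. -/
def Row.id : {A B : X} → (P : Chain Loose A B) → Row Cell P P (𝟙 A) (𝟙 B)
  | _, _, .nil A => .nil (𝟙 A)
  | _, _, .cons p P => .cons (idCell p) (Row.id P) rfl

/-- `RowComp Φ Ψ Θ` says that `Θ` is the row obtained by composing the row `Φ` with the row `Ψ`
below it, that is: if `Ψ = (ψ₁, …, ψₙ)` and `Φ` is the concatenation of rows `Φ₁, …, Φₙ` where `Φᵢ`
ends in the source of `ψᵢ`, then `Θ` consists of the composites of `Φᵢ` with `ψᵢ`. -/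
inductive RowComp : ∀ {A B A' B' A'' B'' : X} {P : Chain Loose A B} {Q : Chain Loose A' B'}
    {R : Chain Loose A'' B''} {f : A ⟶ A'} {g : B ⟶ B'} {f' : A' ⟶ A''} {g' : B' ⟶ B''}
    {F : A ⟶ A''} {G : B ⟶ B''},
    Row Cell P Q f g → Row Cell Q R f' g' → Row Cell P R F G → Prop
  | nil {A A' A'' : X} {f : A ⟶ A'} {f' : A' ⟶ A''} {F : A ⟶ A''} (hf : f ≫ f' = F) :
      RowComp (Row.nil f) (Row.nil f') (Row.nil F)
  | cons {A B C A' B' C' A'' B'' C'' : X} {P : Chain Loose A B} {P' : Chain Loose B C}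
      {Q : Chain Loose A' B'} {Q' : Chain Loose B' C'} {r : Loose A'' B''}
      {R' : Chain Loose B'' C''} {P'' : Chain Loose A C} {Q'' : Chain Loose A' C'} {f : A ⟶ A'} {g : B ⟶ B'} {h : C ⟶ C'} {f' : A' ⟶ A''}
      {g' : B' ⟶ B''} {h' : C' ⟶ C''} {F : A ⟶ A''} {G : B ⟶ B''} {H : C ⟶ C''}
      {Φ : Row Cell P Q f g} {ψ : Cell Q r f' g'} (hf : f ≫ f' = F) (hg : g ≫ g' = G)
      {Φ' : Row Cell P' Q' g h} {Ψ' : Row Cell Q' R' g' h'} {Θ' : Row Cell P' R' G H}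
      (hrest : RowComp Φ' Ψ' Θ') (eP : P'' = P.append P') (eQ : Q'' = Q.append Q') :
      RowComp (Φ.append Φ' eP eQ) (.cons ψ Ψ' eQ) (.cons (compCell Φ ψ hf hg) Θ' eP)

end Rows

/-- Virtual double categories. -/
class VirtualDoubleCategory (X : Type u) extends VirtualDoubleStruct.{u, v, w, z} X where
  id_compCell : ∀ {A B A' B' : X} {P : Chain Loose A B} {q : Loose A' B'} {f : A ⟶ A'} {g : B ⟶ B'}
    (φ : Cell P q f g), compCell (Row.id P) φ (Category.id_comp f) (Category.id_comp g) = φ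
  compCell_id : ∀ {A B A' B' : X} {P : Chain Loose A B} {q : Loose A' B'} {f : A ⟶ A'} {g : B ⟶ B'}
    (φ : Cell P q f g),
    compCell (Row.one φ) (idCell q) (Category.comp_id f) (Category.comp_id g) = φ
  compCell_assoc : ∀ {A₁ B₁ A₂ B₂ A₃ B₃ A₄ B₄ : X} {P : Chain Loose A₁ B₁} {Q : Chain Loose A₂ B₂}
    {R : Chain Loose A₃ B₃} {s : Loose A₄ B₄} {f₁ : A₁ ⟶ A₂} {g₁ : B₁ ⟶ B₂} {f₂ : A₂ ⟶ A₃}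
    {g₂ : B₂ ⟶ B₃} {f₃ : A₃ ⟶ A₄} {g₃ : B₃ ⟶ B₄} {f₁₂ : A₁ ⟶ A₃} {g₁₂ : B₁ ⟶ B₃}
    {f₂₃ : A₂ ⟶ A₄} {g₂₃ : B₂ ⟶ B₄} {F : A₁ ⟶ A₄} {G : B₁ ⟶ B₄}
    {Φ : Row Cell P Q f₁ g₁} {Ψ : Row Cell Q R f₂ g₂} {Θ : Row Cell P R f₁₂ g₁₂}
    (_ : RowComp Φ Ψ Θ) (χ : Cell R s f₃ g₃)
    (hf : f₁₂ ≫ f₃ = F) (hg : g₁₂ ≫ g₃ = G) (hf₂ : f₂ ≫ f₃ = f₂₃) (hg₂ : g₂ ≫ g₃ = g₂₃)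
    (hf₁ : f₁ ≫ f₂₃ = F) (hg₁ : g₁ ≫ g₂₃ = G),
    compCell Θ χ hf hg = compCell Φ (compCell Ψ χ hf₂ hg₂) hf₁ hg₁

section Universal

variable {X : Type u} [VirtualDoubleStruct.{u, v, w, z} X]

/-- A 2-cell `φ : P ⇒ q` with identity boundary is opcartesian when, for all chains `S` and `S'`,
every 2-cell with source `S, P, S'` factors uniquely through `φ`. -/
def IsOpcartesian {A B : X} {P : Chain Loose A B} {q : Loose A B}
    (φ : Cell P q (𝟙 A) (𝟙 B)) : Prop :=
  ∀ {A₀ B₀ A₁ B₁ : X} (S : Chain Loose A₀ A) (S' : Chain Loose B B₀) (s : Loose A₁ B₁)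
    (f : A₀ ⟶ A₁) (g : B₀ ⟶ B₁) (χ : Cell (S.append (P.append S')) s f g),
    ∃! ψ : Cell (S.append (.cons q S')) s f g,
      compCell ((Row.id S).append (.cons φ (Row.id S') rfl) rfl rfl) ψ
        (Category.id_comp f) (Category.id_comp g) = χ

/-- A 2-cell `κ : p' ⇒ p` with boundary `f`, `g` is cartesian, i.e. exhibits `p'` as the
restriction `p(f, g)`, when every 2-cell into `p` whose boundary factors through `f` and `g`
factors uniquely through `κ`. -/
def IsCartesian {A B A' B' : X} {p' : Loose A B} {p : Loose A' B'} {f : A ⟶ A'} {g : B ⟶ B'}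
    (κ : Cell (Chain.one p') p f g) : Prop :=
  ∀ {A₀ B₀ : X} (P : Chain Loose A₀ B₀) (h : A₀ ⟶ A) (k : B₀ ⟶ B)
    (χ : Cell P p (h ≫ f) (k ≫ g)),
    ∃! ψ : Cell P p' h k, compCell (Row.one ψ) κ rfl rfl = χ

end Universal

/-! ### Virtual equipments -/

/-- Virtual equipments: virtual double categories with loose-identities `A(1, 1)` and
restrictions `p(f, g)`. -/
class VirtualEquipment (X : Type u) extends VirtualDoubleCategory.{u, v, w, z} X where
  /-- The loose-identity `A(1, 1)`. -/
  unit : ∀ A : X, Loose A A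
  unitCell : ∀ A : X, Cell (Chain.nil A) (unit A) (𝟙 A) (𝟙 A)
  unitCell_isOpcartesian : ∀ A : X, IsOpcartesian (P := Chain.nil A) (q := unit A) (unitCell A)
  /-- The restriction `p(f, g)`. -/
  restr : ∀ {A B A' B' : X} (_p : Loose A' B') (_f : A ⟶ A') (_g : B ⟶ B'), Loose A B
  restrCell : ∀ {A B A' B' : X} (p : Loose A' B') (f : A ⟶ A') (g : B ⟶ B'),
    Cell (Chain.one (restr p f g)) p f g
  restrCell_isCartesian : ∀ {A B A' B' : X} (p : Loose A' B') (f : A ⟶ A') (g : B ⟶ B'),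
    IsCartesian (p' := restr p f g) (p := p) (f := f) (g := g) (restrCell p f g)

open VirtualEquipment

section Basic

variable {X : Type u} [VirtualEquipment.{u, v, w, z} X]

/-- 2-cells whose left and right boundaries are identities. -/
abbrev Glob {A B : X} (P : Chain Loose A B) (q : Loose A B) : Type z := Cell P q (𝟙 A) (𝟙 B)

/-- Composition of 2-cells with a single loose-cell in between. -/
def comp₁ {A B A' B' A'' B'' : X} {P : Chain Loose A B} {q : Loose A' B'} {r : Loose A'' B''}
    {f : A ⟶ A'} {g : B ⟶ B'} {f' : A' ⟶ A''} {g' : B' ⟶ B''} {F : A ⟶ A''} {G : B ⟶ B''}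
    (φ : Cell P q f g) (ψ : Cell (Chain.one q) r f' g') (hf : f ≫ f' = F) (hg : g ≫ g' = G) :
    Cell P r F G := compCell (Row.one φ) ψ hf hg

/-- Composition of a row of two 2-cells with a binary 2-cell. -/
def comp₂ {A B C A' B' C' A'' B'' : X} {P : Chain Loose A B} {Q : Chain Loose B C}
    {p : Loose A' B'} {q : Loose B' C'} {r : Loose A'' B''} {f : A ⟶ A'} {g : B ⟶ B'} {h : C ⟶ C'}
    {f' : A' ⟶ A''} {h' : C' ⟶ B''} {F : A ⟶ A''} {H : C ⟶ B''}
    (φ : Cell P p f g) (φ' : Cell Q q g h) (ψ : Cell (Chain.two p q) r f' h')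
    (hf : f ≫ f' = F) (hh : h ≫ h' = H) : Cell (P.append Q) r F H :=
  compCell (Row.two φ φ') ψ hf hh

/-- `comp₁` for 2-cells with identity boundary. -/
def gcomp {A B : X} {P : Chain Loose A B} {q r : Loose A B} (φ : Glob P q)
    (ψ : Glob (Chain.one q) r) : Glob P r :=
  comp₁ φ ψ (Category.id_comp _) (Category.id_comp _)

/-- `comp₂` for 2-cells with identity boundary. -/
def gcomp₂ {A B C : X} {P : Chain Loose A B} {Q : Chain Loose B C} {p : Loose A B} {q : Loose B C}
    {r : Loose A C} (φ : Glob P p) (φ' : Glob Q q) (ψ : Glob (Chain.two p q) r) :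
    Glob (P.append Q) r :=
  comp₂ φ φ' ψ (Category.id_comp _) (Category.id_comp _)

/-- The factorisation of a 2-cell through the cartesian 2-cell of a restriction. -/
noncomputable def lift {A₀ B₀ A B A' B' : X} {p : Loose A' B'} {P : Chain Loose A₀ B₀}
    (f : A ⟶ A') (g : B ⟶ B') (h : A₀ ⟶ A) (k : B₀ ⟶ B) {F : A₀ ⟶ A'} {G : B₀ ⟶ B'}
    (χ : Cell P p F G) (hF : h ≫ f = F) (hG : k ≫ g = G) : Cell P (restr p f g) h k :=
  (restrCell_isCartesian p f g P h k (by subst hF hG; exact χ)).choose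

/-- The loose-cell `E(f, g)`, the restriction of the loose-identity of `E`. -/
abbrev homL {A B E : X} (f : A ⟶ E) (g : B ⟶ E) : Loose A B := restr (unit E) f g

/-- The cartesian 2-cell from `E(f, g)` to `E(1, 1)`. -/
abbrev homCart {A B E : X} (f : A ⟶ E) (g : B ⟶ E) : Cell (Chain.one (homL f g)) (unit E) f g :=
  restrCell (unit E) f g

/-- The 2-cell with empty source corresponding to the identity of the tight-cell `f`. -/
def oneCell {A E : X} (f : A ⟶ E) : Cell (Chain.nil A) (unit E) f f :=
  compCell (Row.nil f) (unitCell E) (Category.comp_id f) (Category.comp_id f)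

/-- The multiplication `E(1, 1), E(1, 1) ⇒ E(1, 1)`, i.e. the 2-cell whose composite with the unit
in the left variable is the identity. -/
noncomputable def mulCell (E : X) : Glob (Chain.two (unit E) (unit E)) (unit E) :=
  (unitCell_isOpcartesian E (Chain.nil E) (Chain.one (unit E)) (unit E) (𝟙 E) (𝟙 E)
    (idCell (unit E))).choose

/-- The action `C(1, 1) ⇒ E(1, 1)` of a tight-cell `u : C → E`. -/
noncomputable def mapCell {C E : X} (u : C ⟶ E) : Cell (Chain.one (unit C)) (unit E) u u :=
  (unitCell_isOpcartesian C (Chain.nil C) (Chain.nil C) (unit E) u u (oneCell u)).choose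

/-- The identity `⟨⟩ ⇒ E(f, f)`. -/
noncomputable def ident {A E : X} (f : A ⟶ E) : Glob (Chain.nil A) (homL f f) :=
  lift f f (𝟙 A) (𝟙 A) (oneCell f) (Category.id_comp f) (Category.id_comp f)

/-- The composition `E(f, g), E(g, h) ⇒ E(f, h)`. -/
noncomputable def mul {A B C E : X} (f : A ⟶ E) (g : B ⟶ E) (h : C ⟶ E) :
    Glob (Chain.two (homL f g) (homL g h)) (homL f h) :=
  lift f h (𝟙 A) (𝟙 C)
    (comp₂ (homCart f g) (homCart g h) (mulCell E) (Category.comp_id f) (Category.comp_id h))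
    (Category.id_comp f) (Category.id_comp h)

/-- The action `C(f, g) ⇒ E((f ; u), (g ; u))` of a tight-cell `u : C → E`. -/
noncomputable def act {A B C E : X} (f : A ⟶ C) (g : B ⟶ C) (u : C ⟶ E) {f' : A ⟶ E} {g' : B ⟶ E}
    (hf : f ≫ u = f') (hg : g ≫ u = g') : Glob (Chain.one (homL f g)) (homL f' g') :=
  lift f' g' (𝟙 A) (𝟙 B) (comp₁ (homCart f g) (mapCell u) hf hg)
    (Category.id_comp f') (Category.id_comp g')

/-- The restriction `φ(1, x) : B(f, (x ; g)) ⇒ E(h, (x ; k))` of a 2-cell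
`φ : B(f, g) ⇒ E(h, k)` along a tight-cell `x`: the unique 2-cell compatible with `φ` and with
the cartesian 2-cells (over `1` and `x`) from `B(f, (x ; g))` to `B(f, g)` and from `E(h, (x ; k))`
to `E(h, k)`. -/
noncomputable def restrictR {A Y Y' B E : X} {f : A ⟶ B} {g : Y ⟶ B} {h : A ⟶ E} {k : Y ⟶ E}
    (φ : Glob (Chain.one (homL f g)) (homL h k)) (x : Y' ⟶ Y) {g' : Y' ⟶ B} {k' : Y' ⟶ E}
    (hg : x ≫ g = g') (hk : x ≫ k = k') : Glob (Chain.one (homL f g')) (homL h k') :=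
  lift h k' (𝟙 A) (𝟙 Y')
    (comp₁ (lift f g (𝟙 A) x (homCart f g') (Category.id_comp f) hg)
      (comp₁ φ (homCart h k) (Category.id_comp h) (Category.id_comp k)) (Category.id_comp h) hk)
    (Category.id_comp h) (Category.id_comp k')

end Basic

section Lemmas

variable {X : Type u} [VirtualEquipment.{u, v, w, z} X]

open VirtualDoubleCategory

theorem Row.cons_heq {A B C A' B' C' : X} {P : Chain Loose A B} {q : Loose A' B'} {f : A ⟶ A'}
    {g : B ⟶ B'} {P₁ P₂ : Chain Loose B C} {Q₁ Q₂ : Chain Loose B' C'} {h : C ⟶ C'}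
    {P₁' P₂' : Chain Loose A C} (φ : Cell P q f g) {Φ₁ : Row Cell P₁ Q₁ g h}
    {Φ₂ : Row Cell P₂ Q₂ g h} (hP : P₁ = P₂) (hQ : Q₁ = Q₂) (hΦ : Φ₁ ≍ Φ₂)
    (e₁ : P₁' = P.append P₁) (e₂ : P₂' = P.append P₂) :
    Row.cons φ Φ₁ e₁ ≍ Row.cons φ Φ₂ e₂ := by
  subst hP hQ e₁ e₂ hΦ
  rfl

theorem Row.append_nil_heq {A B A' B' : X} {P : Chain Loose A B} {Q : Chain Loose A' B'} {f : A ⟶ A'}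
    {g : B ⟶ B'} (Φ : Row Cell P Q f g) {P'' : Chain Loose A B} {Q'' : Chain Loose A' B'}
    (eP : P'' = P.append (Chain.nil B)) (eQ : Q'' = Q.append (Chain.nil B')) :
    Φ.append (Row.nil g) eP eQ ≍ Φ := by
  induction Φ with
  | nil f => subst eP eQ; rfl
  | cons φ Φ e ih =>
    subst eP eQ
    exact Row.cons_heq φ (Chain.append_nil _) (Chain.append_nil _) (ih rfl rfl) _ e

theorem Row.append_nil {A B A' B' : X} {P : Chain Loose A B} {Q : Chain Loose A' B'} {f : A ⟶ A'}
    {g : B ⟶ B'} (Φ : Row Cell P Q f g) (eP : P = P.append (Chain.nil B))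
    (eQ : Q = Q.append (Chain.nil B')) : Φ.append (Row.nil g) eP eQ = Φ :=
  eq_of_heq (Row.append_nil_heq Φ eP eQ)

theorem compCell_comp₁ {A₁ B₁ A₂ B₂ A₃ B₃ A₄ B₄ : X} {P : Chain Loose A₁ B₁} {Q : Chain Loose A₂ B₂}
    {r : Loose A₃ B₃} {s : Loose A₄ B₄} {f₁ : A₁ ⟶ A₂} {g₁ : B₁ ⟶ B₂} {f₂ : A₂ ⟶ A₃}
    {g₂ : B₂ ⟶ B₃} {f₃ : A₃ ⟶ A₄} {g₃ : B₃ ⟶ B₄} {f₁₂ : A₁ ⟶ A₃} {g₁₂ : B₁ ⟶ B₃}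
    {f₂₃ : A₂ ⟶ A₄} {g₂₃ : B₂ ⟶ B₄} {F : A₁ ⟶ A₄} {G : B₁ ⟶ B₄}
    (Φ : Row Cell P Q f₁ g₁) (ψ : Cell Q r f₂ g₂) (χ : Cell (Chain.one r) s f₃ g₃)
    (h₁ : f₁ ≫ f₂ = f₁₂) (h₂ : g₁ ≫ g₂ = g₁₂)
    (hf : f₁₂ ≫ f₃ = F) (hg : g₁₂ ≫ g₃ = G) (hf₂ : f₂ ≫ f₃ = f₂₃) (hg₂ : g₂ ≫ g₃ = g₂₃)
    (hf₁ : f₁ ≫ f₂₃ = F) (hg₁ : g₁ ≫ g₂₃ = G) :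
    comp₁ (compCell Φ ψ h₁ h₂) χ hf hg = compCell Φ (comp₁ ψ χ hf₂ hg₂) hf₁ hg₁ := by
  have := RowComp.cons (Φ := Φ) (ψ := ψ) h₁ h₂ (RowComp.nil (f := g₁) (f' := g₂) h₂)
    (Chain.append_nil P).symm (Chain.append_nil Q).symm
  rw [Row.append_nil] at this
  exact compCell_assoc this χ hf hg hf₂ hg₂ hf₁ hg₁

theorem compCell_comp₂ {A B C A' B' C' A'' B'' C'' D E : X} {P : Chain Loose A B}
    {P' : Chain Loose B C} {p : Loose A' B'} {p' : Loose B' C'}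
    {q : Loose A'' B''} {q' : Loose B'' C''} {s : Loose D E}
    {f₀ : A ⟶ A'} {f₁ : B ⟶ B'} {f₂ : C ⟶ C'} {g₀ : A' ⟶ A''} {g₁ : B' ⟶ B''} {g₂ : C' ⟶ C''}
    {k₀ : A ⟶ A''} {k₁ : B ⟶ B''} {k₂ : C ⟶ C''} {h₀ : A'' ⟶ D} {h₂ : C'' ⟶ E}
    {m₀ : A' ⟶ D} {m₂ : C' ⟶ E} {F : A ⟶ D} {G : C ⟶ E}
    (a : Cell P p f₀ f₁) (b : Cell (Chain.one p) q g₀ g₁)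
    (c : Cell P' p' f₁ f₂) (d : Cell (Chain.one p') q' g₁ g₂) (χ : Cell (Chain.two q q') s h₀ h₂)
    (e₀ : f₀ ≫ g₀ = k₀) (e₁ : f₁ ≫ g₁ = k₁) (e₂ : f₂ ≫ g₂ = k₂)
    (hf : k₀ ≫ h₀ = F) (hg : k₂ ≫ h₂ = G) (hf₂ : g₀ ≫ h₀ = m₀) (hg₂ : g₂ ≫ h₂ = m₂)
    (hf₁ : f₀ ≫ m₀ = F) (hg₁ : f₂ ≫ m₂ = G) :
    comp₂ (comp₁ a b e₀ e₁) (comp₁ c d e₁ e₂) χ hf hg = comp₂ a c (comp₂ b d χ hf₂ hg₂) hf₁ hg₁ := by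
  have h1 := RowComp.cons (Φ := Row.one c) (ψ := d) e₁ e₂ (RowComp.nil (f := f₂) (f' := g₂) e₂)
    (Chain.append_nil P').symm rfl
  have h2 := RowComp.cons (Φ := Row.one a) (ψ := b) e₀ e₁ h1 rfl rfl
  exact compCell_assoc h2 χ hf hg hf₂ hg₂ hf₁ hg₁


theorem comp₁_assoc {A₁ B₁ A₂ B₂ A₃ B₃ A₄ B₄ : X} {P : Chain Loose A₁ B₁} {q : Loose A₂ B₂}
    {r : Loose A₃ B₃} {s : Loose A₄ B₄} {f₁ : A₁ ⟶ A₂} {g₁ : B₁ ⟶ B₂} {f₂ : A₂ ⟶ A₃}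
    {g₂ : B₂ ⟶ B₃} {f₃ : A₃ ⟶ A₄} {g₃ : B₃ ⟶ B₄} {f₁₂ : A₁ ⟶ A₃} {g₁₂ : B₁ ⟶ B₃}
    {f₂₃ : A₂ ⟶ A₄} {g₂₃ : B₂ ⟶ B₄} {F : A₁ ⟶ A₄} {G : B₁ ⟶ B₄}
    (φ : Cell P q f₁ g₁) (ψ : Cell (Chain.one q) r f₂ g₂) (χ : Cell (Chain.one r) s f₃ g₃)
    (h₁ : f₁ ≫ f₂ = f₁₂) (h₂ : g₁ ≫ g₂ = g₁₂)
    (hf : f₁₂ ≫ f₃ = F) (hg : g₁₂ ≫ g₃ = G) (hf₂ : f₂ ≫ f₃ = f₂₃) (hg₂ : g₂ ≫ g₃ = g₂₃)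
    (hf₁ : f₁ ≫ f₂₃ = F) (hg₁ : g₁ ≫ g₂₃ = G) :
    comp₁ (comp₁ φ ψ h₁ h₂) χ hf hg = comp₁ φ (comp₁ ψ χ hf₂ hg₂) hf₁ hg₁ :=
  compCell_comp₁ _ _ _ _ _ _ _ _ _ _ _

theorem comp₂_comp₁ {A B C A' B' C' A'' B'' A₄ B₄ : X} {P : Chain Loose A B} {Q : Chain Loose B C}
    {p : Loose A' B'} {q : Loose B' C'} {r : Loose A'' B''} {s : Loose A₄ B₄}
    {f : A ⟶ A'} {g : B ⟶ B'} {h : C ⟶ C'}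
    {f' : A' ⟶ A''} {h' : C' ⟶ B''} {F : A ⟶ A''} {H : C ⟶ B''} {f₃ : A'' ⟶ A₄} {g₃ : B'' ⟶ B₄}
    {f₂₃ : A' ⟶ A₄} {g₂₃ : C' ⟶ B₄} {F' : A ⟶ A₄} {G' : C ⟶ B₄}
    (φ : Cell P p f g) (φ' : Cell Q q g h) (ψ : Cell (Chain.two p q) r f' h')
    (χ : Cell (Chain.one r) s f₃ g₃) (h₁ : f ≫ f' = F) (h₂ : h ≫ h' = H)
    (hf : F ≫ f₃ = F') (hg : H ≫ g₃ = G') (hf₂ : f' ≫ f₃ = f₂₃) (hg₂ : h' ≫ g₃ = g₂₃)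
    (hf₁ : f ≫ f₂₃ = F') (hg₁ : h ≫ g₂₃ = G') :
    comp₁ (comp₂ φ φ' ψ h₁ h₂) χ hf hg = comp₂ φ φ' (comp₁ ψ χ hf₂ hg₂) hf₁ hg₁ :=
  compCell_comp₁ _ _ _ _ _ _ _ _ _ _ _

theorem comp₁_id {A B A' B' : X} {P : Chain Loose A B} {q : Loose A' B'} {f : A ⟶ A'} {g : B ⟶ B'}
    (φ : Cell P q f g) (hf : f ≫ 𝟙 A' = f) (hg : g ≫ 𝟙 B' = g) :
    comp₁ φ (idCell q) hf hg = φ := compCell_id φ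

theorem id_comp₁ {A B A' B' : X} {p : Loose A B} {q : Loose A' B'} {f : A ⟶ A'} {g : B ⟶ B'}
    (φ : Cell (Chain.one p) q f g) (hf : 𝟙 A ≫ f = f) (hg : 𝟙 B ≫ g = g) :
    comp₁ (idCell p) φ hf hg = φ := id_compCell φ

section Lift

variable {A₀ B₀ A B A' B' : X} {p : Loose A' B'} {P : Chain Loose A₀ B₀}

theorem lift_restrCell
    (f : A ⟶ A') (g : B ⟶ B') (h : A₀ ⟶ A) (k : B₀ ⟶ B) {F : A₀ ⟶ A'} {G : B₀ ⟶ B'}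
    (χ : Cell P p F G) (hF : h ≫ f = F) (hG : k ≫ g = G) :
    comp₁ (lift f g h k χ hF hG) (restrCell p f g) hF hG = χ := by
  subst hF hG
  exact (restrCell_isCartesian p f g P h k χ).choose_spec.1

theorem restr_ext {f : A ⟶ A'} {g : B ⟶ B'} {h : A₀ ⟶ A} {k : B₀ ⟶ B} {F : A₀ ⟶ A'}
    {G : B₀ ⟶ B'} {hF : h ≫ f = F} {hG : k ≫ g = G} {φ ψ : Cell P (restr p f g) h k}
    (e : comp₁ φ (restrCell p f g) hF hG = comp₁ ψ (restrCell p f g) hF hG) : φ = ψ := by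
  subst hF hG
  exact (restrCell_isCartesian p f g P h k _).unique e rfl

end Lift

theorem lift_homCart {A₀ B₀ A B E : X} {P : Chain Loose A₀ B₀}
    (f : A ⟶ E) (g : B ⟶ E) (h : A₀ ⟶ A) (k : B₀ ⟶ B) {F : A₀ ⟶ E} {G : B₀ ⟶ E}
    (χ : Cell P (unit E) F G) (hF : h ≫ f = F) (hG : k ≫ g = G) :
    comp₁ (lift f g h k χ hF hG : Cell P (homL f g) h k) (homCart f g) hF hG = χ :=
  lift_restrCell _ _ _ _ _ _ _

theorem homL_ext {A₀ B₀ A B E : X} {P : Chain Loose A₀ B₀} {f : A ⟶ E} {g : B ⟶ E} {h : A₀ ⟶ A}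
    {k : B₀ ⟶ B} {F : A₀ ⟶ E} {G : B₀ ⟶ E} (hF : h ≫ f = F) (hG : k ≫ g = G)
    {φ ψ : Cell P (homL f g) h k}
    (e : comp₁ φ (homCart f g) hF hG = comp₁ ψ (homCart f g) hF hG) : φ = ψ :=
  restr_ext e

/-! Units -/

theorem unit_mapCell {C E : X} (u : C ⟶ E) (h₁ h₂ : 𝟙 C ≫ u = u) :
    comp₁ (unitCell C) (mapCell u) h₁ h₂ = oneCell u :=
  (unitCell_isOpcartesian C (Chain.nil C) (Chain.nil C) (unit E) u u (oneCell u)).choose_spec.1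

theorem unit_id_mulCell (E : X) (h₁ h₂ : 𝟙 E ≫ 𝟙 E = 𝟙 E) :
    comp₂ (unitCell E) (idCell (unit E)) (mulCell E) h₁ h₂ = idCell (unit E) :=
  (unitCell_isOpcartesian E (Chain.nil E) (Chain.one (unit E)) (unit E) (𝟙 E) (𝟙 E)
    (idCell (unit E))).choose_spec.1

theorem unit_ext {E A' B' : X} {s : Loose A' B'} {f : E ⟶ A'} {g : E ⟶ B'}
    {φ ψ : Cell (Chain.one (unit E)) s f g}
    (e : comp₁ (unitCell E) φ (Category.id_comp f) (Category.id_comp g) =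
      comp₁ (unitCell E) ψ (Category.id_comp f) (Category.id_comp g)) : φ = ψ :=
  (unitCell_isOpcartesian E (Chain.nil E) (Chain.nil E) s f g _).unique e rfl

theorem unit_ext_left {E B A' B' : X} {p : Loose E B} {s : Loose A' B'} {f : E ⟶ A'} {g : B ⟶ B'}
    {φ ψ : Cell (Chain.two (unit E) p) s f g}
    (e : comp₂ (unitCell E) (idCell p) φ (Category.id_comp f) (Category.id_comp g) =
      comp₂ (unitCell E) (idCell p) ψ (Category.id_comp f) (Category.id_comp g)) : φ = ψ :=
  (unitCell_isOpcartesian E (Chain.nil E) (Chain.one p) s f g _).unique e rfl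

theorem unit_ext_right {E B A' B' : X} {p : Loose B E} {s : Loose A' B'} {f : B ⟶ A'} {g : E ⟶ B'}
    {φ ψ : Cell (Chain.two p (unit E)) s f g}
    (e : comp₂ (idCell p) (unitCell E) φ (Category.id_comp f) (Category.id_comp g) =
      comp₂ (idCell p) (unitCell E) ψ (Category.id_comp f) (Category.id_comp g)) : φ = ψ :=
  (unitCell_isOpcartesian E (Chain.one p) (Chain.nil E) s f g _).unique e rfl

theorem oneCell_comp₁ {A C E : X} (x : A ⟶ C) {u : C ⟶ E} {y : A ⟶ E}
    (φ : Cell (Chain.one (unit C)) (unit E) u u)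
    (hφ : comp₁ (unitCell C) φ (Category.id_comp u) (Category.id_comp u) = oneCell u)
    (h₁ h₂ : x ≫ u = y) : comp₁ (oneCell x) φ h₁ h₂ = oneCell y := by
  subst h₁
  rw [oneCell, compCell_comp₁ _ _ _ _ _ _ _ (Category.id_comp u) (Category.id_comp u) rfl rfl, hφ,
    oneCell, oneCell]
  exact (compCell_assoc (RowComp.nil rfl) _ _ _ _ _ _ _).symm

theorem oneCell_mapCell {A C E : X} (x : A ⟶ C) {u : C ⟶ E} {y : A ⟶ E} (h₁ h₂ : x ≫ u = y) :
    comp₁ (oneCell x) (mapCell u) h₁ h₂ = oneCell y :=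
  oneCell_comp₁ x _ (unit_mapCell u _ _) h₁ h₂

theorem oneCell_mulCell {A B E : X} {P : Chain Loose A B} {f : A ⟶ E} {g : B ⟶ E}
    (α : Cell P (unit E) f g) (h₁ : f ≫ 𝟙 E = f) (h₂ : g ≫ 𝟙 E = g) :
    comp₂ (oneCell f) α (mulCell E) h₁ h₂ = α := by
  have r1 := RowComp.cons (Φ := Row.one α) (ψ := idCell (unit E)) h₁ h₂
    (RowComp.nil (f := g) (f' := 𝟙 E) h₂) (Chain.append_nil P).symm rfl
  have r2 := RowComp.cons (Φ := Row.nil f) (ψ := unitCell E) (Category.comp_id f)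
    (Category.comp_id f) r1 rfl rfl
  have := compCell_assoc r2 (mulCell E) h₁ h₂ (Category.id_comp _) (Category.id_comp _) h₁ h₂
  have e : compCell (Row.one α) (idCell (unit E)) h₁ h₂ = α := compCell_id α
  rw [e] at this
  refine Eq.trans this ?_
  refine Eq.trans (congrArg (fun c => compCell _ c h₁ h₂) (unit_id_mulCell E _ _)) ?_
  refine Eq.trans ?_ (compCell_id α)
  congr 1

theorem oneCell_id (E : X) : oneCell (𝟙 E) = unitCell E := id_compCell (unitCell E)

theorem id_unit_mulCell (E : X) (h₁ h₂ : 𝟙 E ≫ 𝟙 E = 𝟙 E) :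
    comp₂ (idCell (unit E)) (unitCell E) (mulCell E) h₁ h₂ = idCell (unit E) := by
  apply unit_ext
  have r1 := RowComp.cons (Φ := Row.nil (𝟙 E)) (ψ := unitCell E) h₁ h₂
    (RowComp.nil (f := 𝟙 E) (f' := 𝟙 E) h₂) rfl rfl
  have r2 := RowComp.cons (Φ := Row.one (unitCell E)) (ψ := idCell (unit E)) h₁ h₂ r1 rfl rfl
  refine (compCell_assoc r2 (mulCell E) h₁ h₂ h₁ h₂ h₁ h₂).symm.trans ?_
  rw [comp₁_id]
  have e : compCell (Row.one (unitCell E)) (idCell (unit E)) h₁ h₂ = unitCell E :=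
    compCell_id (unitCell E)
  have e' : compCell (Row.nil (𝟙 E)) (unitCell E) h₁ h₂ = unitCell E := id_compCell (unitCell E)
  rw [e, e']
  have := oneCell_mulCell (unitCell E) h₁ h₂
  rw [oneCell_id] at this
  exact this

theorem mulCell_oneCell {A B E : X} {p : Loose A B} {f : A ⟶ E} {g : B ⟶ E}
    (α : Cell (Chain.one p) (unit E) f g) (h₁ : f ≫ 𝟙 E = f) (h₂ : g ≫ 𝟙 E = g) :
    comp₂ α (oneCell g) (mulCell E) h₁ h₂ = α := by
  have r1 := RowComp.cons (Φ := Row.nil g) (ψ := unitCell E) (Category.comp_id g)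
    (Category.comp_id g) (RowComp.nil (f := g) (f' := 𝟙 E) h₂) rfl rfl
  have r2 := RowComp.cons (Φ := Row.one α) (ψ := idCell (unit E)) h₁ h₂ r1 rfl rfl
  have := compCell_assoc r2 (mulCell E) h₁ h₂ (Category.id_comp _) (Category.id_comp _) h₁ h₂
  have e : compCell (Row.one α) (idCell (unit E)) h₁ h₂ = α := compCell_id α
  rw [e] at this
  refine Eq.trans this ?_
  refine Eq.trans (congrArg (fun c => compCell _ c h₁ h₂) (id_unit_mulCell E _ _)) ?_
  exact compCell_id α

theorem mulCell_mapCell {C E : X} (u : C ⟶ E) (h₁ h₂ : 𝟙 C ≫ u = u) (h₃ h₄ : u ≫ 𝟙 E = u) :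
    comp₁ (mulCell C) (mapCell u) h₁ h₂ = comp₂ (mapCell u) (mapCell u) (mulCell E) h₃ h₄ := by
  apply unit_ext_left
  rw [← comp₂_comp₁ _ _ _ _ (Category.id_comp _) (Category.id_comp _) h₁ h₂, unit_id_mulCell,
    id_comp₁, ← compCell_comp₂ (unitCell C) _ _ _ _ h₁ h₁ h₂ h₃ h₄, unit_mapCell, id_comp₁,
    oneCell_mulCell]

/-- The right action of `C(1, 1)` on `C(f, 1)`. -/
noncomputable def rightAct {A C : X} (f : A ⟶ C) :
    Glob (Chain.two (homL f (𝟙 C)) (unit C)) (homL f (𝟙 C)) :=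
  lift f (𝟙 C) (𝟙 A) (𝟙 C) (comp₂ (homCart f (𝟙 C)) (idCell (unit C)) (mulCell C)
    (Category.comp_id f) (Category.comp_id _)) (Category.id_comp f) (Category.comp_id _)

theorem id_unit_rightAct {A C : X} (f : A ⟶ C) (h₁ : 𝟙 A ≫ 𝟙 A = 𝟙 A) (h₂ : 𝟙 C ≫ 𝟙 C = 𝟙 C) :
    comp₂ (idCell (homL f (𝟙 C))) (unitCell C) (rightAct f) h₁ h₂ = idCell (homL f (𝟙 C)) := by
  apply homL_ext (Category.id_comp f) (Category.id_comp _)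
  rw [comp₂_comp₁ _ _ _ _ _ _ _ _ (Category.id_comp f) (Category.id_comp _) (Category.id_comp f)
    (Category.id_comp _), rightAct, lift_homCart, id_comp₁,
    ← compCell_comp₂ (idCell (homL f (𝟙 C))) (homCart f (𝟙 C)) (unitCell C) (idCell (unit C))
      (mulCell C) (Category.id_comp _) (Category.id_comp _) (Category.id_comp _)
      (Category.comp_id _) (Category.comp_id _), id_comp₁, comp₁_id, ← oneCell_id, mulCell_oneCell]

theorem rightAct_comp₁ {A C E : X} (f : A ⟶ C) {h : A ⟶ E} {k : C ⟶ E}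
    (φ : Cell (Chain.one (homL f (𝟙 C))) (unit E) h k) (h₁ : 𝟙 A ≫ h = h) (h₂ : 𝟙 C ≫ k = k)
    (h₃ : h ≫ 𝟙 E = h) (h₄ : k ≫ 𝟙 E = k) :
    comp₁ (rightAct f) φ h₁ h₂ = comp₂ φ (mapCell k) (mulCell E) h₃ h₄ := by
  apply unit_ext_right
  rw [← comp₂_comp₁ _ _ _ _ (Category.id_comp _) (Category.id_comp _) h₁ h₂, id_unit_rightAct,
    id_comp₁, ← compCell_comp₂ (idCell _) φ (unitCell C) _ _ h₁ h₂ h₂ h₃ h₄, unit_mapCell,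
    id_comp₁, mulCell_oneCell]

/-- The action of a 2-cell `φ : B(f, g) ⇒ E(h, k)` on 2-cells into `B(f, (x ; g))`. -/
noncomputable def hat {A Y Y' B E : X} {f : A ⟶ B} {g : Y ⟶ B} {h : A ⟶ E} {k : Y ⟶ E}
    (φ : Glob (Chain.one (homL f g)) (homL h k)) (x : Y' ⟶ Y) {g' : Y' ⟶ B} {k' : Y' ⟶ E}
    (hg : x ≫ g = g') (hk : x ≫ k = k') {P : Chain Loose A Y'} (α : Cell P (unit B) f g') :
    Cell P (unit E) h k' :=
  comp₁ (lift f g (𝟙 A) x α (Category.id_comp f) hg : Cell P (homL f g) (𝟙 A) x)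
    (comp₁ φ (homCart h k) (Category.id_comp h) (Category.id_comp k)) (Category.id_comp h) hk

section Hat

variable {A Y Y' B E : X} {f : A ⟶ B} {g : Y ⟶ B} {h : A ⟶ E} {k : Y ⟶ E}

theorem gcomp_restrictR
    (φ : Glob (Chain.one (homL f g)) (homL h k)) (x : Y' ⟶ Y) {g' : Y' ⟶ B} {k' : Y' ⟶ E}
    (hg : x ≫ g = g') (hk : x ≫ k = k') {P : Chain Loose A Y'} (α : Glob P (homL f g')) :
    comp₁ (gcomp α (restrictR φ x hg hk)) (homCart h k') (Category.id_comp h)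
      (Category.id_comp k') =
    hat φ x hg hk (comp₁ α (homCart f g') (Category.id_comp f) (Category.id_comp g')) := by
  rw [gcomp, comp₁_assoc _ _ _ _ _ _ _ (Category.id_comp h) (Category.id_comp k')
    (Category.id_comp h) (Category.id_comp k'), restrictR, lift_homCart,
    ← comp₁_assoc _ _ _ (Category.id_comp _) (Category.id_comp _) (Category.id_comp h) hk, hat]
  congr 1
  apply homL_ext (Category.id_comp f) hg
  rw [lift_homCart, comp₁_assoc _ _ _ _ _ _ _ (Category.id_comp f) hg (Category.id_comp f)
    (Category.id_comp g'), lift_homCart]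

theorem hat_hat {F : X} {m : A ⟶ F} {n : Y ⟶ F} (φ : Glob (Chain.one (homL f g)) (homL h k))
    (ψ : Glob (Chain.one (homL h k)) (homL m n)) (x : Y' ⟶ Y) {g' : Y' ⟶ B} {k' : Y' ⟶ E}
    {n' : Y' ⟶ F} (hg : x ≫ g = g') (hk : x ≫ k = k') (hn : x ≫ n = n') {P : Chain Loose A Y'}
    (α : Cell P (unit B) f g') :
    hat ψ x hk hn (hat φ x hg hk α) = hat (gcomp φ ψ) x hg hn α := by
  have e : (lift h k (𝟙 A) x (hat φ x hg hk α) (Category.id_comp h) hk : Cell P (homL h k) (𝟙 A) x)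
      = comp₁ (lift f g (𝟙 A) x α (Category.id_comp f) hg : Cell P (homL f g) (𝟙 A) x) φ
        (Category.id_comp _) (Category.comp_id _) := by
    apply homL_ext (Category.id_comp h) hk
    rw [lift_homCart, comp₁_assoc _ _ _ _ _ _ _ (Category.id_comp h) (Category.id_comp k)
      (Category.id_comp h) hk, hat]
  rw [hat, e, hat, gcomp, comp₁_assoc _ _ _ _ _ _ _ (Category.id_comp _) (Category.id_comp _)
    (Category.id_comp _) hn, comp₁_assoc φ ψ _ _ _ _ _ (Category.id_comp _) (Category.id_comp _)
    (Category.id_comp _) (Category.id_comp _)]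

theorem hat_id (x : Y' ⟶ Y) {g' : Y' ⟶ B} (hg : x ≫ g = g') {P : Chain Loose A Y'}
    (α : Cell P (unit B) f g') : hat (idCell (homL f g)) x hg hg α = α := by
  rw [hat, id_comp₁, lift_homCart]

theorem hat_mul {Z : X} {k : B ⟶ E} (φ : Glob (Chain.one (homL f (𝟙 B))) (homL h k)) (x : Y ⟶ B)
    (y : Z ⟶ B) {x' : Y ⟶ E} {y' : Z ⟶ E} (hx : x ≫ k = x') (hy : y ≫ k = y')
    {P : Chain Loose A Y} {Q : Chain Loose Y Z} (α : Cell P (unit B) f x) (β : Cell Q (unit B) x y) :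
    hat φ y (Category.comp_id y) hy
      (comp₂ α β (mulCell B) (Category.comp_id f) (Category.comp_id y)) =
    comp₂ (hat φ x (Category.comp_id x) hx α) (comp₁ β (mapCell k) hx hy) (mulCell E)
      (Category.comp_id h) (Category.comp_id y') := by
  have e : (lift f (𝟙 B) (𝟙 A) y
      (comp₂ α β (mulCell B) (Category.comp_id f) (Category.comp_id y)) (Category.id_comp f)
      (Category.comp_id y) : Cell (P.append Q) (homL f (𝟙 B)) (𝟙 A) y) =
      comp₂ (lift f (𝟙 B) (𝟙 A) x α (Category.id_comp f) (Category.comp_id x) :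
        Cell P (homL f (𝟙 B)) (𝟙 A) x) β (rightAct f) (Category.id_comp _) (Category.comp_id y) := by
    apply homL_ext (Category.id_comp f) (Category.comp_id y)
    rw [lift_homCart, comp₂_comp₁ _ _ _ _ _ _ _ _ (Category.id_comp f) (Category.id_comp _)
      (Category.id_comp f) (Category.comp_id y), rightAct, lift_homCart,
      ← compCell_comp₂ _ _ β (idCell (unit B)) _ (Category.id_comp f) (Category.comp_id x)
      (Category.comp_id y) (Category.comp_id f) (Category.comp_id y), lift_homCart, comp₁_id]
  rw [hat, e, comp₂_comp₁ _ _ _ _ _ _ _ _ (Category.id_comp h) (Category.id_comp k)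
    (Category.id_comp h) hy, rightAct_comp₁ f _ _ _ (Category.comp_id h) (Category.comp_id k),
    ← compCell_comp₂ _ _ β (mapCell k) _ (Category.id_comp h) hx hy, hat]

end Hat

/-! 2-cells into hom loose-cells -/

/-- The 2-cell into `E(1, 1)` underlying a 2-cell into `E(f, g)`. -/
def und {A B E : X} {P : Chain Loose A B} {f : A ⟶ E} {g : B ⟶ E} (α : Glob P (homL f g)) :
    Cell P (unit E) f g := comp₁ α (homCart f g) (Category.id_comp f) (Category.id_comp g)

theorem und_ext {A B E : X} {P : Chain Loose A B} {f : A ⟶ E} {g : B ⟶ E}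
    {α β : Glob P (homL f g)} (e : und α = und β) : α = β :=
  homL_ext _ _ e

theorem und_ident {A E : X} (f : A ⟶ E) : und (ident f) = oneCell f := lift_homCart _ _ _ _ _ _ _

theorem und_gcomp_mul {A B C E : X} {f : A ⟶ E} {g : B ⟶ E} {h : C ⟶ E} {P : Chain Loose A B}
    {Q : Chain Loose B C} (α : Glob P (homL f g)) (β : Glob Q (homL g h)) :
    und (gcomp₂ α β (mul f g h)) =
      comp₂ (und α) (und β) (mulCell E) (Category.comp_id f) (Category.comp_id h) := by
  rw [und, gcomp₂, comp₂_comp₁ _ _ _ _ _ _ _ _ (Category.id_comp f) (Category.id_comp h)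
    (Category.id_comp f) (Category.id_comp h), mul, lift_homCart,
    ← compCell_comp₂ _ _ _ _ _ (Category.id_comp f) (Category.id_comp g) (Category.id_comp h)
    (Category.comp_id f) (Category.comp_id h)]
  rfl

theorem und_gcomp_act {A B C E : X} {f : A ⟶ C} {g : B ⟶ C} (u : C ⟶ E) {f' : A ⟶ E} {g' : B ⟶ E}
    (hf : f ≫ u = f') (hg : g ≫ u = g') {P : Chain Loose A B} (α : Glob P (homL f g)) :
    und (gcomp α (act f g u hf hg)) = comp₁ (und α) (mapCell u) hf hg := by
  rw [und, gcomp, comp₁_assoc _ _ _ _ _ _ _ (Category.id_comp f') (Category.id_comp g')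
    (Category.id_comp f') (Category.id_comp g'), act, lift_homCart,
    ← comp₁_assoc _ _ _ (Category.id_comp f) (Category.id_comp g)]
  rfl

theorem und_gcomp_restrictR {A Y Y' B E : X} {f : A ⟶ B} {g : Y ⟶ B} {h : A ⟶ E} {k : Y ⟶ E}
    (φ : Glob (Chain.one (homL f g)) (homL h k)) (x : Y' ⟶ Y) {g' : Y' ⟶ B} {k' : Y' ⟶ E}
    (hg : x ≫ g = g') (hk : x ≫ k = k') {P : Chain Loose A Y'} (α : Glob P (homL f g')) :
    und (gcomp α (restrictR φ x hg hk)) = hat φ x hg hk (und α) :=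
  gcomp_restrictR _ _ _ _ _

theorem gcomp_assoc {A B : X} {P : Chain Loose A B} {q r s : Loose A B} (α : Glob P q)
    (β : Glob (Chain.one q) r) (γ : Glob (Chain.one r) s) :
    gcomp (gcomp α β) γ = gcomp α (gcomp β γ) := comp₁_assoc _ _ _ _ _ _ _ _ _ _ _

theorem idCell_gcomp {A B : X} {q r : Loose A B} (α : Glob (Chain.one q) r) :
    gcomp (idCell q) α = α := id_comp₁ _ _ _

theorem und_gcomp_hat {A Y B E : X} {f : A ⟶ B} {g : Y ⟶ B} {h : A ⟶ E} {k : Y ⟶ E}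
    (φ : Glob (Chain.one (homL f g)) (homL h k)) {P : Chain Loose A Y} (α : Glob P (homL f g)) :
    und (gcomp α φ) = hat φ (𝟙 Y) (Category.id_comp g) (Category.id_comp k) (und α) := by
  rw [und, gcomp, comp₁_assoc _ _ _ _ _ _ _ (Category.id_comp h) (Category.id_comp k)
    (Category.id_comp h) (Category.id_comp k), hat]
  congr 1
  apply homL_ext (Category.id_comp f) (Category.id_comp g)
  rw [lift_homCart]; rfl

theorem mul_mapCell {A B C D E : X} {f : A ⟶ D} {g : B ⟶ D} {h : C ⟶ D} {P : Chain Loose A B}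
    {Q : Chain Loose B C} (α : Cell P (unit D) f g) (β : Cell Q (unit D) g h) (u : D ⟶ E)
    {f' : A ⟶ E} {g' : B ⟶ E} {h' : C ⟶ E} (hf : f ≫ u = f') (hg : g ≫ u = g') (hh : h ≫ u = h') :
    comp₁ (comp₂ α β (mulCell D) (Category.comp_id f) (Category.comp_id h)) (mapCell u) hf hh =
    comp₂ (comp₁ α (mapCell u) hf hg) (comp₁ β (mapCell u) hg hh) (mulCell E) (Category.comp_id f')
      (Category.comp_id h') := by
  rw [comp₂_comp₁ _ _ _ _ _ _ _ _ (Category.id_comp u) (Category.id_comp u) hf hh,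
    mulCell_mapCell u _ _ (Category.comp_id u) (Category.comp_id u),
    ← compCell_comp₂ _ _ _ _ _ hf hg hh]

end Lemmas

/-! ### Relative monads, relative adjunctions, algebras -/

section Monads

variable {X : Type u} [VirtualEquipment.{u, v, w, z} X]

/-- Relative monads with root `j : A → E`. In terms of generalised elements, the laws are
`η ; f† = f`, `η† = 1` and `(f ; g†)† = f† ; g†`. -/
structure RelativeMonad {A E : X} (j : A ⟶ E) where
  /-- The carrier `t`. -/
  t : A ⟶ E
  /-- The unit `η : j ⇒ t`. -/
  unit : Glob (Chain.nil A) (homL j t)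
  /-- The extension operator `† : E(j, t) ⇒ E(t, t)`. -/
  ext : Glob (Chain.one (homL j t)) (homL t t)
  unit_mul_ext : gcomp₂ unit ext (mul j t t) = idCell (homL j t)
  unit_ext : gcomp unit ext = ident t
  ext_ext : gcomp (gcomp₂ (idCell (homL j t)) ext (mul j t t)) ext = gcomp₂ ext ext (mul t t t)

/-- Relative adjunctions `ℓ ⊣ r` with root `j : A → E`. -/
structure RelativeAdjunction {A C E : X} (j : A ⟶ E) (l : A ⟶ C) (r : C ⟶ E) where
  sharp : Glob (Chain.one (homL l (𝟙 C))) (homL j r)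
  flat : Glob (Chain.one (homL j r)) (homL l (𝟙 C))
  sharp_flat : gcomp sharp flat = idCell (homL l (𝟙 C))
  flat_sharp : gcomp flat sharp = idCell (homL j r)

/-- Adjunctions are relative adjunctions whose root is the identity. -/
abbrev Adjunction {C E : X} (l : E ⟶ C) (r : C ⟶ E) : Type z := RelativeAdjunction (𝟙 E) l r

/-- Algebras with domain `D` for a relative monad. In terms of generalised elements, the laws are
`η ; f^⋊ = f` and `(f ; g^⋊)^⋊ = f† ; g^⋊`, where `⋊` denotes the extension operator. -/
structure RelativeMonad.Algebra {A E : X} {j : A ⟶ E} (T : RelativeMonad j) (D : X) where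
  /-- The carrier. -/
  e : D ⟶ E
  /-- The extension operator `E(j, e) ⇒ E(t, e)`. -/
  ext : Glob (Chain.one (homL j e)) (homL T.t e)
  unit_mul_ext : gcomp₂ T.unit ext (mul j T.t e) = idCell (homL j e)
  ext_ext : gcomp (gcomp₂ (idCell (homL j T.t)) ext (mul j T.t e)) ext =
    gcomp₂ T.ext ext (mul T.t T.t e)

/-- A 2-cell `ε : p₁, …, pₙ ⇒ E(e, e')` is a `(p₁, …, pₙ)`-graded algebra morphism when
`(f ; ε)^⋊' = f^⋊ ; ε`, an equality of 2-cells `E(j, e), p₁, …, pₙ ⇒ E(t, e')`. -/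
def RelativeMonad.Algebra.IsGradedMorphism {A E : X} {j : A ⟶ E} {T : RelativeMonad j} {D D' : X}
    (M : T.Algebra D) (N : T.Algebra D') {P : Chain Loose D D'} (ε : Glob P (homL M.e N.e)) :
    Prop :=
  gcomp (gcomp₂ (idCell (homL j M.e)) ε (mul j M.e N.e)) N.ext = gcomp₂ M.ext ε (mul T.t M.e N.e)

/-- `M.IsPullback U x` says that the algebra `M` is the restriction of the algebra `U` along the
tight-cell `x`: one has `x ; u = e`, and the extension operator of `M` is that of `U`
restricted along `x`. -/
def RelativeMonad.Algebra.IsPullback {A E : X} {j : A ⟶ E} {T : RelativeMonad j} {D O : X}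
    (M : T.Algebra D) (U : T.Algebra O) (x : D ⟶ O) : Prop :=
  ∃ h : x ≫ U.e = M.e, restrictR U.ext x h h = M.ext

/-- Algebra objects: universal algebras. -/
structure RelativeMonad.Algebra.IsAlgebraObject {A E : X} {j : A ⟶ E} {T : RelativeMonad j} {O : X}
    (U : T.Algebra O) : Prop where
  existsUnique_tight : ∀ {D : X} (M : T.Algebra D), ∃! x : D ⟶ O, M.IsPullback U x
  existsUnique_cell : ∀ {D D' : X} (M : T.Algebra D) (N : T.Algebra D') (x : D ⟶ O) (y : D' ⟶ O)
    (hx : M.IsPullback U x) (hy : N.IsPullback U y) (P : Chain Loose D D')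
    (ε : Glob P (homL M.e N.e)), M.IsGradedMorphism N ε →
    ∃! χ : Glob P (homL x y), gcomp χ (act x y U.e hx.1 hy.1) = ε

/-- A relative monad admits an algebra object. -/
def RelativeMonad.AdmitsAlgebraObject {A E : X} {j : A ⟶ E} (T : RelativeMonad j) : Prop :=
  ∃ (O : X) (U : T.Algebra O), U.IsAlgebraObject

namespace RelativeAdjunction

variable {A C E : X} {j : A ⟶ E} {l : A ⟶ C} {r : C ⟶ E} (a : RelativeAdjunction j l r)

/-- For a tight-cell `x : D → C`, the 2-cell `E(j, (x ; r)) ⇒ C(ℓ, x) ⇒ E((ℓ ; r), (x ; r))` given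
by transposition followed by the action of `r`. -/
noncomputable def ext {D : X} (x : D ⟶ C) {e : D ⟶ E} (h : x ≫ r = e) :
    Glob (Chain.one (homL j e)) (homL (l ≫ r) e) :=
  gcomp (restrictR a.flat x h (Category.comp_id x)) (act l x r rfl h)

/-- The unit `j ⇒ (ℓ ; r)`, the transpose of the identity of `ℓ`. -/
noncomputable def unit : Glob (Chain.nil A) (homL j (l ≫ r)) :=
  gcomp (ident l) (restrictR a.sharp l (Category.comp_id l) rfl)

theorem hat_flat_sharp {D : X} (x : D ⟶ C) {e : D ⟶ E} (h : x ≫ r = e) {P : Chain Loose A D}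
    (α : Cell P (VirtualEquipment.unit C) l x) :
    hat a.flat x h (Category.comp_id x) (hat a.sharp x (Category.comp_id x) h α) = α := by
  rw [hat_hat, a.sharp_flat, hat_id]

theorem hat_sharp_flat {D : X} (x : D ⟶ C) {e : D ⟶ E} (h : x ≫ r = e) {P : Chain Loose A D}
    (α : Cell P (VirtualEquipment.unit E) j e) :
    hat a.sharp x (Category.comp_id x) h (hat a.flat x h (Category.comp_id x) α) = α := by
  rw [hat_hat, a.flat_sharp, hat_id]

theorem und_ext {D : X} (x : D ⟶ C) {e : D ⟶ E} (h : x ≫ r = e) {P : Chain Loose A D}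
    (α : Glob P (homL j e)) : und (gcomp α (a.ext x h)) =
      comp₁ (hat a.flat x h (Category.comp_id x) (und α)) (mapCell r) rfl h := by
  rw [ext, ← gcomp_assoc, und_gcomp_act, und_gcomp_restrictR]

theorem und_ext' {D : X} (x : D ⟶ C) {e : D ⟶ E} (h : x ≫ r = e) : und (a.ext x h) =
      comp₁ (hat a.flat x h (Category.comp_id x) (und (idCell _))) (mapCell r) rfl h := by
  rw [← und_ext, idCell_gcomp]

theorem und_unit : und a.unit = hat a.sharp l (Category.comp_id l) rfl (oneCell l) := by
  rw [unit, und_gcomp_restrictR, und_ident]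

theorem unit_mul_ext {D : X} (x : D ⟶ C) {e : D ⟶ E} (h : x ≫ r = e) :
    gcomp₂ a.unit (a.ext x h) (mul j (l ≫ r) e) = idCell (homL j e) := by
  apply FormalCat.und_ext
  rw [und_gcomp_mul, und_unit, und_ext', ← hat_mul a.sharp l x rfl h, oneCell_mulCell,
    hat_sharp_flat]

theorem ext_ext {D : X} (x : D ⟶ C) {e : D ⟶ E} (h : x ≫ r = e) :
    gcomp (gcomp₂ (idCell (homL j (l ≫ r))) (a.ext x h) (mul j (l ≫ r) e)) (a.ext x h) =
      gcomp₂ (a.ext l rfl) (a.ext x h) (mul (l ≫ r) (l ≫ r) e) := by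
  apply FormalCat.und_ext
  rw [und_ext, und_gcomp_mul, und_gcomp_mul, und_ext', und_ext', ← mul_mapCell _ _ r rfl rfl h]
  congr 1
  rw [← a.hat_flat_sharp x h (comp₂ _ _ _ _ _), hat_mul a.sharp l x rfl h, hat_sharp_flat]

/-- The relative monad induced by a relative adjunction. Its carrier is `(ℓ ; r)`, its unit is the
transpose of the identity of `ℓ`, and its extension operator is
`E(j, (ℓ ; r)) ⇒ C(ℓ, ℓ) ⇒ E((ℓ ; r), (ℓ ; r))`. -/
noncomputable def monad : RelativeMonad j where
  t := l ≫ r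
  unit := a.unit
  ext := a.ext l rfl
  unit_mul_ext := a.unit_mul_ext l rfl
  unit_ext := by
    apply FormalCat.und_ext
    rw [und_ext, und_unit, hat_flat_sharp, oneCell_mapCell, und_ident]
  ext_ext := a.ext_ext l rfl

/-- The algebra with carrier `r`, for the relative monad induced by `ℓ ⊣ r`, with extension
operator `E(j, r) ⇒ C(ℓ, 1) ⇒ E((ℓ ; r), r)`. -/
noncomputable def algebra : a.monad.Algebra C where
  e := r
  ext := a.ext (𝟙 C) (Category.id_comp r)
  unit_mul_ext := a.unit_mul_ext (𝟙 C) (Category.id_comp r)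
  ext_ext := a.ext_ext (𝟙 C) (Category.id_comp r)

/-- The comparison tight-cell to an algebra object for the induced relative monad. -/
noncomputable def comparison {O : X} {U : a.monad.Algebra O} (hU : U.IsAlgebraObject) : C ⟶ O :=
  (hU.existsUnique_tight a.algebra).choose

end RelativeAdjunction

/-! ### Monadicity -/

/-- An (invertible) 2-cell `f ≅ g` between tight-cells, as a property. -/
def TightIso {A E : X} (f g : A ⟶ E) : Prop :=
  ∃ (α : Glob (Chain.nil A) (homL f g)) (β : Glob (Chain.nil A) (homL g f)),
    gcomp₂ α β (mul f g f) = ident f ∧ gcomp₂ β α (mul g f g) = ident g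

/-- A tight-cell is an equivalence when it has an inverse up to invertible 2-cells. -/
def IsTightEquivalence {A B : X} (c : A ⟶ B) : Prop :=
  ∃ d : B ⟶ A, TightIso (c ≫ d) (𝟙 A) ∧ TightIso (d ≫ c) (𝟙 B)

/-- `r : D → E` is strictly `j`-monadic when it admits a left `j`-adjoint, the induced `j`-monad
admits an algebra object, and the comparison tight-cell is an isomorphism. -/
def StrictlyRelativelyMonadic {A D E : X} (j : A ⟶ E) (r : D ⟶ E) : Prop :=
  ∃ (l : A ⟶ D) (a : RelativeAdjunction j l r) (O : X) (U : a.monad.Algebra O)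
    (hU : U.IsAlgebraObject), IsIso (a.comparison hU)

/-- `r : D → E` is non-strictly `j`-monadic when it admits a left `j`-adjoint, the induced `j`-monad
admits an algebra object, and the comparison tight-cell is an equivalence. -/
def NonstrictlyRelativelyMonadic {A D E : X} (j : A ⟶ E) (r : D ⟶ E) : Prop :=
  ∃ (l : A ⟶ D) (a : RelativeAdjunction j l r) (O : X) (U : a.monad.Algebra O)
    (hU : U.IsAlgebraObject), IsTightEquivalence (a.comparison hU)

/-- Strict monadicity: relative to the identity. -/
def StrictlyMonadic {D E : X} (r : D ⟶ E) : Prop := StrictlyRelativelyMonadic (𝟙 E) r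

/-- Non-strict monadicity: relative to the identity. -/
def NonstrictlyMonadic {D E : X} (r : D ⟶ E) : Prop := NonstrictlyRelativelyMonadic (𝟙 E) r

end Monads

end FormalCat

namespace FormalCat

open VirtualDoubleStruct VirtualDoubleCategory VirtualEquipment

variable {X : Type u} [VirtualEquipment.{u, v, w, z} X]

/-! ### Generalised elements of hom loose-cells -/

/-! The proof is the Eilenberg–Moore argument, made available in a virtual equipment by two
translations. First, a 2-cell `P ⇒ E(f, g)` is treated as a morphism from `f` to `g` in a category
`Elt E` whose objects are tight-cells into `E`. Tight-cells `u` act on it by `mapc u`, 2-cells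
between tight-cells whisker by `wh`, and the two interchange (`mapc_comp_wh`). Second, by a Yoneda
argument (`lift_comp₁`, `gen_cancel`), a 2-cell `B(1, g) ⇒ E(h, k)` is the same as a 2-cell `(g ; h)
⇒ k`. An extension operator thus becomes an action `(e ; t) ⇒ e`, and a graded algebra morphism
becomes a morphism that respects actions. Monadicity of `r` then splits into `FullyFaithful`
together with `StrictlyBijective` or `EssentiallySurjective`. These properties follow from
monadicity, and they imply it back, given an algebra object in the non-strict case.

For cancellation, let `m ⊣ (r ; r')` and `ℓ' ⊣ r'` be the adjunctions supplied by monadicity. The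
mate `tau : (r' ; m) ⇒ ℓ` turns an `(ℓ ; r)`-action `k` on `e` into an action `pushAct` of `(m ; r ;
r')` on `(e ; r')`. The 2-cell `omega : (ℓ' ; r') ⇒ (m ; r ; r')` pulls this action back to the
canonical action on `(e ; r')`, whatever `k` was (`wh_omega_pushAct`). Hence morphisms between
pushed actions descend along `r'`. Monadicity of `(r ; r')` produces an `x` with `(x ; r ; r')`
equal or isomorphic to `(e ; r')`, and monadicity of `r'` improves this to a comparison of `(x ; r)`
with `e`.

It remains to see that the comparison respects the original action `k`, which is
`mapc_comp_freeAct_of_pushAct`. There `k` is viewed as a morphism out of the free algebra on `e`, so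
that full faithfulness of `(r ; r')` lifts the relevant composite to `C`, where the unit law
determines it. -/

/-- 2-cells `P ⇒ E(f, g)`, presented as 2-cells into the loose-identity with boundary `f`, `g`. -/
abbrev Gen {A B E : X} (P : Chain Loose A B) (f : A ⟶ E) (g : B ⟶ E) : Type z :=
  Cell P (unit E) f g

/-- Composition of generalised elements. -/
noncomputable def seq {A B C E : X} {f : A ⟶ E} {g : B ⟶ E} {h : C ⟶ E} {P : Chain Loose A B}
    {Q : Chain Loose B C} {R : Chain Loose A C} (α : Gen P f g) (β : Gen Q g h)
    (e : R = P.append Q) : Gen R f h :=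
  compCell (Row.cons α (Row.one β) e) (mulCell E) (Category.comp_id f) (Category.comp_id h)

/-- Whiskering of a 2-cell with empty source by a tight-cell. -/
def whisker {A A' E : X} (x : A' ⟶ A) {f g : A ⟶ E} {f' g' : A' ⟶ E}
    (θ : Gen (Chain.nil A) f g) (hf : x ≫ f = f') (hg : x ≫ g = g') : Gen (Chain.nil A') f' g' :=
  compCell (Row.nil x) θ hf hg

/-! ### Unit and associativity laws for composition of generalised elements. -/

/-- The source chain is only required to equal the concatenation. This is needed when the second
2-cell has empty source, since `P.append (nil _)` equals `P` only propositionally. -/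
theorem compCell_cons₂ {A B C A' B' C' A'' B'' C'' D E : X} {P : Chain Loose A B}
    {P' : Chain Loose B C} {R : Chain Loose A C} {p : Loose A' B'} {p' : Loose B' C'}
    {q : Loose A'' B''} {q' : Loose B'' C''} {s : Loose D E}
    {f₀ : A ⟶ A'} {f₁ : B ⟶ B'} {f₂ : C ⟶ C'} {g₀ : A' ⟶ A''} {g₁ : B' ⟶ B''} {g₂ : C' ⟶ C''}
    {k₀ : A ⟶ A''} {k₁ : B ⟶ B''} {k₂ : C ⟶ C''} {h₀ : A'' ⟶ D} {h₂ : C'' ⟶ E}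
    {m₀ : A' ⟶ D} {m₂ : C' ⟶ E} {F : A ⟶ D} {G : C ⟶ E}
    (a : Cell P p f₀ f₁) (b : Cell (Chain.one p) q g₀ g₁)
    (c : Cell P' p' f₁ f₂) (d : Cell (Chain.one p') q' g₁ g₂) (χ : Cell (Chain.two q q') s h₀ h₂)
    (e : R = P.append P')
    (e₀ : f₀ ≫ g₀ = k₀) (e₁ : f₁ ≫ g₁ = k₁) (e₂ : f₂ ≫ g₂ = k₂)
    (hf : k₀ ≫ h₀ = F) (hg : k₂ ≫ h₂ = G) (hf₂ : g₀ ≫ h₀ = m₀) (hg₂ : g₂ ≫ h₂ = m₂)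
    (hf₁ : f₀ ≫ m₀ = F) (hg₁ : f₂ ≫ m₂ = G) :
    compCell (Row.cons (comp₁ a b e₀ e₁) (Row.one (comp₁ c d e₁ e₂)) e) χ hf hg =
      compCell (Row.cons a (Row.one c) e) (comp₂ b d χ hf₂ hg₂) hf₁ hg₁ := by
  subst e
  exact compCell_comp₂ _ _ _ _ _ _ _ _ _ _ _ _ _ _

theorem oneCell_seq {A B E : X} {P : Chain Loose A B} {f : A ⟶ E} {g : B ⟶ E} (α : Gen P f g)
    (e : P = (Chain.nil A).append P) : seq (oneCell f) α e = α :=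
  oneCell_mulCell α (Category.comp_id f) (Category.comp_id g)

theorem seq_oneCell {A B E : X} {P : Chain Loose A B} {f : A ⟶ E} {g : B ⟶ E} (α : Gen P f g)
    (e : P = P.append (Chain.nil B)) : seq α (oneCell g) e = α := by
  have h₁ := Category.comp_id f
  have h₂ := Category.comp_id g
  have r1 := RowComp.cons (Φ := Row.nil g) (ψ := unitCell E) h₂ h₂
    (RowComp.nil (f := g) (f' := 𝟙 E) h₂) rfl rfl
  have r2 := RowComp.cons (Φ := Row.one α) (ψ := idCell (unit E)) h₁ h₂ r1 e rfl
  have e' : compCell (Row.one α) (idCell (unit E)) h₁ h₂ = α := compCell_id α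
  have r3 : (Row.one α).append ((Row.nil g).append (Row.nil g) rfl rfl) e rfl = Row.one α :=
    Row.append_nil _ _ _
  rw [e', r3] at r2
  refine Eq.trans (compCell_assoc r2 (mulCell E) h₁ h₂ (Category.id_comp _) (Category.id_comp _)
    h₁ h₂) ?_
  refine Eq.trans (congrArg (fun c => compCell _ c h₁ h₂) (id_unit_mulCell E _ _)) ?_
  exact compCell_id α

/-- Together with `compCell_three'`, this rewrites the two bracketings of a composite of three
2-cells as the same row of three followed by different binary composites. Associativity of `seq`
thereby reduces to associativity of `mulCell`. -/
theorem compCell_three {A B C D A' B' C' D' A'' B'' C'' : X} {P : Chain Loose A B}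
    {Q : Chain Loose B C} {R : Chain Loose C D} {S : Chain Loose B D} {V : Chain Loose A D}
    {W : Chain Loose A C} {p : Loose A' B'} {q : Loose B' C'} {r : Loose C' D'}
    {s : Loose A'' B''} {t : Loose B'' C''} {T : Loose A'' C''}
    {f : A ⟶ A'} {g : B ⟶ B'} {h : C ⟶ C'} {k : D ⟶ D'} {f' : A' ⟶ A''} {h' : C' ⟶ B''}
    {k' : D' ⟶ C''} {F : A ⟶ A''} {H : C ⟶ B''} {K : D ⟶ C''}
    (α : Cell P p f g) (β : Cell Q q g h) (γ : Cell R r h k) (μ : Cell (Chain.two p q) s f' h')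
    (ν : Cell (Chain.one r) t h' k') (χ : Cell (Chain.two s t) T (𝟙 A'') (𝟙 C''))
    (e₁ : W = P.append Q) (e₂ : V = W.append R) (e₃ : S = Q.append R) (e₄ : V = P.append S)
    (hf : f ≫ f' = F) (hh : h ≫ h' = H) (hk : k ≫ k' = K) :
    compCell (Row.cons (compCell (Row.cons α (Row.one β) e₁) μ hf hh)
        (Row.one (comp₁ γ ν hh hk)) e₂) χ (Category.comp_id _) (Category.comp_id _) =
      compCell (Row.cons α (Row.cons β (Row.one γ) e₃) e₄)
        (comp₂ μ ν χ (Category.comp_id _) (Category.comp_id _)) hf hk := by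
  subst e₁ e₃ e₂
  have h1 := RowComp.cons (Φ := Row.one γ) (ψ := ν) hh hk (RowComp.nil (f := k) (f' := k') hk)
    (Chain.append_nil R).symm rfl
  have h2 := RowComp.cons (Φ := Row.cons α (Row.one β) rfl) (ψ := μ) hf hh h1 rfl rfl
  exact compCell_assoc h2 χ _ _ _ _ hf hk

theorem compCell_three' {A B C D A' B' C' D' A'' B'' C'' : X} {P : Chain Loose A B}
    {Q : Chain Loose B C} {R : Chain Loose C D} {S : Chain Loose B D} {V : Chain Loose A D}
    {p : Loose A' B'} {q : Loose B' C'} {r : Loose C' D'}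
    {s : Loose A'' B''} {t : Loose B'' C''} {T : Loose A'' C''}
    {f : A ⟶ A'} {g : B ⟶ B'} {h : C ⟶ C'} {k : D ⟶ D'} {f' : A' ⟶ A''} {g' : B' ⟶ B''}
    {k' : D' ⟶ C''} {F : A ⟶ A''} {G : B ⟶ B''} {K : D ⟶ C''}
    (α : Cell P p f g) (β : Cell Q q g h) (γ : Cell R r h k) (μ : Cell (Chain.one p) s f' g')
    (ν : Cell (Chain.two q r) t g' k') (χ : Cell (Chain.two s t) T (𝟙 A'') (𝟙 C''))
    (e₃ : S = Q.append R) (e₄ : V = P.append S)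
    (hf : f ≫ f' = F) (hg : g ≫ g' = G) (hk : k ≫ k' = K) :
    compCell (Row.cons (comp₁ α μ hf hg)
        (Row.one (compCell (Row.cons β (Row.one γ) e₃) ν hg hk)) e₄) χ
        (Category.comp_id _) (Category.comp_id _) =
      compCell (Row.cons α (Row.cons β (Row.one γ) e₃) e₄)
        (comp₂ μ ν χ (Category.comp_id _) (Category.comp_id _)) hf hk := by
  subst e₃ e₄
  have h1 := RowComp.cons (Φ := Row.cons β (Row.one γ) rfl) (ψ := ν) hg hk
    (RowComp.nil (f := k) (f' := k') hk) (Chain.append_nil _).symm rfl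
  rw [Row.append_nil] at h1
  have h2 := RowComp.cons (Φ := Row.one α) (ψ := μ) hf hg h1 rfl rfl
  exact compCell_assoc h2 χ _ _ _ _ hf hk

/-- By opcartesianness of the unit, a 2-cell out of three copies of `E(1, 1)` is determined by
inserting `unitCell E` in the first slot. Both sides then reduce to `mulCell E`. -/
theorem mulCell_assoc (E : X) (h : 𝟙 E ≫ 𝟙 E = 𝟙 E) :
    comp₂ (mulCell E) (idCell (unit E)) (mulCell E) h h =
      comp₂ (idCell (unit E)) (mulCell E) (mulCell E) h h := by
  apply (unitCell_isOpcartesian E (Chain.nil E) (Chain.two (unit E) (unit E)) (unit E) (𝟙 E) (𝟙 E)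
    (mulCell E)).unique
  · have := compCell_three (unitCell E) (idCell (unit E)) (idCell (unit E)) (mulCell E)
      (idCell (unit E)) (mulCell E) (W := Chain.one (unit E)) (V := Chain.two (unit E) (unit E))
      rfl rfl rfl rfl h h h
    refine this.symm.trans ?_
    have e : compCell (Row.cons (unitCell E) (Row.one (idCell (unit E))) rfl) (mulCell E) h h =
      idCell (unit E) := unit_id_mulCell E h h
    rw [e, comp₁_id]
    exact id_compCell (mulCell E)
  · have := compCell_three' (unitCell E) (idCell (unit E)) (idCell (unit E)) (idCell (unit E))
      (mulCell E) (mulCell E) (V := Chain.two (unit E) (unit E))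
      rfl rfl h h h
    refine this.symm.trans ?_
    have e : compCell (Row.cons (idCell (unit E)) (Row.one (idCell (unit E))) rfl) (mulCell E) h h =
      mulCell E := id_compCell (mulCell E)
    rw [e, comp₁_id, ← oneCell_id]
    exact oneCell_mulCell _ _ _

theorem seq_assoc {A B C D E : X} {f : A ⟶ E} {g : B ⟶ E} {h : C ⟶ E} {k : D ⟶ E}
    {P : Chain Loose A B} {Q : Chain Loose B C} {R : Chain Loose C D} {S : Chain Loose B D}
    {V : Chain Loose A D} {W : Chain Loose A C} (α : Gen P f g) (β : Gen Q g h) (γ : Gen R h k)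
    (e₁ : W = P.append Q) (e₂ : V = W.append R) (e₃ : S = Q.append R) (e₄ : V = P.append S) :
    seq (seq α β e₁) γ e₂ = seq α (seq β γ e₃) e₄ := by
  have h1 := compCell_three α β γ (mulCell E) (idCell (unit E)) (mulCell E) e₁ e₂ e₃ e₄
    (Category.comp_id _) (Category.comp_id _) (Category.comp_id _)
  have h2 := compCell_three' α β γ (idCell (unit E)) (mulCell E) (mulCell E) e₃ e₄
    (Category.comp_id _) (Category.comp_id _) (Category.comp_id _)
  rw [comp₁_id] at h1 h2
  exact h1.trans ((congrArg (fun c => compCell _ c _ _) (mulCell_assoc E _)).trans h2.symm)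

/-! ### Whiskering and interchange. -/

/-- With `comp₁_mapCell_seq`, this writes each side of the interchange law as `α` followed by a
2-cell out of `C(1, 1)`, so that only those two 2-cells need comparing. -/
theorem comp₁_seq_mapCell {A B C E : X} {f : A ⟶ C} {g : B ⟶ C}
    {P : Chain Loose A B} {f' : A ⟶ E} {g' k' : B ⟶ E} {u k : C ⟶ E} (α : Gen P f g)
    (θ : Gen (Chain.nil C) u k)
    (hf : f ≫ u = f') (hg : g ≫ u = g') (hk : g ≫ k = k') (e : P = P.append (Chain.nil B)) :
    seq (comp₁ α (mapCell u) hf hg) (whisker g θ hg hk) e =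
      compCell (Row.one α) (seq (mapCell u) θ rfl) hf hk := by
  have r1 := RowComp.cons (Φ := Row.nil g) (ψ := θ) hg hk (RowComp.nil (f := g) (f' := k) hk) rfl rfl
  have r2 := RowComp.cons (Φ := Row.one α) (ψ := mapCell u) hf hg r1 e rfl
  have r3 : (Row.one α).append ((Row.nil g).append (Row.nil g) rfl rfl) e rfl = Row.one α :=
    Row.append_nil _ _ _
  rw [r3] at r2
  exact compCell_assoc r2 (mulCell E) _ _ _ _ _ _

theorem comp₁_mapCell_seq {A B C E : X} {f : A ⟶ C} {g : B ⟶ C}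
    {P : Chain Loose A B} {f' k' : A ⟶ E} {g' : B ⟶ E} {u k : C ⟶ E} (α : Gen P f g)
    (θ : Gen (Chain.nil C) k u)
    (hf : f ≫ u = f') (hg : g ≫ u = g') (hk : f ≫ k = k') (e : P = (Chain.nil A).append P) :
    seq (whisker f θ hk hf) (comp₁ α (mapCell u) hf hg) e =
      compCell (Row.one α) (seq θ (mapCell u) rfl) hk hg := by
  have r1 := RowComp.cons (Φ := Row.one α) (ψ := mapCell u) hf hg
    (RowComp.nil (f := g) (f' := u) hg) (Chain.append_nil P).symm rfl
  have r2 := RowComp.cons (Φ := Row.nil f) (ψ := θ) hk hf r1 e rfl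
  exact compCell_assoc r2 (mulCell E) _ _ _ _ _ _

theorem id_whisker {A E : X} {f g : A ⟶ E} (θ : Gen (Chain.nil A) f g) (hf : 𝟙 A ≫ f = f)
    (hg : 𝟙 A ≫ g = g) : whisker (𝟙 A) θ hf hg = θ := id_compCell θ

/-- This is interchange at the universal `α`: after insertion of the unit of `C(1, 1)`, both actions
become identities and both sides become `θ`. -/
theorem seq_mapCell_eq {C E : X} {u k : C ⟶ E} (θ : Gen (Chain.nil C) u k) :
    (seq (mapCell u) θ rfl : Gen (Chain.one (unit C)) u k) = seq θ (mapCell k) rfl := by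
  apply unit_ext
  have h1 := comp₁_seq_mapCell (unitCell C) θ (Category.id_comp u) (Category.id_comp u)
    (Category.id_comp k) rfl
  have h2 := comp₁_mapCell_seq (unitCell C) θ (Category.id_comp k) (Category.id_comp k)
    (Category.id_comp u) rfl
  refine h1.symm.trans (Eq.trans ?_ h2)
  rw [id_whisker, unit_mapCell, unit_mapCell, oneCell_seq, seq_oneCell]

/-- The interchange law. -/
theorem seq_whisker {A B C E : X} {f : A ⟶ C} {g : B ⟶ C} {P : Chain Loose A B} {u k : C ⟶ E}
    {fu fk : A ⟶ E} {gu gk : B ⟶ E} (α : Gen P f g) (θ : Gen (Chain.nil C) u k)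
    (hfu : f ≫ u = fu) (hfk : f ≫ k = fk) (hgu : g ≫ u = gu) (hgk : g ≫ k = gk)
    (e : P = P.append (Chain.nil B)) (e' : P = (Chain.nil A).append P) :
    seq (comp₁ α (mapCell u) hfu hgu) (whisker g θ hgu hgk) e =
      seq (whisker f θ hfu hfk) (comp₁ α (mapCell k) hfk hgk) e' := by
  rw [comp₁_seq_mapCell, comp₁_mapCell_seq, seq_mapCell_eq]

theorem seq_mapCell {A B C D E : X} {P : Chain Loose A B} {f : A ⟶ D} {g : B ⟶ D} {h : C ⟶ D}
    {Q : Chain Loose B C} {R : Chain Loose A C} (α : Gen P f g) (β : Gen Q g h) (u : D ⟶ E)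
    {f' : A ⟶ E} {g' : B ⟶ E} {h' : C ⟶ E} (hf : f ≫ u = f') (hg : g ≫ u = g') (hh : h ≫ u = h')
    (e : R = P.append Q) :
    comp₁ (seq α β e) (mapCell u) hf hh =
      seq (comp₁ α (mapCell u) hf hg) (comp₁ β (mapCell u) hg hh) e := by
  subst e
  exact mul_mapCell α β u hf hg hh

theorem mapCell_comp {C D E : X} (p : C ⟶ D) (q : D ⟶ E) {pq : C ⟶ E} (h : p ≫ q = pq) :
    comp₁ (mapCell p) (mapCell q) h h = mapCell pq := by
  apply unit_ext
  have h1 := comp₁_assoc (unitCell C) (mapCell p) (mapCell q) (Category.id_comp _)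
    (Category.id_comp _) h h h h (Category.id_comp _) (Category.id_comp _)
  rw [← h1, unit_mapCell, unit_mapCell, oneCell_mapCell]

theorem mapCell_id (C : X) : mapCell (𝟙 C) = idCell (unit C) := by
  apply unit_ext
  rw [unit_mapCell, comp₁_id, oneCell_id]

theorem whisker_oneCell {A A' E : X} (x : A' ⟶ A) {f : A ⟶ E} {f' : A' ⟶ E} (hf : x ≫ f = f') :
    whisker x (oneCell f) hf hf = oneCell f' := by
  subst hf
  exact (compCell_assoc (RowComp.nil rfl) _ _ _ _ _ _ _).symm

theorem whisker_whisker {A A' A'' E : X} (y : A'' ⟶ A') (x : A' ⟶ A) {yx : A'' ⟶ A}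
    (h : y ≫ x = yx) {f g : A ⟶ E} {f' g' : A' ⟶ E}
    {f'' g'' : A'' ⟶ E} (θ : Gen (Chain.nil A) f g) (hf : x ≫ f = f') (hg : x ≫ g = g')
    (hf' : y ≫ f' = f'') (hg' : y ≫ g' = g'') (hf'' : yx ≫ f = f'') (hg'' : yx ≫ g = g'') :
    whisker y (whisker x θ hf hg) hf' hg' = whisker yx θ hf'' hg'' := by
  subst h
  exact (compCell_assoc (RowComp.nil rfl) _ _ _ _ _ _ _).symm

theorem whisker_mapCell {A A' D E : X} (x : A' ⟶ A) {f g : A ⟶ D} (u : D ⟶ E) {f' g' : A' ⟶ D}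
    {fu gu : A ⟶ E} {fu' gu' : A' ⟶ E} (θ : Gen (Chain.nil A) f g) (hf : x ≫ f = f')
    (hg : x ≫ g = g') (hfu : f ≫ u = fu) (hgu : g ≫ u = gu) (hfu' : x ≫ fu = fu')
    (hgu' : x ≫ gu = gu') (hfu'' : f' ≫ u = fu') (hgu'' : g' ≫ u = gu') :
    whisker x (comp₁ θ (mapCell u) hfu hgu : Gen (Chain.nil A) fu gu) hfu' hgu' =
      comp₁ (whisker x θ hf hg) (mapCell u) hfu'' hgu'' :=
  (compCell_comp₁ (Row.nil x) θ (mapCell u) hf hg hfu'' hgu'' hfu hgu hfu' hgu').symm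

theorem whisker_seq {A A' E : X} (x : A' ⟶ A) {f g h : A ⟶ E} {f' g' h' : A' ⟶ E}
    (θ : Gen (Chain.nil A) f g) (θ' : Gen (Chain.nil A) g h) (hf : x ≫ f = f') (hg : x ≫ g = g')
    (hh : x ≫ h = h') :
    whisker x (seq θ θ' rfl : Gen (Chain.nil A) f h) hf hh =
      seq (whisker x θ hf hg) (whisker x θ' hg hh) rfl := by
  have r1 := RowComp.cons (Φ := Row.nil x) (ψ := θ') hg hh (RowComp.nil (f := x) (f' := h) hh)
    rfl rfl
  have r2 := RowComp.cons (Φ := Row.nil x) (ψ := θ) hf hg r1 rfl rfl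
  exact (compCell_assoc r2 (mulCell E) _ _ _ _ _ _).symm

/-! ### 2-cells out of `B(1, g)` -/

/-- The left action of `B(1, 1)` on `B(1, g)`. -/
noncomputable def leftAct {B Y : X} (g : Y ⟶ B) :
    Glob (Chain.two (unit B) (homL (𝟙 B) g)) (homL (𝟙 B) g) :=
  lift (𝟙 B) g (𝟙 B) (𝟙 Y) (comp₂ (idCell (unit B)) (homCart (𝟙 B) g) (mulCell B)
    (Category.comp_id _) (Category.comp_id g)) (Category.comp_id _) (Category.id_comp g)

theorem unit_id_leftAct {B Y : X} (g : Y ⟶ B) (h₁ : 𝟙 B ≫ 𝟙 B = 𝟙 B) (h₂ : 𝟙 Y ≫ 𝟙 Y = 𝟙 Y) :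
    comp₂ (unitCell B) (idCell (homL (𝟙 B) g)) (leftAct g) h₁ h₂ = idCell (homL (𝟙 B) g) := by
  apply homL_ext (Category.id_comp _) (Category.id_comp g)
  rw [comp₂_comp₁ _ _ _ _ _ _ _ _ (Category.id_comp _) (Category.id_comp g) (Category.id_comp _)
    (Category.id_comp g), leftAct, lift_homCart, id_comp₁,
    ← compCell_comp₂ (unitCell B) (idCell (unit B)) (idCell (homL (𝟙 B) g)) (homCart (𝟙 B) g)
      (mulCell B) (Category.id_comp _) (Category.id_comp _) (Category.id_comp g)
      (Category.comp_id _) (Category.comp_id _), id_comp₁, comp₁_id, ← oneCell_id, oneCell_mulCell]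

/-- Linearity over `B(1, 1)` is automatic: the equation need only be tested on the unit, where both
actions are trivial. -/
theorem leftAct_comp₁ {B Y E : X} (g : Y ⟶ B) {h : B ⟶ E} {k : Y ⟶ E}
    (φ : Cell (Chain.one (homL (𝟙 B) g)) (unit E) h k) (h₁ : 𝟙 B ≫ h = h) (h₂ : 𝟙 Y ≫ k = k)
    (h₃ : h ≫ 𝟙 E = h) (h₄ : k ≫ 𝟙 E = k) :
    comp₁ (leftAct g) φ h₁ h₂ = comp₂ (mapCell h) φ (mulCell E) h₃ h₄ := by
  apply unit_ext_left
  rw [← comp₂_comp₁ _ _ _ _ (Category.id_comp _) (Category.id_comp _) h₁ h₂, unit_id_leftAct,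
    id_comp₁, ← compCell_comp₂ (unitCell B) _ (idCell _) φ _ h₁ h₁ h₂ h₃ h₄, unit_mapCell,
    id_comp₁, oneCell_mulCell]

/-- The 2-cell `⟨⟩ ⇒ B(1, g)(g, 1)` corresponding to the identity of `g`. -/
noncomputable def corepr {B Y : X} (g : Y ⟶ B) : Cell (Chain.nil Y) (homL (𝟙 B) g) g (𝟙 Y) :=
  lift (𝟙 B) g g (𝟙 Y) (oneCell g) (Category.comp_id g) (Category.id_comp g)

/-- The value of a 2-cell out of `B(1, g)` at the identity of `g`. -/
noncomputable def coyoneda {B Y E : X} {g : Y ⟶ B} {h : B ⟶ E} {k : Y ⟶ E} {gh : Y ⟶ E}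
    (φ : Cell (Chain.one (homL (𝟙 B) g)) (unit E) h k) (hg : g ≫ h = gh) :
    Gen (Chain.nil Y) gh k :=
  comp₁ (corepr g) φ hg (Category.id_comp k)

theorem lift_oneCell {B Y Y' : X} (g : Y ⟶ B) (x : Y' ⟶ Y) {g' : Y' ⟶ B} (hx : x ≫ g = g') :
    (lift (𝟙 B) g g' x (oneCell g') (Category.comp_id g') hx :
      Cell (Chain.nil Y') (homL (𝟙 B) g) g' x) =
    compCell (Row.nil x) (corepr g) hx (Category.comp_id x) := by
  apply homL_ext (Category.comp_id _) hx
  rw [lift_homCart, corepr, compCell_comp₁ _ _ _ _ _ _ _ (Category.comp_id g) (Category.id_comp g)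
    hx hx, lift_homCart]
  exact (whisker_oneCell x hx).symm

/-- The Yoneda lemma for `B(1, g)`. An element of `B(y, g')` is its own left action on the identity
element of `g'`, and `φ` commutes with left actions. So `φ` is determined by its value `coyoneda φ`
at the identity of `g`. -/
theorem lift_comp₁ {A B Y Y' E : X} {g : Y ⟶ B} {h : B ⟶ E} {k : Y ⟶ E}
    (φ : Cell (Chain.one (homL (𝟙 B) g)) (unit E) h k) {P : Chain Loose A Y'} {y : A ⟶ B}
    (x : Y' ⟶ Y) {g' : Y' ⟶ B} {yh : A ⟶ E} {gh : Y ⟶ E} {gh' k' : Y' ⟶ E} (α : Gen P y g')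
    (hx : x ≫ g = g') (hy : y ≫ h = yh) (hk : x ≫ k = k') (hg : g ≫ h = gh) (hg' : x ≫ gh = gh')
    (hg'' : g' ≫ h = gh') (e : P = P.append (Chain.nil Y')) :
    comp₁ (lift (𝟙 B) g y x α (Category.comp_id y) hx : Cell P (homL (𝟙 B) g) y x) φ hy hk =
      seq (comp₁ α (mapCell h) hy hg'') (whisker x (coyoneda φ hg) hg' hk) e := by
  have e1 : (lift (𝟙 B) g y x α (Category.comp_id y) hx : Cell P (homL (𝟙 B) g) y x) =
      compCell (Row.cons α (Row.one (lift (𝟙 B) g g' x (oneCell g') (Category.comp_id g') hx :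
        Cell (Chain.nil Y') (homL (𝟙 B) g) g' x)) e) (leftAct g) (Category.comp_id y)
        (Category.comp_id x) := by
    apply homL_ext (Category.comp_id y) hx
    rw [lift_homCart, compCell_comp₁ _ _ _ _ _ _ _ (Category.id_comp _) (Category.id_comp g)
      (Category.comp_id y) hx, leftAct, lift_homCart, ← compCell_cons₂ α (idCell (unit B)) _ _ _ e
      (Category.comp_id y) (Category.comp_id g') hx (Category.comp_id y) (Category.comp_id g'),
      lift_homCart, comp₁_id]
    exact (seq_oneCell α e).symm
  rw [e1, compCell_comp₁ _ _ _ _ _ _ _ (Category.id_comp h) (Category.id_comp k)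
      hy hk, leftAct_comp₁ g φ _ _ (Category.comp_id h) (Category.comp_id k),
      ← compCell_cons₂ α (mapCell h) _ φ _ e hy hg'' hk (Category.comp_id _) (Category.comp_id _),
      lift_oneCell, seq, whisker, coyoneda, compCell_comp₁ _ _ _ _ _ _ _ hg (Category.id_comp k)
      hg' hk]

theorem lift_homCart_id {B Y : X} (g : Y ⟶ B) :
    (lift (𝟙 B) g (𝟙 B) (𝟙 Y) (homCart (𝟙 B) g) (Category.comp_id _) (Category.id_comp g) :
      Cell (Chain.one (homL (𝟙 B) g)) (homL (𝟙 B) g) (𝟙 B) (𝟙 Y)) = idCell _ := by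
  apply homL_ext (Category.comp_id _) (Category.id_comp g)
  rw [lift_homCart, id_comp₁]

theorem eq_coyoneda {B Y E : X} {g : Y ⟶ B} {h : B ⟶ E} {k : Y ⟶ E} {gh : Y ⟶ E}
    (φ : Cell (Chain.one (homL (𝟙 B) g)) (unit E) h k) (hg : g ≫ h = gh) :
    φ = seq (comp₁ (homCart (𝟙 B) g) (mapCell h) (Category.id_comp h) hg) (coyoneda φ hg) rfl := by
  have := lift_comp₁ φ (𝟙 Y) (homCart (𝟙 B) g) (Category.id_comp g) (Category.id_comp h)
    (Category.id_comp k) hg (Category.id_comp gh) hg rfl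
  rw [lift_homCart_id, id_comp₁, id_whisker] at this
  exact this

theorem corepr_homCart {B Y : X} (g : Y ⟶ B) :
    comp₁ (corepr g) (homCart (𝟙 B) g) (Category.comp_id g) (Category.id_comp g) = oneCell g :=
  lift_homCart _ _ _ _ _ _ _

/-- Evaluating the generic element of `B(1, g)` at the identity of `g` turns it into an identity, so
`ξ` can be recovered from its composite with the generic element. -/
theorem corepr_seq {B C Y E : X} (g : Y ⟶ B) {h : B ⟶ E} {gh : Y ⟶ E} (hg : g ≫ h = gh)
    {k : C ⟶ E} {Q : Chain Loose Y C} (ξ : Gen Q gh k)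
    (e' : Q = (Chain.nil Y).append Q) :
    compCell (Row.cons (corepr g) (Row.id Q) e')
      (seq (comp₁ (homCart (𝟙 B) g) (mapCell h) (Category.id_comp h) hg) ξ rfl) hg
      (Category.id_comp k) = ξ := by
  have r1 := RowComp.cons (Φ := Row.id Q) (ψ := ξ) (Category.id_comp gh) (Category.id_comp k)
    (RowComp.nil (f := 𝟙 C) (f' := k) (Category.id_comp k)) (Chain.append_nil Q).symm
    (Chain.append_nil Q).symm
  rw [Row.append_nil] at r1
  have r2 := RowComp.cons (Φ := Row.one (corepr g))
    (ψ := comp₁ (homCart (𝟙 B) g) (mapCell h) (Category.id_comp h) hg) hg (Category.id_comp gh) r1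
    e' rfl
  refine (compCell_assoc r2 (mulCell E) (Category.comp_id _) (Category.comp_id _)
    (Category.comp_id _) (Category.comp_id _) hg (Category.id_comp k)).symm.trans ?_
  have h1 : comp₁ (corepr g) (comp₁ (homCart (𝟙 B) g) (mapCell h) (Category.id_comp h) hg) hg
      (Category.id_comp gh) = oneCell gh := by
    rw [← comp₁_assoc (corepr g) (homCart (𝟙 B) g) (mapCell h) (Category.comp_id g)
      (Category.id_comp g) hg hg, corepr_homCart, oneCell_mapCell]
  have h2 : compCell (Row.id Q) ξ (Category.id_comp gh) (Category.id_comp k) = ξ := id_compCell ξ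
  unfold comp₁ at h1
  rw [h2]
  unfold comp₁
  rw [h1]
  exact oneCell_seq ξ rfl

theorem seq_homCart_cancel {B C Y E : X} {g : Y ⟶ B} {h : B ⟶ E} {gh : Y ⟶ E} {hg : g ≫ h = gh}
    {k : C ⟶ E} {Q : Chain Loose Y C} {ξ ξ' : Gen Q gh k}
    (H : (seq (comp₁ (homCart (𝟙 B) g) (mapCell h) (Category.id_comp h) hg) ξ rfl :
        Gen (Chain.cons (homL (𝟙 B) g) Q) h k) =
      seq (comp₁ (homCart (𝟙 B) g) (mapCell h) (Category.id_comp h) hg) ξ' rfl) : ξ = ξ' := by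
  rw [← corepr_seq g hg ξ rfl, ← corepr_seq g hg ξ' rfl]
  exact congrArg (fun c => compCell _ c hg (Category.id_comp k)) H

/-! ### The category of generalised elements -/

/-- Generalised elements of an object: tight-cells into it. -/
structure Elt (E : X) where
  {dom : X}
  map : dom ⟶ E

/-- Morphisms of generalised elements: 2-cells `P ⇒ E(f, g)` for an arbitrary chain `P`. -/
noncomputable instance (E : X) : Category (Elt E) where
  Hom a b := Σ P : Chain (Loose (X := X)) a.dom b.dom, Gen P a.map b.map
  id a := ⟨Chain.nil a.dom, oneCell a.map⟩
  comp α β := ⟨α.1.append β.1, seq α.2 β.2 rfl⟩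
  id_comp α := Sigma.ext rfl (heq_of_eq (oneCell_seq α.2 rfl))
  comp_id := by
    rintro ⟨f⟩ ⟨g⟩ ⟨P, α⟩
    -- The source chain has to change along `P.append (nil _) = P`. Quantifying over the chain `R`
    -- lets the equality be eliminated.
    have : ∀ R (e : R = P.append (Chain.nil _)), (⟨R, seq α (oneCell g) e⟩ :
        Σ P, Gen P f g) = ⟨_, seq α (oneCell g) rfl⟩ := by
      rintro R rfl; rfl
    exact (this P (Chain.append_nil P).symm).symm.trans (by rw [seq_oneCell])
  assoc := by
    rintro ⟨f⟩ ⟨g⟩ ⟨h⟩ ⟨k⟩ ⟨P, α⟩ ⟨Q, β⟩ ⟨R, γ⟩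
    have : ∀ S (e : S = P.append (Q.append R)), (⟨S, seq α (seq β γ rfl) e⟩ :
        Σ P, Gen P f k) = ⟨_, seq α (seq β γ rfl) rfl⟩ := by
      rintro R rfl; rfl
    exact Eq.trans (by rw [seq_assoc _ _ _ rfl rfl rfl (Chain.append_assoc P Q R)])
      (this _ (Chain.append_assoc P Q R))

/-- `Category.assoc` restricted to `Elt E`, so that rewriting leaves composites of tight-cells
alone. -/
theorem Elt.assoc {E : X} {a b c d : Elt E} (α : a ⟶ b) (β : b ⟶ c) (γ : c ⟶ d) :
    (α ≫ β) ≫ γ = α ≫ β ≫ γ := Category.assoc α β γ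

/-- The morphism of generalised elements given by a 2-cell. -/
def hom {A B E : X} {f : A ⟶ E} {g : B ⟶ E} {P : Chain Loose A B} (α : Gen P f g) :
    Elt.mk f ⟶ Elt.mk g := ⟨P, α⟩

theorem hom_inj {A B E : X} {f : A ⟶ E} {g : B ⟶ E} {P : Chain Loose A B} {α β : Gen P f g} :
    hom α = hom β ↔ α = β :=
  ⟨fun h => eq_of_heq (Sigma.mk.inj h).2, fun h => h ▸ rfl⟩

theorem hom_seq {A B C E : X} {f : A ⟶ E} {g : B ⟶ E} {h : C ⟶ E} {P : Chain Loose A B}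
    {Q : Chain Loose B C} {R : Chain Loose A C} (α : Gen P f g) (β : Gen Q g h)
    (e : R = P.append Q) : hom (seq α β e) = hom α ≫ hom β := by
  subst e; rfl

theorem hom_oneCell {A E : X} (f : A ⟶ E) : hom (oneCell f) = 𝟙 (Elt.mk f) := rfl

/-- The action of a tight-cell on generalised elements. -/
noncomputable def mapc {A B C E : X} (u : C ⟶ E) {f : A ⟶ C} {g : B ⟶ C} {f' : A ⟶ E} {g' : B ⟶ E}
    (hf : f ≫ u = f') (hg : g ≫ u = g') (α : Elt.mk f ⟶ Elt.mk g) : Elt.mk f' ⟶ Elt.mk g' :=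
  ⟨α.1, comp₁ α.2 (mapCell u) hf hg⟩

/-- Whiskering of a 2-cell with empty source by a tight-cell, as a morphism of generalised
elements. -/
def wh {A A' E : X} (x : A' ⟶ A) {f g : A ⟶ E} {f' g' : A' ⟶ E}
    (θ : Gen (Chain.nil A) f g) (hf : x ≫ f = f') (hg : x ≫ g = g') : Elt.mk f' ⟶ Elt.mk g' :=
  hom (whisker x θ hf hg)

theorem hom_comp₁_mapCell {A B C E : X} (u : C ⟶ E) {f : A ⟶ C} {g : B ⟶ C} {f' : A ⟶ E}
    {g' : B ⟶ E} (hf : f ≫ u = f') (hg : g ≫ u = g') {P : Chain Loose A B} (α : Gen P f g) :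
    hom (comp₁ α (mapCell u) hf hg) = mapc u hf hg (hom α) := rfl

section

variable {A A' A'' B C D E : X}

theorem mapc_comp {f : A ⟶ D} {g : B ⟶ D} {h : C ⟶ D} (u : D ⟶ E) {f' : A ⟶ E} {g' : B ⟶ E}
    {h' : C ⟶ E} (hf : f ≫ u = f') (hg : g ≫ u = g') (hh : h ≫ u = h')
    (α : Elt.mk f ⟶ Elt.mk g) (β : Elt.mk g ⟶ Elt.mk h) :
    mapc u hf hh (α ≫ β) = mapc u hf hg α ≫ mapc u hg hh β :=
  Sigma.ext rfl (heq_of_eq (seq_mapCell α.2 β.2 u hf hg hh rfl))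

theorem mapc_one {f : A ⟶ D} (u : D ⟶ E) {f' : A ⟶ E} (hf : f ≫ u = f') :
    mapc u hf hf (𝟙 _) = 𝟙 _ :=
  Sigma.ext rfl (heq_of_eq (oneCell_mapCell f hf hf))

theorem mapc_mapc {f : A ⟶ C} {g : B ⟶ C} (p : C ⟶ D) (q : D ⟶ E) {pq : C ⟶ E} (h : p ≫ q = pq)
    {f' : A ⟶ D} {g' : B ⟶ D} {f'' : A ⟶ E} {g'' : B ⟶ E} (hf : f ≫ p = f') (hg : g ≫ p = g')
    (hf' : f' ≫ q = f'') (hg' : g' ≫ q = g'') (hf'' : f ≫ pq = f'') (hg'' : g ≫ pq = g'')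
    (α : Elt.mk f ⟶ Elt.mk g) :
    mapc q hf' hg' (mapc p hf hg α) = mapc pq hf'' hg'' α := by
  obtain ⟨P, α⟩ := α
  change hom (comp₁ (comp₁ α (mapCell p) hf hg) (mapCell q) hf' hg') =
    hom (comp₁ α (mapCell pq) hf'' hg'')
  rw [← mapCell_comp p q h, ← comp₁_assoc]

theorem mapc_id {f : A ⟶ C} {g : B ⟶ C} (hf : f ≫ 𝟙 C = f) (hg : g ≫ 𝟙 C = g)
    (α : Elt.mk f ⟶ Elt.mk g) : mapc (𝟙 C) hf hg α = α := by
  obtain ⟨P, α⟩ := α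
  change hom (comp₁ α (mapCell (𝟙 C)) hf hg) = hom α
  rw [mapCell_id, comp₁_id]

/-- The interchange law. -/
theorem mapc_comp_wh {f : A ⟶ C} {g : B ⟶ C} {u k : C ⟶ E}
    {fu fk : A ⟶ E} {gu gk : B ⟶ E} (α : Elt.mk f ⟶ Elt.mk g) (θ : Gen (Chain.nil C) u k)
    (hfu : f ≫ u = fu) (hfk : f ≫ k = fk) (hgu : g ≫ u = gu) (hgk : g ≫ k = gk) :
    mapc u hfu hgu α ≫ wh g θ hgu hgk = wh f θ hfu hfk ≫ mapc k hfk hgk α := by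
  obtain ⟨P, α⟩ := α
  change hom (comp₁ α (mapCell u) hfu hgu) ≫ hom (whisker g θ hgu hgk) =
    hom (whisker f θ hfu hfk) ≫ hom (comp₁ α (mapCell k) hfk hgk)
  rw [← hom_seq _ _ (Chain.append_nil P).symm,
    ← hom_seq (R := P) (whisker f θ hfu hfk) (comp₁ α (mapCell k) hfk hgk) rfl,
    seq_whisker α θ hfu hfk hgu hgk (Chain.append_nil P).symm rfl]

theorem id_wh {f g : A ⟶ E} (θ : Gen (Chain.nil A) f g) (hf : 𝟙 A ≫ f = f) (hg : 𝟙 A ≫ g = g) :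
    wh (𝟙 A) θ hf hg = hom θ := congrArg hom (id_whisker θ hf hg)

theorem wh_congr {x y : A' ⟶ A} (h : x = y) {f g : A ⟶ E} {f' g' : A' ⟶ E}
    (θ : Gen (Chain.nil A) f g) (hf : x ≫ f = f') (hg : x ≫ g = g') (hf' : y ≫ f = f')
    (hg' : y ≫ g = g') : wh x θ hf hg = wh y θ hf' hg' := by subst h; rfl

theorem wh_oneCell (x : A' ⟶ A) {f : A ⟶ E} {f' : A' ⟶ E} (hf : x ≫ f = f') :
    wh x (oneCell f) hf hf = 𝟙 _ := congrArg hom (whisker_oneCell x hf)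

theorem wh_whisker (y : A'' ⟶ A') (x : A' ⟶ A) {yx : A'' ⟶ A}
    (h : y ≫ x = yx) {f g : A ⟶ E} {f' g' : A' ⟶ E}
    {f'' g'' : A'' ⟶ E} (θ : Gen (Chain.nil A) f g) (hf : x ≫ f = f') (hg : x ≫ g = g')
    (hf' : y ≫ f' = f'') (hg' : y ≫ g' = g'') (hf'' : yx ≫ f = f'') (hg'' : yx ≫ g = g'') :
    wh y (whisker x θ hf hg) hf' hg' = wh yx θ hf'' hg'' :=
  congrArg hom (whisker_whisker y x h θ hf hg hf' hg' hf'' hg'')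

theorem wh_comp₁_mapCell (x : A' ⟶ A) {f g : A ⟶ D} (u : D ⟶ E) {f' g' : A' ⟶ D}
    {fu gu : A ⟶ E} {fu' gu' : A' ⟶ E} (θ : Gen (Chain.nil A) f g) (hf : x ≫ f = f')
    (hg : x ≫ g = g') (hfu : f ≫ u = fu) (hgu : g ≫ u = gu) (hfu' : x ≫ fu = fu')
    (hgu' : x ≫ gu = gu') (hfu'' : f' ≫ u = fu') (hgu'' : g' ≫ u = gu') :
    wh x (comp₁ θ (mapCell u) hfu hgu : Gen (Chain.nil A) fu gu) hfu' hgu' =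
      mapc u hfu'' hgu'' (wh x θ hf hg) :=
  congrArg hom (whisker_mapCell x u θ hf hg hfu hgu hfu' hgu' hfu'' hgu'')

theorem wh_seq (x : A' ⟶ A) {f g h : A ⟶ E} {f' g' h' : A' ⟶ E}
    (θ : Gen (Chain.nil A) f g) (θ' : Gen (Chain.nil A) g h) (hf : x ≫ f = f') (hg : x ≫ g = g')
    (hh : x ≫ h = h') :
    wh x (seq θ θ' rfl : Gen (Chain.nil A) f h) hf hh = wh x θ hf hg ≫ wh x θ' hg hh := by
  rw [wh, whisker_seq x θ θ' hf hg hh, hom_seq, wh, wh]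

/-- The inverse of a morphism of actions is a morphism of actions. -/
theorem mapc_comp_of_inverse {f ft : A ⟶ E} {g gt : B ⟶ E} {t : E ⟶ E} (hf : f ≫ t = ft)
    (hg : g ≫ t = gt) {k : Elt.mk ft ⟶ Elt.mk f} {k' : Elt.mk gt ⟶ Elt.mk g}
    {α : Elt.mk f ⟶ Elt.mk g} {β : Elt.mk g ⟶ Elt.mk f} (h₁ : α ≫ β = 𝟙 _) (h₂ : β ≫ α = 𝟙 _)
    (h : mapc t hf hg α ≫ k' = k ≫ α) : mapc t hg hf β ≫ k = k' ≫ β := by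
  rw [← Category.comp_id (mapc t hg hf β ≫ k), ← h₁, Elt.assoc, ← Elt.assoc k, ← h, Elt.assoc,
    ← Elt.assoc, ← mapc_comp t hg hf hg, h₂, mapc_one, Category.id_comp]

/-- Transport of the equality of two whiskered 2-cells along a further whiskering. -/
theorem wh_of_hom_eq (x : A' ⟶ A) {f g : A ⟶ E} {f' g' : A' ⟶ E} {θ θ' : Gen (Chain.nil A) f g}
    (h : hom θ = hom θ') (hf : x ≫ f = f') (hg : x ≫ g = g') : wh x θ hf hg = wh x θ' hf hg := by
  rw [hom_inj.1 h]

end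

/-! ### 2-cells between hom loose-cells as morphisms of generalised elements -/

theorem hom_und_inj {A B E : X} {P : Chain Loose A B} {f : A ⟶ E} {g : B ⟶ E}
    {α β : Glob P (homL f g)} : hom (und α) = hom (und β) ↔ α = β :=
  ⟨fun h => und_ext (hom_inj.1 h), fun h => h ▸ rfl⟩

theorem exists_und_eq {A B E : X} {P : Chain Loose A B} {f : A ⟶ E} {g : B ⟶ E}
    (α : Gen P f g) : ∃ β : Glob P (homL f g), und β = α :=
  ⟨lift f g (𝟙 A) (𝟙 B) α (Category.id_comp f) (Category.id_comp g), lift_homCart _ _ _ _ _ _ _⟩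

theorem hom_und_mul {A B C E : X} {f : A ⟶ E} {g : B ⟶ E} {h : C ⟶ E} {P : Chain Loose A B}
    {Q : Chain Loose B C} (α : Glob P (homL f g)) (β : Glob Q (homL g h)) :
    hom (und (gcomp₂ α β (mul f g h))) = hom (und α) ≫ hom (und β) := by
  rw [und_gcomp_mul]; rfl

theorem hom_und_ident {A E : X} (f : A ⟶ E) : hom (und (ident f)) = 𝟙 _ := by
  rw [und_ident]; rfl

theorem und_idCell {A B E : X} (f : A ⟶ E) (g : B ⟶ E) : und (idCell (homL f g)) = homCart f g :=
  id_comp₁ _ _ _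

theorem hom_und_act {A B C E : X} {f : A ⟶ C} {g : B ⟶ C} (u : C ⟶ E) {f' : A ⟶ E} {g' : B ⟶ E}
    (hf : f ≫ u = f') (hg : g ≫ u = g') {P : Chain Loose A B} (α : Glob P (homL f g)) :
    hom (und (gcomp α (act f g u hf hg))) = mapc u hf hg (hom (und α)) := by
  rw [und_gcomp_act]; rfl

/-- The generic element of `B(1, g)`. -/
def gen {B Y : X} (g : Y ⟶ B) : Elt.mk (𝟙 B) ⟶ Elt.mk g := hom (homCart (𝟙 B) g)

theorem hom_eq_coyoneda {B Y E : X} {g : Y ⟶ B} {h : B ⟶ E} {k : Y ⟶ E} {gh : Y ⟶ E}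
    (φ : Cell (Chain.one (homL (𝟙 B) g)) (unit E) h k) (hg : g ≫ h = gh) :
    hom φ = mapc h (Category.id_comp h) hg (gen g) ≫ hom (coyoneda φ hg) :=
  congrArg hom (eq_coyoneda φ hg)

theorem hom_und_gcomp {B Y E : X} {g : Y ⟶ B} {h : B ⟶ E} {k : Y ⟶ E} {gh : Y ⟶ E}
    (φ : Glob (Chain.one (homL (𝟙 B) g)) (homL h k)) (hg : g ≫ h = gh) {P : Chain Loose B Y}
    (α : Glob P (homL (𝟙 B) g)) :
    hom (und (gcomp α φ)) =
      mapc h (Category.id_comp h) hg (hom (und α)) ≫ hom (coyoneda (und φ) hg) := by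
  have e := lift_comp₁ (und φ) (𝟙 Y) (und α) (Category.id_comp g) (Category.id_comp h)
    (Category.id_comp k) hg (Category.id_comp gh) hg (Chain.append_nil P).symm
  rw [id_whisker] at e
  have e' : und (gcomp α φ) = _ := (und_gcomp_hat φ α).trans e
  rw [e', hom_seq]; rfl

/-- An equation with a free variable ranging over `B(1, g)` may be tested at the generic element.
Injectivity of `Chain.cons` also recovers the source chain of `ξ`, so the two morphisms need not be
known to have the same chain. -/
theorem gen_cancel {B C Y E : X} {g : Y ⟶ B} {h : B ⟶ E} {gh : Y ⟶ E} {hg : g ≫ h = gh}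
    {k : C ⟶ E} {ξ ξ' : Elt.mk gh ⟶ Elt.mk k}
    (H : mapc h (Category.id_comp h) hg (gen g) ≫ ξ =
      mapc h (Category.id_comp h) hg (gen g) ≫ ξ') : ξ = ξ' := by
  obtain ⟨Q, ξ⟩ := ξ
  obtain ⟨Q', ξ'⟩ := ξ'
  obtain ⟨h1, h2⟩ := Sigma.mk.inj H
  obtain rfl : Q = Q' := by
    injection h1
  exact hom_inj.2 (seq_homCart_cancel (eq_of_heq h2))

/-! ### Adjunctions -/

namespace RelativeAdjunction

variable {C E : X} {l : E ⟶ C} {r : C ⟶ E} (a : Adjunction l r)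

/-- The unit of an adjunction. -/
noncomputable def eta : Gen (Chain.nil E) (𝟙 E) (l ≫ r) := und a.unit

/-- The counit of an adjunction. -/
noncomputable def eps : Gen (Chain.nil C) (r ≫ l) (𝟙 C) := coyoneda (und a.flat) rfl

/-- Transposition in the usual form `α ↦ ℓ(α) ; ε`: by Yoneda, `flat` is determined by its value at
the identity of `r`, which is the counit. -/
theorem hat_flat_eq {D : X} (x : D ⟶ C) {e : D ⟶ E} {el : D ⟶ C} (h : x ≫ r = e) (hl : e ≫ l = el)
    (hx : x ≫ r ≫ l = el) {P : Chain Loose E D} (α : Gen P (𝟙 E) e) :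
    hom (hat a.flat x h (Category.comp_id x) α) =
      mapc l (Category.id_comp l) hl (hom α) ≫ wh x a.eps hx (Category.comp_id x) := by
  have := lift_comp₁ (und a.flat) x α h (Category.id_comp l) (Category.comp_id x) rfl hx hl
    (Chain.append_nil P).symm
  exact (congrArg hom this).trans (hom_seq _ _ _)

/-- Transposition in the usual form `α ↦ η ; r(α)`. Writing `α` as the identity of `ℓ` followed by
`α`, linearity of `sharp` leaves only its value at that identity, which is `η`. -/
theorem hat_sharp_eq {D : X} (x : D ⟶ C) {e : D ⟶ E} (h : x ≫ r = e)
    {P : Chain Loose E D} (α : Gen P l x) :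
    hom (hat a.sharp x (Category.comp_id x) h α) = hom a.eta ≫ mapc r rfl h (hom α) := by
  have : hat a.sharp x (Category.comp_id x) h
      (comp₂ (oneCell l) α (mulCell C) (Category.comp_id l) (Category.comp_id x)) = _ :=
    hat_mul a.sharp l x rfl h _ _
  rw [oneCell_mulCell] at this
  rw [this, ← und_unit]; rfl

theorem eta_flat : hom (hat a.flat l rfl (Category.comp_id l) a.eta) = 𝟙 _ := by
  rw [eta, und_unit, hat_flat_sharp]; rfl

theorem seq_eta_eps {lrl : E ⟶ C} (h₁ : (l ≫ r) ≫ l = lrl) (h₂ : l ≫ r ≫ l = lrl) :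
    (seq (comp₁ a.eta (mapCell l) (Category.id_comp l) h₁)
      (whisker l a.eps h₂ (Category.comp_id l)) rfl : Gen (Chain.nil E) l l) = oneCell l := by
  rw [← hom_inj, hom_oneCell, ← eta_flat, a.hat_flat_eq l rfl h₁ h₂]; rfl

/-- A triangle identity. -/
theorem triangle_left {A : X} (x : A ⟶ E) {xlr : A ⟶ E} {xl xlrl : A ⟶ C} (h : x ≫ 𝟙 E = x)
    (h₁ : x ≫ l ≫ r = xlr) (h₂ : x ≫ l = xl) (h₃ : xlr ≫ l = xlrl) (h₄ : xl ≫ r ≫ l = xlrl)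
    (h₅ : xl ≫ 𝟙 C = xl) :
    mapc l h₂ h₃ (wh x a.eta h h₁) ≫ wh xl a.eps h₄ h₅ = 𝟙 _ := by
  have e := wh_of_hom_eq x (congrArg hom (a.seq_eta_eps rfl (by simp))) h₂ h₂
  rw [wh_seq (g' := xlrl) x _ _ h₂ (by simp [← h₃, ← h₁]) h₂,
    wh_comp₁_mapCell x l a.eta h h₁ _ _ _ (by simp [← h₃, ← h₁]) h₂ h₃,
    wh_whisker x l h₂ a.eps _ _ _ _ h₄ h₅, wh_oneCell] at e
  exact e

/-- A triangle identity. -/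
theorem triangle_right {A : X} (x : A ⟶ C) {xr xrlr : A ⟶ E} {xrl : A ⟶ C} (h : x ≫ r = xr)
    (h₀ : xr ≫ 𝟙 E = xr) (h₁ : xr ≫ l ≫ r = xrlr) (h₂ : x ≫ r ≫ l = xrl) (h₃ : x ≫ 𝟙 C = x)
    (h₄ : xrl ≫ r = xrlr) :
    wh xr a.eta h₀ h₁ ≫ mapc r h₄ h (wh x a.eps h₂ h₃) = 𝟙 _ := by
  -- The identity `flat ; sharp = 1` is taken at the generic element of `E(1, xr)`. Naturality of
  -- `η` then moves the generic element to the front, where it cancels.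
  have e : hom (hat a.sharp x (Category.comp_id x) h
      (hat a.flat x h (Category.comp_id x) (homCart (𝟙 E) xr))) = gen xr := by
    rw [hat_sharp_flat]; rfl
  have hxl : xr ≫ l = xrl := by simp [← h₂, ← h]
  rw [hat_sharp_eq, a.hat_flat_eq x h hxl h₂, mapc_comp r rfl h₄ h,
    mapc_mapc l r rfl _ _ _ _ (by simp) h₁] at e
  rw [← id_wh a.eta (by simp) (by simp), ← Elt.assoc] at e
  erw [← mapc_comp_wh (gen xr) a.eta (by simp) (by simp) h₀ h₁] at e
  rw [Elt.assoc] at e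
  refine gen_cancel (hg := h₀) (h := 𝟙 E) (e.trans ?_)
  rw [mapc_id, Category.comp_id]

/-- One half of the transposition bijection, at an arbitrary `y` in place of the identity of `E`.
Naturality of `ε` reduces it to a triangle identity. -/
theorem flat_sharp_hom {A B : X} {y : A ⟶ E} {x : B ⟶ C} {yl : A ⟶ C} {xr : B ⟶ E} {xrl : B ⟶ C}
    (hl : y ≫ l = yl) (hr : x ≫ r = xr) (hrl : xr ≫ l = xrl) (hx : x ≫ r ≫ l = xrl)
    (hx' : x ≫ 𝟙 C = x) {ylr : A ⟶ E} (hy : y ≫ 𝟙 E = y) (hy' : y ≫ l ≫ r = ylr)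
    (hlr : yl ≫ r = ylr) (β : Elt.mk yl ⟶ Elt.mk x) :
    mapc l hl hrl (wh y a.eta hy hy' ≫ mapc r hlr hr β) ≫ wh x a.eps hx hx' = β := by
  have h1 : ylr ≫ l = yl ≫ r ≫ l := by simp [← hlr]
  rw [mapc_comp l hl h1 hrl, mapc_mapc r l rfl _ _ _ _ rfl hx, Elt.assoc,
    mapc_comp_wh β a.eps rfl (Category.comp_id yl) hx hx', ← Elt.assoc,
    triangle_left a y hy hy' hl h1 rfl, mapc_id, Category.id_comp]

end RelativeAdjunction

/-! ### Algebras as actions -/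

namespace RelativeAdjunction

variable {C E : X} {l : E ⟶ C} {r : C ⟶ E} (a : Adjunction l r)

/-- Eilenberg–Moore style algebras: 2-cells `(e ; ℓ ; r) ⇒ e` satisfying the unit and
associativity laws. -/
structure IsAction {D : X} (e : D ⟶ E) (k : Gen (Chain.nil D) (e ≫ l ≫ r) e) : Prop where
  unit : wh e a.eta (Category.comp_id e) rfl ≫ hom k = 𝟙 _
  assoc : mapc (l ≫ r) rfl rfl (hom k) ≫ hom k =
    mapc r (by simp) (by simp) (wh (e ≫ l) a.eps rfl (Category.comp_id (e ≫ l))) ≫ hom k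

variable {a}

theorem gen_cancel_iff {B C Y E : X} {g : Y ⟶ B} {h : B ⟶ E} {gh : Y ⟶ E} {h₁ : 𝟙 B ≫ h = h}
    {hg : g ≫ h = gh} {k : C ⟶ E} {ξ ξ' : Elt.mk gh ⟶ Elt.mk k} :
    mapc h h₁ hg (gen g) ≫ ξ = mapc h h₁ hg (gen g) ≫ ξ' ↔ ξ = ξ' :=
  ⟨gen_cancel, fun H => H ▸ rfl⟩

theorem hom_comp_mapc {A B E : X} {f : A ⟶ B} {u k : B ⟶ E} {fu fk : A ⟶ E}
    (θ : Gen (Chain.nil B) u k) (hu : 𝟙 B ≫ u = u) (hk : 𝟙 B ≫ k = k) (hfu : f ≫ u = fu)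
    (hfk : f ≫ k = fk) (α : Elt.mk (𝟙 B) ⟶ Elt.mk f) :
    hom θ ≫ mapc k hk hfk α = mapc u hu hfu α ≫ wh f θ hfu hfk := by
  rw [mapc_comp_wh α θ hu hk hfu hfk, id_wh]

/-- Naturality of `η` brings the generic element of `E(1, e)` to the front of both sides, and it can
then be cancelled. -/
theorem unit_mul_iff {D : X} {e : D ⟶ E} {k : Gen (Chain.nil D) (e ≫ l ≫ r) e}
    {φ : Glob (Chain.one (homL (𝟙 E) e)) (homL (l ≫ r) e)}
    (hφ : hom (und φ) = mapc (l ≫ r) (Category.id_comp _) rfl (gen e) ≫ hom k) :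
    gcomp₂ a.unit φ (mul (𝟙 E) (l ≫ r) e) = idCell (homL (𝟙 E) e) ↔
      wh e a.eta (Category.comp_id e) rfl ≫ hom k = 𝟙 _ := by
  rw [← gen_cancel_iff (hg := Category.comp_id e) (h₁ := Category.comp_id _)]
  have h1 : hom (und (gcomp₂ a.unit φ (mul (𝟙 E) (l ≫ r) e))) =
      mapc (𝟙 E) (Category.comp_id _) (Category.comp_id e) (gen e) ≫
        wh e a.eta (Category.comp_id e) rfl ≫ hom k := by
    rw [hom_und_mul, hφ, ← Elt.assoc, ← Elt.assoc]
    congr 1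
    exact hom_comp_mapc a.eta (Category.comp_id _) (Category.id_comp _) (Category.comp_id e) rfl _
  have h2 : hom (und (idCell (homL (𝟙 E) e))) =
      mapc (𝟙 E) (Category.comp_id _) (Category.comp_id e) (gen e) ≫ 𝟙 _ := by
    rw [mapc_id, Category.comp_id, und_idCell]; rfl
  rw [← h1, ← h2]
  exact hom_und_inj.symm

/-- The action on `x ; r` is `r` applied to the counit at `x`, as for the comparison functor of
ordinary monad theory. -/
theorem coyoneda_und_ext {D : X} (x : D ⟶ C) {e : D ⟶ E} {et : D ⟶ E} {el : D ⟶ C} (h : x ≫ r = e)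
    (het : e ≫ l ≫ r = et) (hel : x ≫ r ≫ l = el) (hx : x ≫ 𝟙 C = x) (h' : el ≫ r = et) :
    coyoneda (und (a.ext x h)) het = comp₁ (whisker x a.eps hel hx) (mapCell r) h' h := by
  have hl : e ≫ l = el := by simp [← hel, ← h]
  rw [← hom_inj]
  apply gen_cancel (hg := het)
  rw [← hom_eq_coyoneda, und_ext', hom_comp₁_mapCell, a.hat_flat_eq x h hl hel, und_idCell,
    mapc_comp r rfl h' h, mapc_mapc l r rfl _ _ _ _ (Category.id_comp _) het]
  rfl

/-- The extension law has two variables, ranging over `E(1, t)` and `E(1, e)`. Both sides begin with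
the two generic elements, which are cancelled one after the other. -/
theorem mul_ext_iff {D : X} {e : D ⟶ E} {k : Gen (Chain.nil D) (e ≫ l ≫ r) e}
    {φ : Glob (Chain.one (homL (𝟙 E) e)) (homL (l ≫ r) e)}
    (hφ : hom (und φ) = mapc (l ≫ r) (Category.id_comp _) rfl (gen e) ≫ hom k) :
    gcomp (gcomp₂ (idCell (homL (𝟙 E) (l ≫ r))) φ (mul (𝟙 E) (l ≫ r) e)) φ =
        gcomp₂ (a.ext l rfl) φ (mul (l ≫ r) (l ≫ r) e) ↔
      mapc (l ≫ r) rfl rfl (hom k) ≫ hom k =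
        mapc r (by simp) (by simp) (wh (e ≫ l) a.eps rfl (Category.comp_id (e ≫ l))) ≫ hom k := by
  have hk : coyoneda (und φ) rfl = k := by
    rw [← hom_inj]
    apply gen_cancel (hg := rfl)
    rw [← hom_eq_coyoneda, hφ]
  have h3 : (l ≫ r ≫ l) ≫ r = (l ≫ r) ≫ l ≫ r := by simp
  have h4 : e ≫ (l ≫ r) ≫ (l ≫ r) = (e ≫ (l ≫ r)) ≫ (l ≫ r) := by simp
  have h1 : hom (und (gcomp (gcomp₂ (idCell (homL (𝟙 E) (l ≫ r))) φ (mul (𝟙 E) (l ≫ r) e)) φ)) =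
      mapc (l ≫ r) (Category.id_comp _) rfl (gen (l ≫ r)) ≫
        mapc ((l ≫ r) ≫ (l ≫ r)) (Category.id_comp _) h4 (gen e) ≫
        mapc (l ≫ r) rfl rfl (hom k) ≫ hom k := by
    rw [hom_und_gcomp φ rfl, hom_und_mul, hφ, hk, mapc_comp (l ≫ r) (Category.id_comp _) rfl rfl,
      mapc_comp (l ≫ r) rfl rfl rfl, mapc_mapc (l ≫ r) (l ≫ r) rfl _ _ _ _ _ h4, und_idCell,
      Elt.assoc, Elt.assoc]
    rfl
  have h2 : hom (und (gcomp₂ (a.ext l rfl) φ (mul (l ≫ r) (l ≫ r) e))) =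
      mapc (l ≫ r) (Category.id_comp _) rfl (gen (l ≫ r)) ≫
        mapc ((l ≫ r) ≫ (l ≫ r)) (Category.id_comp _) h4 (gen e) ≫
        mapc r (by simp) (by simp) (wh (e ≫ l) a.eps rfl (Category.comp_id (e ≫ l))) ≫ hom k := by
    rw [hom_und_mul, hom_eq_coyoneda (und (a.ext l rfl)) rfl,
      coyoneda_und_ext l rfl rfl rfl (Category.comp_id l) h3, hφ, Elt.assoc]
    congr 1
    rw [← Elt.assoc, hom_comp_mapc _ (Category.id_comp _) (Category.id_comp _) h4 rfl,
      Elt.assoc]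
    congr 2
    rw [wh_comp₁_mapCell (f' := (e ≫ l) ≫ r ≫ l) (g' := e ≫ l) e r _ (by simp) rfl h3 rfl h4 rfl
      (by simp) (by simp)]
    exact congrArg _ (wh_whisker e l rfl a.eps rfl (Category.comp_id l) (by simp) rfl rfl
      (Category.comp_id _))
  rw [← hom_und_inj, h1, h2, gen_cancel_iff, gen_cancel_iff]

/-! ### Algebras, graded morphisms and restrictions in terms of actions. -/

section Algebras

variable {D D' : X}

/-- The extension operator of an algebra. -/
def algExt (M : a.monad.Algebra D) : Glob (Chain.one (homL (𝟙 E) M.e)) (homL (l ≫ r) M.e) := M.ext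

/-- The action of an algebra. -/
noncomputable def action (M : a.monad.Algebra D) : Gen (Chain.nil D) (M.e ≫ l ≫ r) M.e :=
  coyoneda (und (algExt M)) rfl

theorem hom_algExt (M : a.monad.Algebra D) :
    hom (und (algExt M)) =
      mapc (l ≫ r) (Category.id_comp _) rfl (gen M.e) ≫ hom (action M) :=
  hom_eq_coyoneda _ rfl

theorem isAction_action (M : a.monad.Algebra D) : a.IsAction M.e (action M) :=
  ⟨(unit_mul_iff (hom_algExt M)).1 M.unit_mul_ext, (mul_ext_iff (hom_algExt M)).1 M.ext_ext⟩

/-- The extension operator is `f ↦ t(f) ; k`, written down at the generic `f`. -/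
theorem IsAction.exists_algebra {e : D ⟶ E} {k : Gen (Chain.nil D) (e ≫ l ≫ r) e}
    (h : a.IsAction e k) : ∃ φ : Glob (Chain.one (homL (𝟙 E) e)) (homL (l ≫ r) e),
    ∃ (h₁ : _) (h₂ : _), action (⟨e, φ, h₁, h₂⟩ : a.monad.Algebra D) = k := by
  obtain ⟨φ, hφ⟩ := exists_und_eq (seq (comp₁ (homCart (𝟙 E) e) (mapCell (l ≫ r))
    (Category.id_comp _) rfl) k rfl : Gen (Chain.one (homL (𝟙 E) e)) (l ≫ r) e)
  have hφ' : hom (und φ) = mapc (l ≫ r) (Category.id_comp _) rfl (gen e) ≫ hom k := by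
    rw [hφ, hom_seq]; rfl
  refine ⟨φ, (unit_mul_iff hφ').2 h.unit, (mul_ext_iff hφ').2 h.assoc, ?_⟩
  rw [← hom_inj]
  apply gen_cancel (hg := rfl)
  exact (hom_eq_coyoneda (und φ) rfl).symm.trans hφ'

/-- Both sides of the graded morphism law begin with the generic element of `E(1, M.e)`. Cancelling
it leaves the usual square. -/
theorem isGradedMorphism_iff (M : a.monad.Algebra D) (N : a.monad.Algebra D') {P : Chain Loose D D'}
    (ψ : Glob P (homL M.e N.e)) :
    M.IsGradedMorphism N ψ ↔ mapc (l ≫ r) rfl rfl (hom (und ψ)) ≫ hom (action N) =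
      hom (action M) ≫ hom (und ψ) := by
  have h1 : hom (und (gcomp (gcomp₂ (idCell (homL (𝟙 E) M.e)) ψ (mul (𝟙 E) M.e N.e)) (algExt N))) =
      mapc (l ≫ r) (Category.id_comp _) rfl (gen M.e) ≫
        mapc (l ≫ r) rfl rfl (hom (und ψ)) ≫ hom (action N) := by
    rw [hom_und_gcomp _ rfl, hom_und_mul, mapc_comp (l ≫ r) (Category.id_comp _) rfl rfl, und_idCell,
      Elt.assoc]
    rfl
  have h2 : hom (und (gcomp₂ (algExt M) ψ (mul (l ≫ r) M.e N.e))) =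
      mapc (l ≫ r) (Category.id_comp _) rfl (gen M.e) ≫ hom (action M) ≫ hom (und ψ) := by
    rw [hom_und_mul, hom_algExt, Elt.assoc]
  rw [← gen_cancel_iff (h₁ := Category.id_comp _) (hg := rfl), ← h1, ← h2, hom_und_inj]
  rfl

theorem isPullback_iff (M : a.monad.Algebra D) (U : a.monad.Algebra D') (x : D ⟶ D') :
    M.IsPullback U x ↔ ∃ h : x ≫ U.e = M.e, wh x (action U) (by rw [← h]; simp) h =
      hom (action M) := by
  refine exists_congr fun h => ?_
  have h1 : hom (und (restrictR (algExt U) x h h)) =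
      mapc (l ≫ r) (Category.id_comp _) rfl (gen M.e) ≫
        wh x (action U) (by rw [← h]; simp) h := by
    have e := lift_comp₁ (und (algExt U)) x (und (idCell (homL (𝟙 E) M.e))) h (Category.id_comp _) h
      rfl (by rw [← h]; simp : x ≫ U.e ≫ l ≫ r = M.e ≫ l ≫ r) rfl rfl
    rw [← idCell_gcomp (restrictR (algExt U) x h h)]
    have e' := (und_gcomp_restrictR (algExt U) x h h (idCell (homL (𝟙 E) M.e))).trans e
    rw [e', und_idCell]
    exact hom_seq _ _ _
  rw [← gen_cancel_iff (h₁ := Category.id_comp _) (h := l ≫ r) (hg := rfl), ← h1, ← hom_algExt, hom_und_inj]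
  rfl

variable (a)

/-- The action of the monad induced by an adjunction `ℓ ⊣ r` on a tight-cell `x ; r`. -/
noncomputable def freeAct {f ft : D ⟶ E} (x : D ⟶ C) (hx : x ≫ r = f) (hf : f ≫ l ≫ r = ft) :
    Elt.mk ft ⟶ Elt.mk f :=
  mapc r (by rw [← hf, ← hx]; simp) hx (wh x a.eps rfl (Category.comp_id x))

theorem freeAct_eq {f ft : D ⟶ E} {y : D ⟶ C} (x : D ⟶ C) (hx : x ≫ r = f) (hf : f ≫ l ≫ r = ft)
    (hy : x ≫ r ≫ l = y) (hy' : y ≫ r = ft) :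
    a.freeAct x hx hf = mapc r hy' hx (wh x a.eps hy (Category.comp_id x)) := by
  subst hy; rfl

/-- The algebra with carrier `x ; r`. -/
noncomputable def algebraAt (x : D ⟶ C) : a.monad.Algebra D where
  e := x ≫ r
  ext := a.ext x rfl
  unit_mul_ext := a.unit_mul_ext x rfl
  ext_ext := a.ext_ext x rfl

theorem hom_action_algebraAt (x : D ⟶ C) :
    hom (action (a.algebraAt x)) = a.freeAct x rfl rfl :=
  congrArg hom (coyoneda_und_ext x rfl rfl rfl (Category.comp_id x) (by simp))

theorem action_algebra : action a.algebra =
    comp₁ a.eps (mapCell r) (Category.assoc r l r) (Category.id_comp r) := by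
  have := coyoneda_und_ext (a := a) (𝟙 C) (Category.id_comp r) rfl
    (Category.id_comp (r ≫ l)) (Category.comp_id _) (Category.assoc r l r)
  rw [id_whisker] at this
  exact this

theorem wh_action_algebra (x : D ⟶ C) {f ft : D ⟶ E} (hx : x ≫ r = f) (hf : f ≫ l ≫ r = ft)
    (hx' : x ≫ r ≫ l ≫ r = ft) : wh x (action a.algebra) hx' hx = a.freeAct x hx hf := by
  rw [action_algebra]
  exact wh_comp₁_mapCell x r a.eps rfl (Category.comp_id x) _ _ _ _ _ _

theorem wh_freeAct {A : X} (z : A ⟶ D) (x : D ⟶ C) {zx : A ⟶ C} (hzx : z ≫ x = zx) {f ft : D ⟶ E}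
    {f' ft' : A ⟶ E} (hx : x ≫ r = f) (hf : f ≫ l ≫ r = ft) {k : Gen (Chain.nil D) ft f}
    (hk : hom k = a.freeAct x hx hf) (h₁ : z ≫ ft = ft') (h₂ : z ≫ f = f') (h₃ : zx ≫ r = f')
    (h₄ : f' ≫ l ≫ r = ft') : wh z k h₁ h₂ = a.freeAct zx h₃ h₄ := by
  have e : (x ≫ r ≫ l) ≫ r = ft := by rw [← hf, ← hx]; simp
  have e' : hom k = hom (comp₁ (whisker x a.eps rfl (Category.comp_id x)) (mapCell r) e hx) := hk
  have e₁ : z ≫ x ≫ r ≫ l = zx ≫ r ≫ l := by rw [← hzx]; simp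
  rw [hom_inj.1 e', wh_comp₁_mapCell z r _ e₁ hzx e hx h₁ h₂ (by rw [← e₁, ← h₁, ← e]; simp) h₃,
    wh_whisker z x hzx a.eps _ _ _ _ rfl (Category.comp_id zx)]
  rfl

/-- Any 2-cell in the image of `r` respects the canonical actions, by naturality of `ε` followed by
an application of `r`. -/
theorem freeAct_naturality {x : D ⟶ C} {y : D' ⟶ C} {f ft : D ⟶ E} {g gt : D' ⟶ E} (hx : x ≫ r = f)
    (hf : f ≫ l ≫ r = ft) (hy : y ≫ r = g) (hg : g ≫ l ≫ r = gt) (χ : Elt.mk x ⟶ Elt.mk y) :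
    mapc (l ≫ r) hf hg (mapc r hx hy χ) ≫ a.freeAct y hy hg =
      a.freeAct x hx hf ≫ mapc r hx hy χ := by
  have h1 : f ≫ l = x ≫ r ≫ l := by rw [← hx]; simp
  have h2 : g ≫ l = y ≫ r ≫ l := by rw [← hy]; simp
  rw [freeAct, freeAct, ← mapc_mapc l r rfl h1 h2 (by rw [← h1, ← hf]; simp)
    (by rw [← h2, ← hg]; simp), ← mapc_comp,
    ← mapc_comp, mapc_mapc r l rfl _ _ _ _ rfl rfl,
    mapc_comp_wh χ a.eps rfl (Category.comp_id x) rfl (Category.comp_id y), mapc_id]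

theorem isAction_freeAct (x : D ⟶ C) :
    ∃ k, a.IsAction (x ≫ r) k ∧ hom k = a.freeAct x rfl rfl :=
  ⟨_, isAction_action (a.algebraAt x), a.hom_action_algebraAt x⟩

end Algebras

end RelativeAdjunction

/-! ### Equivalences -/

theorem tightIso_iff {A E : X} {f g : A ⟶ E} : TightIso f g ↔
    ∃ (α : Gen (Chain.nil A) f g) (β : Gen (Chain.nil A) g f),
      hom α ≫ hom β = 𝟙 _ ∧ hom β ≫ hom α = 𝟙 _ := by
  constructor
  · rintro ⟨α, β, h₁, h₂⟩
    refine ⟨und α, und β, ?_, ?_⟩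
    · rw [← hom_und_mul, h₁, hom_und_ident]
    · rw [← hom_und_mul, h₂, hom_und_ident]
  · rintro ⟨α, β, h₁, h₂⟩
    obtain ⟨α, rfl⟩ := exists_und_eq α
    obtain ⟨β, rfl⟩ := exists_und_eq β
    refine ⟨α, β, ?_, ?_⟩
    · rw [← hom_und_inj, hom_und_ident, ← h₁]
      exact hom_und_mul α β
    · rw [← hom_und_inj, hom_und_ident, ← h₂]
      exact hom_und_mul β α

theorem tightIso_of_eq {A E : X} {f g : A ⟶ E} (h : f = g) : TightIso f g := by
  subst h
  exact tightIso_iff.2 ⟨oneCell f, oneCell f, Category.comp_id (𝟙 (Elt.mk f)),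
    Category.comp_id (𝟙 (Elt.mk f))⟩

theorem isTightEquivalence_of_isIso {A B : X} (c : A ⟶ B) [IsIso c] : IsTightEquivalence c :=
  ⟨inv c, tightIso_of_eq (by simp), tightIso_of_eq (by simp)⟩

/-- A tight-cell with a left inverse up to isomorphism is faithful: `χ` is recovered from `(c ;
d)(χ)` by conjugation. -/
theorem mapc_injective_of_tightIso {A B C E : X} {c : C ⟶ E} {d : E ⟶ C}
    (h : TightIso (c ≫ d) (𝟙 C)) {x : A ⟶ C} {y : B ⟶ C} {f : A ⟶ E} {g : B ⟶ E} (hf : x ≫ c = f)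
    (hg : y ≫ c = g) : Function.Injective (mapc c hf hg) := by
  obtain ⟨α, β, h₁, h₂⟩ := tightIso_iff.1 h
  intro χ χ' e
  have hβ : ∀ {A : X} (x : A ⟶ C), wh x β (Category.comp_id x) rfl ≫
      wh x α rfl (Category.comp_id x) = 𝟙 _ := fun x => by
    rw [← wh_seq]
    rw [← hom_seq (e := rfl), ← hom_oneCell] at h₂
    rw [wh_of_hom_eq x h₂, wh_oneCell]
  have key : ∀ χ : Elt.mk x ⟶ Elt.mk y, χ = wh x β (Category.comp_id x) rfl ≫
      mapc (c ≫ d) rfl rfl χ ≫ wh y α rfl (Category.comp_id y) := fun χ => by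
    rw [mapc_comp_wh χ α rfl (Category.comp_id x) rfl (Category.comp_id y), ← Elt.assoc, hβ,
      Category.id_comp, mapc_id]
  have e' : mapc (c ≫ d) rfl rfl χ = mapc (c ≫ d) rfl rfl χ' := by
    have hf' : f ≫ d = x ≫ c ≫ d := by rw [← hf]; simp
    have hg' : g ≫ d = y ≫ c ≫ d := by rw [← hg]; simp
    rw [← mapc_mapc c d rfl hf hg hf' hg', e, mapc_mapc c d rfl]
  rw [key χ, e', ← key χ']

theorem IsTightEquivalence.existsUnique_mapc {A B C E : X} {c : C ⟶ E} (h : IsTightEquivalence c)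
    {x : A ⟶ C} {y : B ⟶ C} {f : A ⟶ E} {g : B ⟶ E} (hf : x ≫ c = f)
    (hg : y ≫ c = g) (ψ : Elt.mk f ⟶ Elt.mk g) : ∃! χ, mapc c hf hg χ = ψ := by
  obtain ⟨d, h, h'⟩ := h
  refine existsUnique_of_exists_of_unique ?_ fun χ χ' e e' =>
    mapc_injective_of_tightIso h hf hg (e.trans e'.symm)
  obtain ⟨α, β, h₁, h₂⟩ := tightIso_iff.1 h
  have hα : ∀ {A : X} (x : A ⟶ C), wh x α rfl (Category.comp_id x) ≫
      wh x β (Category.comp_id x) rfl = 𝟙 _ := fun x => by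
    rw [← wh_seq]
    rw [← hom_seq (e := rfl), ← hom_oneCell] at h₁
    rw [wh_of_hom_eq x h₁, wh_oneCell]
  have hf' : f ≫ d = x ≫ c ≫ d := by rw [← hf]; simp
  have hg' : g ≫ d = y ≫ c ≫ d := by rw [← hg]; simp
  -- The preimage is `d(ψ)` conjugated by `(c ; d) ≅ 1`. To check that `c` sends it to `ψ`, it is
  -- enough to compare after applying `d`, which is faithful because `(d ; c) ≅ 1`.
  refine ⟨wh x β (Category.comp_id x) rfl ≫ mapc d hf' hg' ψ ≫ wh y α rfl (Category.comp_id y),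
    ?_⟩
  apply mapc_injective_of_tightIso h' hf' hg'
  rw [mapc_mapc c d rfl _ _ _ _ rfl rfl]
  have : ∀ χ : Elt.mk x ⟶ Elt.mk y, mapc (c ≫ d) rfl rfl χ =
      wh x α rfl (Category.comp_id x) ≫ χ ≫ wh y β (Category.comp_id y) rfl := fun χ => by
    have e := mapc_comp_wh χ α rfl (Category.comp_id x) rfl (Category.comp_id y)
    rw [mapc_id] at e
    rw [← Elt.assoc, ← e, Elt.assoc, hα, Category.comp_id]
  rw [this, Elt.assoc, Elt.assoc, hα, Category.comp_id, ← Elt.assoc, hα, Category.id_comp]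

/-! ### Monadicity in terms of actions -/

namespace RelativeAdjunction

variable {C E : X} {l : E ⟶ C} {r : C ⟶ E} (a : Adjunction l r)

/-- Every morphism between the algebras on `x ; r` and `y ; r` is the image of a unique 2-cell
from `x` to `y`. -/
def FullyFaithful : Prop :=
  ∀ {A B : X} {x : A ⟶ C} {y : B ⟶ C} {f ft : A ⟶ E} {g gt : B ⟶ E} (hx : x ≫ r = f)
    (hy : y ≫ r = g) (hf : f ≫ l ≫ r = ft) (hg : g ≫ l ≫ r = gt) (ψ : Elt.mk f ⟶ Elt.mk g),
    mapc (l ≫ r) hf hg ψ ≫ a.freeAct y hy hg = a.freeAct x hx hf ≫ ψ →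
    ∃! χ : Elt.mk x ⟶ Elt.mk y, mapc r hx hy χ = ψ

/-- Every algebra is of the form `x ; r` for a unique `x`. -/
def StrictlyBijective : Prop :=
  ∀ {D : X} {e : D ⟶ E} {k : Gen (Chain.nil D) (e ≫ l ≫ r) e}, a.IsAction e k →
    ∃! x : D ⟶ C, ∃ h : x ≫ r = e, a.freeAct x h rfl = hom k

/-- Every algebra is isomorphic to one of the form `x ; r`. -/
def EssentiallySurjective : Prop :=
  ∀ {D : X} {e : D ⟶ E} {k : Gen (Chain.nil D) (e ≫ l ≫ r) e}, a.IsAction e k →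
    ∃ (x : D ⟶ C) (α : Gen (Chain.nil D) (x ≫ r) e) (β : Gen (Chain.nil D) e (x ≫ r)),
      hom α ≫ hom β = 𝟙 _ ∧ hom β ≫ hom α = 𝟙 _ ∧
      mapc (l ≫ r) rfl rfl (hom α) ≫ hom k = a.freeAct x rfl rfl ≫ hom α

variable {a}

/-- The 2-dimensional universal property with the chain as part of the morphism. As `mapc` leaves
the chain unchanged, uniqueness extends to candidates with an a priori different chain. -/
theorem existsUnique_hom {O D D' : X} {U : a.monad.Algebra O} (hU : U.IsAlgebraObject)
    {M : a.monad.Algebra D} {N : a.monad.Algebra D'} {x : D ⟶ O} {y : D' ⟶ O}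
    (hx : M.IsPullback U x) (hy : N.IsPullback U y) (ψ : Elt.mk M.e ⟶ Elt.mk N.e)
    (hψ : mapc (l ≫ r) rfl rfl ψ ≫ hom (action N) = hom (action M) ≫ ψ) :
    ∃! χ : Elt.mk x ⟶ Elt.mk y, mapc U.e hx.1 hy.1 χ = ψ := by
  obtain ⟨P, ψ⟩ := ψ
  obtain ⟨ψ, rfl⟩ := exists_und_eq ψ
  obtain ⟨χ, hχ, hχ'⟩ := hU.existsUnique_cell M N x y hx hy P ψ ((isGradedMorphism_iff M N ψ).2 hψ)
  refine ⟨hom (und χ), ?_, ?_⟩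
  · dsimp only
    rw [← hom_und_act, hχ]; rfl
  · rintro ⟨Q, χ'⟩ h
    obtain rfl : Q = P := congrArg Sigma.fst h
    obtain ⟨χ', rfl⟩ := exists_und_eq χ'
    rw [← hχ' χ']
    · rfl
    · exact hom_und_inj.1 ((hom_und_act _ _ _ _).trans h)

variable {C E : X} {l : E ⟶ C} {r : C ⟶ E} {a : Adjunction l r}

theorem comparison_isPullback {O : X} {U : a.monad.Algebra O} (hU : U.IsAlgebraObject) :
    a.algebra.IsPullback U (a.comparison hU) :=
  (hU.existsUnique_tight a.algebra).choose_spec.1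

/-! ### Properties of `r` read off from its comparison tight-cell. -/

section Comparison

variable {O : X} {U : a.monad.Algebra O} {c : C ⟶ O}

theorem wh_action_of_isPullback (hc : a.algebra.IsPullback U c) {D : X} (x : D ⟶ C) {f ft : D ⟶ E}
    (hx : x ≫ r = f) (hf : f ≫ l ≫ r = ft) (h₁ : (x ≫ c) ≫ U.e = f)
    (h₂ : (x ≫ c) ≫ U.e ≫ l ≫ r = ft) :
    wh (x ≫ c) (action U) h₂ h₁ = a.freeAct x hx hf := by
  obtain ⟨h, hk⟩ := (isPullback_iff _ _ _).1 hc
  rw [← a.wh_action_algebra x hx hf (by rw [← hf, ← hx]; simp), ← hom_inj.1 hk]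
  exact (wh_whisker x c rfl (action U) _ _ _ _ _ _).symm

theorem algebraAt_isPullback (hc : a.algebra.IsPullback U c) {D : X} (x : D ⟶ C) :
    (a.algebraAt x).IsPullback U (x ≫ c) := by
  have h : (x ≫ c) ≫ U.e = x ≫ r := (Category.assoc x c U.e).trans (congrArg (x ≫ ·) hc.1)
  refine (isPullback_iff _ _ _).2 ⟨h, ?_⟩
  rw [hom_action_algebraAt]
  exact wh_action_of_isPullback hc x rfl rfl h _

/-- Since `r = (c ; u)`, an algebra morphism lifts first along `u`, by the universal property, and
then along the equivalence `c`. -/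
theorem fullyFaithful_of_comparison (hU : U.IsAlgebraObject) (hc : a.algebra.IsPullback U c)
    (hc' : IsTightEquivalence c) : a.FullyFaithful := by
  rintro A B x y f ft g gt rfl rfl rfl rfl ψ hψ
  obtain ⟨χ, hχ, hχ'⟩ := existsUnique_hom hU (algebraAt_isPullback hc x)
    (algebraAt_isPullback hc y) ψ (by rw [hom_action_algebraAt, hom_action_algebraAt]; exact hψ)
  obtain ⟨ξ, hξ, hξ'⟩ := hc'.existsUnique_mapc (x := x) (y := y) rfl rfl χ
  have key : ∀ ξ : Elt.mk x ⟶ Elt.mk y, mapc r rfl rfl ξ = mapc U.e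
      (algebraAt_isPullback hc x).1 (algebraAt_isPullback hc y).1 (mapc c rfl rfl ξ) :=
    fun ξ => (mapc_mapc c U.e hc.1 _ _ _ _ _ _ ξ).symm
  refine ⟨ξ, ?_, fun ξ₁ h₁ => hξ' ξ₁ (hχ' _ ((key ξ₁).symm.trans h₁))⟩
  exact (key ξ).trans ((congrArg _ hξ).trans hχ)

theorem strictlyBijective_of_comparison (hU : U.IsAlgebraObject) (hc : a.algebra.IsPullback U c)
    (hc' : IsIso c) : a.StrictlyBijective := by
  intro D e k hk
  obtain ⟨φ, h₁, h₂, rfl⟩ := hk.exists_algebra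
  obtain ⟨y, hy, hy'⟩ := hU.existsUnique_tight (⟨e, φ, h₁, h₂⟩ : a.monad.Algebra D)
  obtain ⟨h, hh⟩ := (isPullback_iff _ _ _).1 hy
  have hr : c ≫ U.e = r := hc.1
  have e1 : (y ≫ inv c) ≫ r = e := by
    rw [← hr, Category.assoc, IsIso.inv_hom_id_assoc]
    exact h
  refine ⟨y ≫ inv c, ⟨e1, ?_⟩, ?_⟩
  · rw [← hh, ← wh_action_of_isPullback hc (y ≫ inv c) e1 rfl (by rw [Category.assoc, hr, e1])
      (by rw [← Category.assoc, Category.assoc _ c, hr, e1])]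
    exact wh_congr (by simp) _ _ _ _ _
  · rintro x ⟨hx, hx'⟩
    rw [← hy' (x ≫ c)]
    · simp
    · refine (isPullback_iff _ _ _).2 ⟨by simpa [hr] using hx, ?_⟩
      rw [← hx']
      exact wh_action_of_isPullback hc x hx rfl _ _

/-- If `y` classifies the algebra and `d` is a pseudo-inverse of `c`, then `y ; d` works: `(y ; d ;
c) ≅ y` is sent by `u` to an isomorphism of carriers. It respects actions by interchange with the
universal action. -/
theorem essentiallySurjective_of_comparison (hU : U.IsAlgebraObject)
    (hc : a.algebra.IsPullback U c) (hc' : IsTightEquivalence c) : a.EssentiallySurjective := by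
  intro D e k hk
  obtain ⟨φ, h₁, h₂, rfl⟩ := hk.exists_algebra
  obtain ⟨y, hy, -⟩ := hU.existsUnique_tight (⟨e, φ, h₁, h₂⟩ : a.monad.Algebra D)
  obtain ⟨h, hh⟩ := (isPullback_iff _ _ _).1 hy
  have hr : c ≫ U.e = r := hc.1
  have h' : y ≫ U.e = e := h
  obtain ⟨d, -, hd⟩ := hc'
  obtain ⟨α, β, h₁', h₂'⟩ := tightIso_iff.1 hd
  have e1 : (y ≫ d ≫ c) ≫ U.e = (y ≫ d) ≫ r := by simp [hr]
  have e2 : (y ≫ d) ≫ c = y ≫ d ≫ c := by simp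
  let γ : Gen (Chain.nil D) (y ≫ d ≫ c) y := whisker y α rfl (Category.comp_id y)
  let δ : Gen (Chain.nil D) y (y ≫ d ≫ c) := whisker y β (Category.comp_id y) rfl
  have hγδ : hom γ ≫ hom δ = 𝟙 _ := by
    rw [← hom_seq (e := rfl), ← hom_oneCell] at h₁'
    have := wh_of_hom_eq y h₁' rfl rfl
    rwa [wh_seq y α β rfl (Category.comp_id y), wh_oneCell] at this
  have hδγ : hom δ ≫ hom γ = 𝟙 _ := by
    rw [← hom_seq (e := rfl), ← hom_oneCell] at h₂'
    have := wh_of_hom_eq y h₂' (Category.comp_id y) (Category.comp_id y)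
    rwa [wh_seq y β α (Category.comp_id y) rfl, wh_oneCell] at this
  refine ⟨y ≫ d, comp₁ γ (mapCell U.e) e1 h, comp₁ δ (mapCell U.e) h e1, ?_, ?_, ?_⟩
  · rw [hom_comp₁_mapCell, hom_comp₁_mapCell, ← mapc_comp, hγδ, mapc_one]
  · rw [hom_comp₁_mapCell, hom_comp₁_mapCell, ← mapc_comp, hδγ, mapc_one]
  · rw [← hh, hom_comp₁_mapCell, ← wh_action_of_isPullback hc (y ≫ d) rfl rfl
      (by rw [e2, e1]) (by rw [e2, ← Category.assoc, e1]), wh_congr e2 _ _ _ (by rw [← Category.assoc, e1]) e1,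
      mapc_mapc U.e (l ≫ r) rfl _ _ _ _ (by rw [← Category.assoc, e1]) (by rw [← Category.assoc, h'])]
    exact mapc_comp_wh (hom γ) (action U) _ _ _ _

end Comparison

theorem exists_of_strictlyMonadic (h : StrictlyMonadic r) :
    ∃ (l : E ⟶ C) (a : Adjunction l r), a.FullyFaithful ∧ a.StrictlyBijective := by
  obtain ⟨l, a, O, U, hU, h⟩ := h
  exact ⟨l, a, fullyFaithful_of_comparison hU (comparison_isPullback hU)
    (isTightEquivalence_of_isIso _), strictlyBijective_of_comparison hU (comparison_isPullback hU) h⟩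

theorem exists_of_nonstrictlyMonadic (h : NonstrictlyMonadic r) :
    ∃ (l : E ⟶ C) (a : Adjunction l r), a.FullyFaithful ∧ a.EssentiallySurjective := by
  obtain ⟨l, a, O, U, hU, h⟩ := h
  exact ⟨l, a, fullyFaithful_of_comparison hU (comparison_isPullback hU) h,
    essentiallySurjective_of_comparison hU (comparison_isPullback hU) h⟩

/-! Monadicity from the properties of the adjunction -/

theorem isPullback_algebra_iff {D : X} (M : a.monad.Algebra D) (x : D ⟶ C) :
    M.IsPullback a.algebra x ↔ ∃ h : x ≫ r = M.e, a.freeAct x h rfl = hom (action M) := by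
  rw [isPullback_iff]
  refine exists_congr fun h => ?_
  rw [← a.wh_action_algebra x h rfl (by rw [← h]; exact (Category.assoc x r (l ≫ r)).symm)]

theorem isAlgebraObject_algebra (hF : a.FullyFaithful) (hS : a.StrictlyBijective) :
    a.algebra.IsAlgebraObject where
  existsUnique_tight M := by
    obtain ⟨x, hx, hx'⟩ := hS (isAction_action M)
    exact ⟨x, (isPullback_algebra_iff M x).2 hx, fun y hy => hx' y ((isPullback_algebra_iff M y).1 hy)⟩
  existsUnique_cell M N x y hx hy P ψ hψ := by
    obtain ⟨h₁, h₂⟩ := (isPullback_algebra_iff M x).1 hx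
    obtain ⟨h₃, h₄⟩ := (isPullback_algebra_iff N y).1 hy
    obtain ⟨⟨Q, χ⟩, hχ, hχ'⟩ := hF h₁ h₃ rfl rfl (hom (und ψ)) (by
      rw [h₂, h₄]
      exact (isGradedMorphism_iff M N ψ).1 hψ)
    obtain rfl : Q = P := congrArg Sigma.fst hχ
    obtain ⟨χ, rfl⟩ := exists_und_eq χ
    refine ⟨χ, ?_, fun χ₁ e₁ => ?_⟩
    · exact hom_und_inj.1 ((hom_und_act _ _ _ _).trans hχ)
    · refine hom_und_inj.1 (hχ' (hom (und χ₁)) ?_)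
      rw [← e₁]
      exact (hom_und_act r _ _ χ₁).symm

theorem strictlyMonadic (hF : a.FullyFaithful) (hS : a.StrictlyBijective) : StrictlyMonadic r := by
  refine ⟨l, a, C, a.algebra, isAlgebraObject_algebra hF hS, ?_⟩
  -- With `C` itself as algebra object, the identity also classifies the algebra `r`, so by
  -- uniqueness it is the comparison.
  have : a.comparison (isAlgebraObject_algebra hF hS) = 𝟙 C := by
    refine ((isAlgebraObject_algebra hF hS).existsUnique_tight a.algebra).unique
      (comparison_isPullback _) ((isPullback_algebra_iff _ _).2 ⟨Category.id_comp r, ?_⟩)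
    exact (a.wh_action_algebra (𝟙 C) (Category.id_comp r) rfl (Category.id_comp _)).symm.trans
      (id_wh _ _ _)
  rw [this]
  infer_instance

/-- A lift of a 2-cell with empty source again has empty source. -/
theorem exists_hom_of_mapc_eq {A C E : X} {u : C ⟶ E} {x y : A ⟶ C} {f g : A ⟶ E} {hx : x ≫ u = f}
    {hy : y ≫ u = g} {θ : Gen (Chain.nil A) f g} {χ : Elt.mk x ⟶ Elt.mk y}
    (h : mapc u hx hy χ = hom θ) : ∃ χ' : Gen (Chain.nil A) x y, χ = hom χ' := by
  obtain ⟨Q, χ⟩ := χ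
  obtain rfl : Q = Chain.nil A := congrArg Sigma.fst h
  exact ⟨χ, rfl⟩

/-- The pseudo-inverse of the comparison `c` comes from essential surjectivity applied to the
universal algebra itself, which gives `x` with `(x ; r) ≅ u` as algebras. Lifting this isomorphism
along `u` gives `(x ; c) ≅ 1`. Whiskering it with `c` and lifting along `r` gives `(c ; x) ≅ 1`. -/
theorem nonstrictlyMonadic (hF : a.FullyFaithful) (hS : a.EssentiallySurjective)
    (hT : a.monad.AdmitsAlgebraObject) : NonstrictlyMonadic r := by
  obtain ⟨O, U, hU⟩ := hT
  refine ⟨l, a, O, U, hU, ?_⟩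
  have hc := comparison_isPullback hU
  set c := a.comparison hU
  have hr : c ≫ U.e = r := hc.1
  obtain ⟨x, α, β, h₁, h₂, h₃⟩ := hS (isAction_action U)
  have h₄ : mapc (l ≫ r) rfl rfl (hom β) ≫ a.freeAct x rfl rfl = hom (action U) ≫ hom β :=
    mapc_comp_of_inverse rfl rfl h₁ h₂ h₃
  refine ⟨x, ?_, ?_⟩
  · obtain ⟨k, -, hk⟩ := a.isAction_freeAct x
    have e₁ : c ≫ x ≫ r = (c ≫ x) ≫ r := (Category.assoc _ _ _).symm
    have e₂ : c ≫ U.e ≫ l ≫ r = r ≫ l ≫ r := by rw [← Category.assoc, hr]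
    have e₃ : c ≫ (x ≫ r) ≫ l ≫ r = ((c ≫ x) ≫ r) ≫ l ≫ r := by simp
    -- Restricting the universal action along `c` returns the canonical action on `r`, so `α` and
    -- `β` whiskered by `c` are morphisms between actions of the form `freeAct`, to which `hF`
    -- applies.
    have hU₁ : wh c (action U) e₂ hr = a.freeAct (𝟙 C) (Category.id_comp r) rfl := by
      rw [← wh_action_of_isPullback hc (𝟙 C) (Category.id_comp r) rfl
        (by rw [Category.id_comp, hr]) (by rw [Category.id_comp, e₂])]
      exact wh_congr (Category.id_comp c).symm _ _ _ _ _
    have key₁ : mapc (l ≫ r) rfl rfl (wh c α e₁ hr) ≫ a.freeAct (𝟙 C) (Category.id_comp r) rfl =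
        a.freeAct (c ≫ x) rfl rfl ≫ wh c α e₁ hr := by
      rw [← hk, ← hom_comp₁_mapCell, ← hom_seq (e := rfl), ← hom_seq (e := rfl)] at h₃
      have := wh_of_hom_eq c h₃ e₃ hr
      rwa [wh_seq c _ _ e₃ e₂ hr, wh_seq c _ _ e₃ e₁ hr, hU₁,
        a.wh_freeAct c x rfl rfl rfl hk e₃ e₁ rfl rfl,
        wh_comp₁_mapCell c (l ≫ r) α e₁ hr _ _ _ _ rfl rfl] at this
    have key₂ : mapc (l ≫ r) rfl rfl (wh c β hr e₁) ≫ a.freeAct (c ≫ x) rfl rfl =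
        a.freeAct (𝟙 C) (Category.id_comp r) rfl ≫ wh c β hr e₁ := by
      rw [← hk, ← hom_comp₁_mapCell, ← hom_seq (e := rfl), ← hom_seq (e := rfl)] at h₄
      have := wh_of_hom_eq c h₄ e₂ e₁
      rwa [wh_seq c _ _ e₂ e₃ e₁, wh_seq c _ _ e₂ hr e₁, hU₁,
        a.wh_freeAct c x rfl rfl rfl hk e₃ e₁ rfl rfl,
        wh_comp₁_mapCell c (l ≫ r) β hr e₁ _ _ _ _ rfl rfl] at this
    obtain ⟨χ, hχ, -⟩ := hF rfl (Category.id_comp r) rfl rfl _ key₁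
    obtain ⟨χ', hχ', -⟩ := hF (Category.id_comp r) rfl rfl rfl _ key₂
    obtain ⟨χ, rfl⟩ := exists_hom_of_mapc_eq hχ
    obtain ⟨χ', rfl⟩ := exists_hom_of_mapc_eq hχ'
    refine tightIso_iff.2 ⟨χ, χ', ?_, ?_⟩
    · refine (hF rfl rfl rfl rfl (𝟙 _) ?_).unique ?_ (mapc_one _ _)
      · rw [mapc_one, Category.id_comp, Category.comp_id]
      · rw [← hom_seq (e := rfl), ← hom_oneCell] at h₁
        have := wh_of_hom_eq c h₁ e₁ e₁
        rw [wh_seq c _ _ e₁ hr e₁, wh_oneCell] at this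
        rw [mapc_comp _ _ (Category.id_comp r), hχ, hχ', this]
    · refine (hF (Category.id_comp r) (Category.id_comp r) rfl rfl (𝟙 _) ?_).unique ?_ (mapc_one _ _)
      · rw [mapc_one, Category.id_comp, Category.comp_id]
      · rw [← hom_seq (e := rfl), ← hom_oneCell] at h₂
        have := wh_of_hom_eq c h₂ hr hr
        rw [wh_seq c _ _ hr e₁ hr, wh_oneCell] at this
        rw [mapc_comp _ _ rfl, hχ, hχ', this]
  · have hU₁ : U.IsPullback U (𝟙 O) := (isPullback_iff _ _ _).2 ⟨Category.id_comp _, id_wh _ _ _⟩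
    have hx := algebraAt_isPullback hc x
    obtain ⟨χ, hχ, -⟩ := existsUnique_hom hU hx hU₁ (hom α) (by rw [hom_action_algebraAt]; exact h₃)
    obtain ⟨χ', hχ', -⟩ := existsUnique_hom hU hU₁ hx (hom β)
      (by rw [hom_action_algebraAt]; exact h₄)
    obtain ⟨χ, rfl⟩ := exists_hom_of_mapc_eq hχ
    obtain ⟨χ', rfl⟩ := exists_hom_of_mapc_eq hχ'
    refine tightIso_iff.2 ⟨χ, χ', ?_, ?_⟩
    · refine (existsUnique_hom hU hx hx (𝟙 _) ?_).unique ?_ (mapc_one _ _)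
      · rw [mapc_one, Category.id_comp, Category.comp_id]
      · rw [mapc_comp _ _ hU₁.1, hχ, hχ']
        exact h₁
    · refine (existsUnique_hom hU hU₁ hU₁ (𝟙 _) ?_).unique ?_ (mapc_one _ _)
      · rw [mapc_one, Category.id_comp, Category.comp_id]
      · rw [mapc_comp _ _ hx.1, hχ, hχ']
        exact h₂

end RelativeAdjunction

/-! ### Cancellation -/

namespace RelativeAdjunction

theorem sharp_flat_hom {C E : X} {l : E ⟶ C} {r : C ⟶ E} (a : Adjunction l r) {A B : X}
    {y : A ⟶ E} {x : B ⟶ C} {yl : A ⟶ C} {xr : B ⟶ E} {xrl : B ⟶ C}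
    (hl : y ≫ l = yl) (hr : x ≫ r = xr) (hrl : xr ≫ l = xrl) (hx : x ≫ r ≫ l = xrl)
    (hx' : x ≫ 𝟙 C = x) {ylr : A ⟶ E} (hy : y ≫ 𝟙 E = y) (hy' : y ≫ l ≫ r = ylr)
    (hlr : yl ≫ r = ylr) (α : Elt.mk y ⟶ Elt.mk xr) :
    wh y a.eta hy hy' ≫ mapc r hlr hr (mapc l hl hrl α ≫ wh x a.eps hx hx') = α := by
  have h1 : xrl ≫ r = xr ≫ l ≫ r := by simp [← hrl]
  rw [mapc_comp r hlr h1 hr, mapc_mapc l r rfl _ _ _ _ hy' rfl, ← Elt.assoc,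
    ← mapc_comp_wh α a.eta hy hy' (Category.comp_id xr) rfl, Elt.assoc,
    triangle_right a x hr (Category.comp_id xr) rfl hx hx' h1, mapc_id, Category.comp_id]

/-! ### Transferring actions along `r'`. -/

section Cancellation

variable {C D E : X} {l : D ⟶ C} {r : C ⟶ D} (a : Adjunction l r) {r' : D ⟶ E} {m : E ⟶ C}
  (b : Adjunction m (r ≫ r'))

/-- The canonical 2-cell `(r' ; m) ⇒ ℓ`. -/
noncomputable def tau : Gen (Chain.nil D) (r' ≫ m) l :=
  seq (comp₁ (comp₁ a.eta (mapCell r') (Category.id_comp r') (Category.assoc l r r')) (mapCell m)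
      rfl (Category.assoc l (r ≫ r') m))
    (whisker l b.eps rfl (Category.comp_id l)) rfl

theorem wh_tau {A : X} (e : A ⟶ D) {el er'm : A ⟶ C} {er' elrr' : A ⟶ E} {elr : A ⟶ D}
    {elrr'm : A ⟶ C} (hl : e ≫ l = el) (h₁ : e ≫ r' ≫ m = er'm) (hr' : e ≫ r' = er')
    (hm : er' ≫ m = er'm) (hlr : e ≫ l ≫ r = elr) (hlrr' : elr ≫ r' = elrr')
    (hm' : elrr' ≫ m = elrr'm) (hel : el ≫ (r ≫ r') ≫ m = elrr'm) (he : e ≫ 𝟙 D = e)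
    (hel' : el ≫ 𝟙 C = el) :
    wh e (tau a b) h₁ hl =
      mapc m hm hm' (mapc r' hr' hlrr' (wh e a.eta he hlr)) ≫ wh el b.eps hel hel' := by
  have h₂ : e ≫ l ≫ (r ≫ r') ≫ m = elrr'm := by rw [← hel, ← hl]; simp
  have h₃ : e ≫ l ≫ r ≫ r' = elrr' := by rw [← hlrr', ← hlr]; simp
  rw [tau, wh_seq e _ _ h₁ h₂ hl, wh_whisker e l hl b.eps _ _ _ _ hel hel',
    wh_comp₁_mapCell e m _ hr' h₃ _ _ _ _ hm hm', wh_comp₁_mapCell e r' _ he hlr _ _ _ _ hr' hlrr']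

/-- By construction `tau` is the transpose of `r'(η)` under `m ⊣ (r ; r')`; transposing back yields
`r'(η)`. -/
theorem eta_tau {A : X} (e : A ⟶ D) {el er'm : A ⟶ C} {er' elrr' er'mrr' : A ⟶ E} {elr : A ⟶ D}
    (hl : e ≫ l = el) (h₁ : e ≫ r' ≫ m = er'm) (hr' : e ≫ r' = er')
    (hlr : e ≫ l ≫ r = elr) (hlrr' : elr ≫ r' = elrr') (he : e ≫ 𝟙 D = e)
    (her' : er' ≫ 𝟙 E = er') (h₂ : er' ≫ m ≫ r ≫ r' = er'mrr') (h₃ : er'm ≫ r ≫ r' = er'mrr')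
    (h₄ : el ≫ r ≫ r' = elrr') :
    wh er' b.eta her' h₂ ≫ mapc (r ≫ r') h₃ h₄ (wh e (tau a b) h₁ hl) =
      mapc r' hr' hlrr' (wh e a.eta he hlr) := by
  rw [wh_tau a b e hl h₁ hr' (by rw [← h₁, ← hr']; simp) hlr hlrr' rfl
    (by rw [← h₄]; simp) he (Category.comp_id el)]
  exact sharp_flat_hom b _ _ _ _ _ _ _ _ _

/-- `tau` is compatible with the two counits: naturality of the counit of `m ⊣ (r ; r')` brings
together the unit and counit of `ℓ ⊣ r`, which cancel by a triangle identity. -/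
theorem tau_eps {A : X} (x : A ⟶ C) {xr : A ⟶ D} {xrl xrr'm : A ⟶ C} (hr : x ≫ r = xr)
    (hl : xr ≫ l = xrl) (h₁ : xr ≫ r' ≫ m = xrr'm) (h₂ : x ≫ r ≫ l = xrl) (hx : x ≫ 𝟙 C = x)
    (h₃ : x ≫ (r ≫ r') ≫ m = xrr'm) :
    wh xr (tau a b) h₁ hl ≫ wh x a.eps h₂ hx = wh x b.eps h₃ hx := by
  have h₄ : xr ≫ l ≫ r = xrl ≫ r := by rw [← hl]; simp
  have h₅ : x ≫ r ≫ r' = xr ≫ r' := by rw [← hr]; simp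
  have h₆ : xrl ≫ r ≫ r' = (xrl ≫ r) ≫ r' := by simp
  have h₇ : xrl ≫ (r ≫ r') ≫ m = ((xrl ≫ r) ≫ r') ≫ m := by simp
  rw [wh_tau a b xr hl h₁ rfl (by rw [← h₁]; simp) h₄ rfl rfl h₇ (Category.comp_id xr)
    (Category.comp_id xrl), Elt.assoc]
  have e := mapc_comp_wh (wh x a.eps h₂ hx) b.eps h₇ (Category.comp_id xrl) h₃ hx
  rw [mapc_id] at e
  rw [← e, ← mapc_mapc (r ≫ r') m rfl h₆ h₅ rfl (by rw [← h₁]; simp),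
    ← mapc_mapc r r' rfl rfl hr rfl rfl, ← Elt.assoc, ← mapc_comp, ← mapc_comp,
    triangle_right a x hr, mapc_one, mapc_one, Category.id_comp]

/-- The action of the monad of `m ⊣ (r ; r')` on `(e ; r')` induced by an action of the monad of
`ℓ ⊣ r` on `e`. -/
noncomputable def pushAct {A : X} {e : A ⟶ D} (k : Elt.mk (e ≫ l ≫ r) ⟶ Elt.mk e) :
    Elt.mk ((e ≫ r') ≫ m ≫ r ≫ r') ⟶ Elt.mk (e ≫ r') :=
  mapc (r ≫ r') (Category.assoc _ _ _) (by simp)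
    (wh e (tau a b) (Category.assoc e r' m).symm rfl : _ ⟶ Elt.mk (e ≫ l)) ≫
    mapc r' (rfl : (e ≫ l ≫ r) ≫ r' = _) rfl k

variable {A B : X}

theorem unit_pushAct {e : A ⟶ D} {k : Elt.mk (e ≫ l ≫ r) ⟶ Elt.mk e}
    (hk : wh e a.eta (Category.comp_id e) rfl ≫ k = 𝟙 _) :
    wh (e ≫ r') b.eta (Category.comp_id _) rfl ≫ pushAct a b k = 𝟙 _ := by
  rw [pushAct, ← Elt.assoc, eta_tau a b e rfl _ rfl rfl rfl (Category.comp_id e), ← mapc_comp, hk,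
    mapc_one]

theorem pushAct_freeAct (x : A ⟶ C) {f : A ⟶ D} (hx : x ≫ r = f) (h : x ≫ r ≫ r' = f ≫ r') :
    pushAct a b (a.freeAct x hx rfl) = b.freeAct x h rfl := by
  have h₁ : x ≫ r ≫ l = f ≫ l := by rw [← hx]; simp
  have h₂ : (f ≫ l) ≫ r ≫ r' = (f ≫ l ≫ r) ≫ r' := by simp
  have h₃ : x ≫ (r ≫ r') ≫ m = (f ≫ r') ≫ m := by rw [← hx]; simp
  rw [pushAct, a.freeAct_eq x hx rfl h₁ (Category.assoc _ _ _),
    mapc_mapc r r' rfl _ _ _ _ h₂ h, ← mapc_comp,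
    tau_eps a b x hx rfl _ h₁ (Category.comp_id x) h₃, b.freeAct_eq x h rfl h₃]

theorem pushAct_naturality {e : A ⟶ D} {e₁ : B ⟶ D} {k : Elt.mk (e ≫ l ≫ r) ⟶ Elt.mk e}
    {k₁ : Elt.mk (e₁ ≫ l ≫ r) ⟶ Elt.mk e₁} {ψ : Elt.mk e ⟶ Elt.mk e₁}
    (hψ : mapc (l ≫ r) rfl rfl ψ ≫ k₁ = k ≫ ψ) :
    mapc (m ≫ r ≫ r') rfl rfl (mapc r' rfl rfl ψ) ≫ pushAct a b k₁ =
      pushAct a b k ≫ mapc r' rfl rfl ψ := by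
  have h₁ : ∀ {Y : X} (e : Y ⟶ D), (e ≫ l) ≫ r ≫ r' = (e ≫ l ≫ r) ≫ r' := fun e => by simp
  have h₂ : mapc r' rfl rfl (mapc (l ≫ r) rfl rfl ψ) =
      mapc (r ≫ r') (h₁ e) (h₁ e₁) (mapc l rfl rfl ψ) := by
    rw [mapc_mapc (l ≫ r) r' (Category.assoc l r r') _ _ _ _ (by simp) (by simp),
      mapc_mapc l (r ≫ r') rfl]
  have h₃ : mapc (m ≫ r ≫ r') rfl rfl (mapc r' rfl rfl ψ) =
      mapc (r ≫ r') (Category.assoc _ _ _) (Category.assoc _ _ _)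
        (mapc (r' ≫ m) (Category.assoc e r' m).symm (Category.assoc e₁ r' m).symm ψ) := by
    rw [mapc_mapc r' (m ≫ r ≫ r') rfl _ _ _ _ (by simp) (by simp),
      mapc_mapc (r' ≫ m) (r ≫ r') (Category.assoc _ _ _)]
  rw [pushAct, pushAct, Elt.assoc, ← mapc_comp, ← hψ, mapc_comp r' rfl rfl rfl, h₂, h₃,
    ← Elt.assoc, ← Elt.assoc, ← mapc_comp, ← mapc_comp,
    mapc_comp_wh ψ (tau a b) _ rfl _ rfl]

end Cancellation

/-! ### Comparison of the monads on `E`, and cancellation of the three properties. -/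

section Cancellation

variable {C D E : X} {l : D ⟶ C} {r : C ⟶ D} (a : Adjunction l r) {r' : D ⟶ E} {m : E ⟶ C}
  (b : Adjunction m (r ≫ r')) {l' : E ⟶ D} (a' : Adjunction l' r') {A B : X}

variable {a} in
theorem IsAction.mapc_comp_self {e : A ⟶ D} {k : Gen (Chain.nil A) (e ≫ l ≫ r) e}
    (hk : a.IsAction e k) : mapc (l ≫ r) rfl rfl (hom k) ≫ hom k =
      a.freeAct (e ≫ l) (Category.assoc e l r) rfl ≫ hom k := hk.assoc

/-- Associativity says that `k` is a morphism from the free algebra on `e` to `(e, k)`. Pushing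
forward keeps it a morphism, and the pushed free action is again canonical. -/
theorem pushAct_action {e : A ⟶ D} {k : Gen (Chain.nil A) (e ≫ l ≫ r) e} (hk : a.IsAction e k) :
    mapc (m ≫ r ≫ r') rfl rfl (mapc r' rfl rfl (hom k)) ≫ pushAct a b (hom k) =
      b.freeAct (e ≫ l) (by simp) rfl ≫ mapc r' rfl rfl (hom k) := by
  rw [pushAct_naturality a b hk.mapc_comp_self, pushAct_freeAct]

theorem isAction_pushAct {e : A ⟶ D} {k : Gen (Chain.nil A) (e ≫ l ≫ r) e} (hk : a.IsAction e k) :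
    ∃ κ, b.IsAction (e ≫ r') κ ∧ hom κ = pushAct a b (hom k) := by
  have h₁ : (e ≫ l) ≫ r ≫ r' = (e ≫ l ≫ r) ≫ r' := by simp
  let κ : Gen (Chain.nil A) ((e ≫ r') ≫ m ≫ r ≫ r') (e ≫ r') :=
    seq (comp₁ (whisker e (tau a b) (Category.assoc e r' m).symm rfl) (mapCell (r ≫ r'))
      (Category.assoc _ _ _) h₁) (comp₁ k (mapCell r') rfl rfl) rfl
  have hκ : hom κ = pushAct a b (hom k) := hom_seq _ _ _
  refine ⟨κ, ⟨?_, ?_⟩, hκ⟩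
  · rw [hκ]
    exact unit_pushAct a b hk.unit
  · change _ = b.freeAct ((e ≫ r') ≫ m) (Category.assoc _ _ _) rfl ≫ hom κ
    rw [hκ]
    -- Each unfolded copy is `(r ; r')(tau)` followed by `r'(k)`. The first factor passes the action
    -- by naturality of the counit, the second by `pushAct_action`.
    nth_rw 1 3 [pushAct]
    rw [mapc_comp (m ≫ r ≫ r') rfl rfl rfl, Elt.assoc, pushAct_action a b hk, ← Elt.assoc,
      freeAct_naturality, Elt.assoc]

/-- The 2-cell `(ℓ' ; r') ⇒ (m ; r ; r')` comparing the two induced monads on `E`. -/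
noncomputable def omega : Gen (Chain.nil E) (l' ≫ r') (m ≫ r ≫ r') :=
  comp₁ (seq (comp₁ b.eta (mapCell l') (Category.id_comp l') rfl)
    (whisker (m ≫ r) a'.eps (by simp) (Category.comp_id (m ≫ r))) rfl) (mapCell r') rfl
    (Category.assoc m r r')

/-- Under `r'`, naturality of the counit of `ℓ' ⊣ r'` moves `κ` to the left of it. There the unit
law collapses `η ; r'(κ)` to the identity, and only the counit at `e` remains. -/
theorem wh_omega_comp {e : A ⟶ D} {κ : Elt.mk ((e ≫ r') ≫ m ≫ r) ⟶ Elt.mk e}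
    (h : ((e ≫ r') ≫ m ≫ r) ≫ r' = (e ≫ r') ≫ m ≫ r ≫ r')
    (hκ : wh (e ≫ r') b.eta (Category.comp_id _) rfl ≫ mapc r' h rfl κ = 𝟙 _) :
    wh (e ≫ r') (omega b a') rfl rfl ≫ mapc r' h rfl κ = a'.freeAct e rfl rfl := by
  have h₁ : (e ≫ r') ≫ (m ≫ r ≫ r') ≫ l' = ((e ≫ r') ≫ m ≫ r ≫ r') ≫ l' := by simp
  have h₂ : ((e ≫ r') ≫ m ≫ r) ≫ r' ≫ l' = ((e ≫ r') ≫ m ≫ r ≫ r') ≫ l' := by simp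
  have e₁ := mapc_comp_wh κ a'.eps h₂ (Category.comp_id _) (Category.assoc e r' l').symm
    (Category.comp_id e)
  rw [mapc_id] at e₁
  rw [omega, wh_comp₁_mapCell (e ≫ r') r' _ rfl rfl _ _ _ _ (Category.assoc _ _ _) h,
    wh_seq (e ≫ r') _ _ rfl h₁ rfl, wh_whisker (e ≫ r') (m ≫ r) rfl a'.eps _ _ _ _ h₂
    (Category.comp_id _), wh_comp₁_mapCell (e ≫ r') l' b.eta (Category.comp_id _) rfl _ _ _ _ rfl rfl,
    ← mapc_comp, Elt.assoc, ← e₁, ← mapc_mapc r' l' rfl h rfl rfl rfl, ← Elt.assoc, ← mapc_comp, hκ,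
    mapc_one, Category.id_comp, a'.freeAct_eq e rfl rfl]

/-- The pushed action is `r'` applied to some 2-cell, so its restriction along `omega` depends only
on the carrier `e`. Only the unit law for `k` is needed. -/
theorem wh_omega_pushAct {e : A ⟶ D} {k : Elt.mk (e ≫ l ≫ r) ⟶ Elt.mk e}
    (hk : wh e a.eta (Category.comp_id e) rfl ≫ k = 𝟙 _) :
    wh (e ≫ r') (omega b a') rfl rfl ≫ pushAct a b k = a'.freeAct e rfl rfl := by
  have h₁ : ((e ≫ r') ≫ m) ≫ r = (e ≫ r') ≫ m ≫ r := by simp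
  have h₂ : ((e ≫ r') ≫ m ≫ r) ≫ r' = (e ≫ r') ≫ m ≫ r ≫ r' := by simp
  have h₃ : pushAct a b k = mapc r' h₂ rfl (mapc r h₁ (Category.assoc e l r)
      (wh e (tau a b) (Category.assoc e r' m).symm rfl) ≫ k) := by
    rw [mapc_comp r' h₂ rfl rfl, mapc_mapc r r' rfl, pushAct]
  have h₄ := unit_pushAct a b hk
  rw [h₃] at h₄ ⊢
  exact wh_omega_comp b a' h₂ h₄

variable {a b a'}

/-- If `r'` is fully faithful, every morphism of induced algebras comes from a unique 2-cell. -/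
theorem existsUnique_of_pushAct (hF : a'.FullyFaithful) {e : A ⟶ D} {e₁ : B ⟶ D}
    {k : Elt.mk (e ≫ l ≫ r) ⟶ Elt.mk e} {k₁ : Elt.mk (e₁ ≫ l ≫ r) ⟶ Elt.mk e₁}
    (hk : wh e a.eta (Category.comp_id e) rfl ≫ k = 𝟙 _)
    (hk₁ : wh e₁ a.eta (Category.comp_id e₁) rfl ≫ k₁ = 𝟙 _)
    (φ : Elt.mk (e ≫ r') ⟶ Elt.mk (e₁ ≫ r'))
    (hφ : mapc (m ≫ r ≫ r') rfl rfl φ ≫ pushAct a b k₁ = pushAct a b k ≫ φ) :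
    ∃! ψ : Elt.mk e ⟶ Elt.mk e₁, mapc r' rfl rfl ψ = φ := by
  refine hF rfl rfl rfl rfl φ ?_
  rw [← wh_omega_pushAct a b a' hk, ← wh_omega_pushAct a b a' hk₁, ← Elt.assoc,
    mapc_comp_wh φ (omega b a') rfl rfl rfl rfl, Elt.assoc, hφ, Elt.assoc]

/-- Uniqueness of lifts applies to all 2-cells, since anything of the form `r'(χ)` is an algebra
morphism. -/
theorem FullyFaithful.mapc_injective (hF : a'.FullyFaithful) {e : A ⟶ D} {e₁ : B ⟶ D} {f : A ⟶ E}
    {g : B ⟶ E} (hf : e ≫ r' = f) (hg : e₁ ≫ r' = g) : Function.Injective (mapc r' hf hg) :=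
  fun χ _ h => (hF hf hg rfl rfl _ (a'.freeAct_naturality hf rfl hg rfl χ)).unique rfl h.symm

theorem wh_eta_freeAct (x : A ⟶ C) {f : A ⟶ D} (hx : x ≫ r = f) :
    wh f a.eta (Category.comp_id f) rfl ≫ a.freeAct x hx rfl = 𝟙 _ := by
  subst hx
  obtain ⟨k, hk, hk'⟩ := a.isAction_freeAct x
  rw [← hk']
  exact hk.unit

theorem wh_omega_freeAct (a : Adjunction l r) (x : A ⟶ C) {g : A ⟶ E}
    (h : x ≫ r ≫ r' = g) (h' : (x ≫ r) ≫ r' = g) :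
    wh g (omega b a') rfl rfl ≫ b.freeAct x h rfl = a'.freeAct (x ≫ r) h' rfl := by
  subst h'
  rw [← wh_omega_pushAct a b a' (wh_eta_freeAct x rfl), pushAct_freeAct a b x rfl h]

/-- For an algebra morphism `ψ`, the pushed morphism `r'(ψ)` is `(r ; r')(χ)` for a unique `χ`, and
faithfulness of `r'` gives `ψ = r(χ)`. -/
theorem FullyFaithful.cancel (hF' : a'.FullyFaithful) (hF : b.FullyFaithful) :
    a.FullyFaithful := by
  rintro A B x y f ft g gt rfl rfl rfl rfl ψ hψ
  have h₁ : mapc (m ≫ r ≫ r') rfl rfl (mapc r' rfl rfl ψ) ≫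
      b.freeAct y (Category.assoc y r r').symm rfl =
      b.freeAct x (Category.assoc x r r').symm rfl ≫ mapc r' rfl rfl ψ := by
    rw [← pushAct_freeAct a b x rfl, ← pushAct_freeAct a b y rfl]
    exact pushAct_naturality a b hψ
  obtain ⟨χ, hχ, hχ'⟩ := hF _ _ rfl rfl _ h₁
  refine ⟨χ, hF'.mapc_injective rfl rfl ?_, fun χ₁ h => hχ' χ₁ ?_⟩
  · rw [mapc_mapc r r' rfl]
    exact hχ
  · rw [← h]
    exact (mapc_mapc r r' rfl _ _ _ _ _ _ χ₁).symm

/-- A 2-cell into a carrier `x ; r` is a morphism of algebras for the monad of `ℓ ⊣ r` as soon as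
it induces a morphism of algebras for the monad of `m ⊣ (r ; r')`. -/
theorem mapc_comp_freeAct_of_pushAct (hF' : a'.FullyFaithful) (hF : b.FullyFaithful) {e : A ⟶ D}
    {k : Gen (Chain.nil A) (e ≫ l ≫ r) e} (hk : a.IsAction e k) {x : B ⟶ C} {f : B ⟶ D}
    (hx : x ≫ r = f) (hx' : x ≫ r ≫ r' = f ≫ r')
    (β : Elt.mk e ⟶ Elt.mk f)
    (hβ : mapc (m ≫ r ≫ r') rfl rfl (mapc r' rfl rfl β) ≫ b.freeAct x hx' rfl =
      pushAct a b (hom k) ≫ mapc r' rfl rfl β) :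
    mapc (l ≫ r) rfl rfl β ≫ a.freeAct x hx rfl = hom k ≫ β := by
  have h₀ : (e ≫ l) ≫ r ≫ r' = (e ≫ l ≫ r) ≫ r' := by simp
  have h₁ : mapc (m ≫ r ≫ r') rfl rfl (mapc r' rfl rfl (hom k ≫ β)) ≫ b.freeAct x hx' rfl =
      b.freeAct (e ≫ l) h₀ rfl ≫ mapc r' rfl rfl (hom k ≫ β) := by
    rw [mapc_comp r' rfl rfl rfl, mapc_comp (m ≫ r ≫ r') rfl rfl rfl, Elt.assoc, hβ, ← Elt.assoc,
      pushAct_action a b hk, Elt.assoc]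
  -- The composite `k ; β` goes from the free algebra on `e` to the algebra at `x`, so it lifts to
  -- some `χ : (e ; ℓ) → x`. The unit law then identifies `χ` as the transpose `ℓ(β) ; ε` of `β`,
  -- and applying `r` gives the claim.
  obtain ⟨χ, hχ, -⟩ := hF _ _ rfl rfl _ h₁
  have h₂ : mapc r (Category.assoc e l r) hx χ = hom k ≫ β := by
    apply hF'.mapc_injective rfl rfl
    rw [mapc_mapc r r' rfl]
    exact hχ
  have h₃ : f ≫ l = x ≫ r ≫ l := by rw [← hx]; simp
  have h₅ : (x ≫ r ≫ l) ≫ r = f ≫ l ≫ r := by rw [← hx]; simp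
  have h₄ : mapc l rfl h₃ β ≫ wh x a.eps rfl (Category.comp_id x) = χ := by
    have := flat_sharp_hom a rfl hx h₃ rfl (Category.comp_id x) (Category.comp_id e) rfl
      (Category.assoc e l r) χ
    rwa [h₂, ← Elt.assoc, hk.unit, Category.id_comp] at this
  rw [← h₂, ← h₄, mapc_comp r (Category.assoc e l r) h₅ hx,
    mapc_mapc l r rfl _ _ _ _ rfl rfl]
  rfl

theorem StrictlyBijective.cancel (hF' : a'.FullyFaithful) (hS' : a'.StrictlyBijective)
    (hF : b.FullyFaithful) (hS : b.StrictlyBijective) : a.StrictlyBijective := by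
  intro A e k hk
  obtain ⟨κ, hκ, hκ'⟩ := isAction_pushAct a b hk
  obtain ⟨x, ⟨h₁, h₂⟩, hx⟩ := hS hκ
  have h₃ : x ≫ r = e := by
    obtain ⟨k', hk', hk''⟩ := a'.isAction_freeAct e
    have h₀ : (x ≫ r) ≫ r' = e ≫ r' := (Category.assoc x r r').trans h₁
    -- Both `x ; r` and `e` classify the same `(ℓ' ; r')`-algebra on `e ; r'`, namely the
    -- restriction along `omega` of the common action of `(m ; r ; r')`.
    refine (hS' hk').unique ⟨h₀, ?_⟩ ⟨rfl, hk''.symm⟩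
    rw [hk'', ← wh_omega_pushAct a b a' hk.unit, ← hκ', ← h₂]
    exact (wh_omega_freeAct a x h₁ h₀).symm
  refine ⟨x, ⟨h₃, ?_⟩, ?_⟩
  -- The identity of `e` is a morphism between the pushed actions, hence between the original ones,
  -- which must therefore agree.
  · have := mapc_comp_freeAct_of_pushAct hF' hF hk h₃ h₁ (𝟙 _) (by
      rw [mapc_one, mapc_one, Category.id_comp, Category.comp_id, h₂, hκ'])
    rwa [mapc_one, Category.id_comp, Category.comp_id] at this
  · rintro y ⟨h₄, h₅⟩
    have h₆ : y ≫ r ≫ r' = e ≫ r' := by rw [← h₄]; simp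
    refine hx y ⟨h₆, ?_⟩
    rw [hκ', ← h₅, pushAct_freeAct a b y h₄ h₆]

theorem EssentiallySurjective.cancel (hF' : a'.FullyFaithful) (hF : b.FullyFaithful)
    (hS : b.EssentiallySurjective) : a.EssentiallySurjective := by
  intro A e k hk
  obtain ⟨κ, hκ, hκ'⟩ := isAction_pushAct a b hk
  obtain ⟨x, α, β, h₁, h₂, h₃⟩ := hS hκ
  have h₀ : x ≫ r ≫ r' = (x ≫ r) ≫ r' := (Category.assoc x r r').symm
  -- The isomorphism is transported along the associativity equality of carriers, so that its
  -- boundary is visibly in the image of `r'`.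
  obtain ⟨α, β, h₁, h₂, h₃⟩ : ∃ (α : Gen (Chain.nil A) ((x ≫ r) ≫ r') (e ≫ r'))
      (β : Gen (Chain.nil A) (e ≫ r') ((x ≫ r) ≫ r')), hom α ≫ hom β = 𝟙 _ ∧
      hom β ≫ hom α = 𝟙 _ ∧
      mapc (m ≫ r ≫ r') rfl rfl (hom α) ≫ hom κ = b.freeAct x h₀ rfl ≫ hom α := by
    have : ∀ g (hg : x ≫ r ≫ r' = g), ∃ (α : Gen (Chain.nil A) g (e ≫ r'))
        (β : Gen (Chain.nil A) (e ≫ r') g), hom α ≫ hom β = 𝟙 _ ∧ hom β ≫ hom α = 𝟙 _ ∧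
        mapc (m ≫ r ≫ r') rfl rfl (hom α) ≫ hom κ = b.freeAct x hg rfl ≫ hom α := by
      rintro g rfl
      exact ⟨α, β, h₁, h₂, h₃⟩
    exact this _ h₀
  have h₄ := mapc_comp_of_inverse rfl rfl h₁ h₂ h₃
  have hx := wh_eta_freeAct (a := a) x rfl
  rw [hκ'] at h₃ h₄
  obtain ⟨α', hα, -⟩ := existsUnique_of_pushAct hF' hx hk.unit (hom α)
    (by rw [pushAct_freeAct a b x rfl h₀, h₃])
  obtain ⟨β', hβ, -⟩ := existsUnique_of_pushAct hF' hk.unit hx (hom β)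
    (by rw [pushAct_freeAct a b x rfl h₀, h₄])
  obtain ⟨α', rfl⟩ := exists_hom_of_mapc_eq hα
  obtain ⟨β', rfl⟩ := exists_hom_of_mapc_eq hβ
  have h₅ : hom α' ≫ hom β' = 𝟙 _ := by
    apply hF'.mapc_injective rfl rfl
    rw [mapc_comp r' rfl rfl rfl, hα, hβ, h₁, mapc_one]
  have h₆ : hom β' ≫ hom α' = 𝟙 _ := by
    apply hF'.mapc_injective rfl rfl
    rw [mapc_comp r' rfl rfl rfl, hα, hβ, h₂, mapc_one]
  -- `mapc_comp_freeAct_of_pushAct` applies to morphisms into a carrier of the form `x ; r`, so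
  -- compatibility is proved for `β'` and then passed to its inverse `α'`.
  exact ⟨x, α', β', h₅, h₆, mapc_comp_of_inverse rfl rfl h₆ h₅
    (mapc_comp_freeAct_of_pushAct hF' hF hk rfl h₀ (hom β') (by rw [hβ, h₄]))⟩

end Cancellation

end RelativeAdjunction

end FormalCat

theorem mainTheorem12 {X : Type u} [FormalCat.VirtualEquipment.{u, v, w, z} X] {C D E : X}
    (l : D ⟶ C) (r : C ⟶ D) (adj : FormalCat.Adjunction l r)
    (l' : E ⟶ D) (r' : D ⟶ E) (adj' : FormalCat.Adjunction l' r')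
    (hT : adj.monad.AdmitsAlgebraObject) :
    (FormalCat.StrictlyMonadic r' → FormalCat.StrictlyMonadic (r ≫ r') →
      FormalCat.StrictlyMonadic r) ∧
    (FormalCat.NonstrictlyMonadic r' → FormalCat.NonstrictlyMonadic (r ≫ r') →
      FormalCat.NonstrictlyMonadic r) := by
  constructor
  · intro h h'
    obtain ⟨_, _, hF, hS⟩ := FormalCat.RelativeAdjunction.exists_of_strictlyMonadic h
    obtain ⟨_, _, hF', hS'⟩ := FormalCat.RelativeAdjunction.exists_of_strictlyMonadic h'
    exact FormalCat.RelativeAdjunction.strictlyMonadic (a := adj)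
      (FormalCat.RelativeAdjunction.FullyFaithful.cancel hF hF')
      (FormalCat.RelativeAdjunction.StrictlyBijective.cancel hF hS hF' hS')
  · intro h h'
    obtain ⟨_, _, hF, -⟩ := FormalCat.RelativeAdjunction.exists_of_nonstrictlyMonadic h
    obtain ⟨_, _, hF', hS'⟩ := FormalCat.RelativeAdjunction.exists_of_nonstrictlyMonadic h'
    exact FormalCat.RelativeAdjunction.nonstrictlyMonadic (a := adj)
      (FormalCat.RelativeAdjunction.FullyFaithful.cancel hF hF')
      (FormalCat.RelativeAdjunction.EssentiallySurjective.cancel hF hF' hS') hT
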